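/- Let $(R,\mathfrak m,k)$ be a regular local ring. For an ideal $I\subset R$ and an ideal $\mathbf x$ generated by a maximal $R$-sequence contained in $I$, the canonical module of $R/I$ is $\Omega=\operatorname{Hom}_R(R/I,R/\mathbf x)$; it embeds in $R/\mathbf x$ by $f\mapsto f(1)$, and $\operatorname{Tor}^R_i(\Omega,k)\to\operatorname{Tor}^R_i(R/\mathbf x,k)$ denotes the map induced by this embedding. For a finitely generated module $M$ with minimal free resolution $(L_\bullet,c_\bullet)$, put $\operatorname{Syz}^i(M)=\operatorname{coker}(c_{i+1})$, which is $M$ for $i=0$ and is isomorphic to $\operatorname{im}(c_i)\subset L_{i-1}$ for $i\ge1$. "Free summand" means nonzero free direct summand. Let $d\ge0$. (1) Let $J=(x_1,\dots,x_d,\lambda)$ be an ideal of height $d$ with $x_1,\dots,x_d$ an $R$-sequence (for instance any almost complete intersection ideal of height $d$, for a suitable choice of generators), let $\mathbf x=(x_1,\dots,x_d)$ and $\Omega=\operatorname{Hom}_R(R/J,R/\mathbf x)$. Let $K_\bullet(J;R)$ be the Koszul complex on $x_1,\dots,x_d,\lambda$, and let $K_{d+1}(J;R)\otimes k\to\operatorname{Tor}^R_{d+1}(R/J,k)$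 be the map induced by any comparison map from $K_\bullet(J;R)$ to a free resolution of $R/J$ over the identity of $R/J$. If this map is zero, then $\operatorname{Syz}^d(\Omega)$ has a free summand. (2) Conversely, let $I$ be an ideal of height $d$ such that $R/I$ satisfies Serre's condition $S_2$, let $\mathbf x$ be the ideal generated by a maximal $R$-sequence contained in $I$, and let $\Omega=\operatorname{Hom}_R(R/I,R/\mathbf x)$ be the canonical module of $R/I$. If $\operatorname{Syz}^d(\Omega)$ has a free summand, then $\operatorname{Tor}^R_d(\Omega,k)\to\operatorname{Tor}^R_d(R/\mathbf x,k)$ is nonzero. -/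

import Mathlib

universe u v

open CategoryTheory MonoidalCategory IsLocalRing RingTheory.Sequence

noncomputable section

namespace DuttaSyz

/-! ### Comparison of a complex of projectives with a projective resolution -/

section Comparison

variable {C : Type*} [Category C] [Abelian C]

/-- The augmentation `P₀ → X` of a projective resolution. -/
def resolutionAug {X : C} (P : ProjectiveResolution X) : P.complex.X 0 ⟶ X := P.π.f 0

instance {X : C} (P : ProjectiveResolution X) : Epi (resolutionAug P) :=
  (inferInstance : Epi (P.π.f 0))

/-- If `K` is a nonnegative complex of projectives with an augmentation `ε : K₀ → X` and `P` is a
projective resolution of `X`, this is a chain map `K → P` over the identity of `X`. By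
`comparison_unique` it is unique up to homotopy. -/
def comparison {X : C} (K : ChainComplex C ℕ) [∀ n, Projective (K.X n)] (ε : K.X 0 ⟶ X)
    (hε : K.d 1 0 ≫ ε = 0) (P : ProjectiveResolution X) : K ⟶ P.complex :=
  ChainComplex.mkHom K P.complex
    (Projective.factorThru ε (resolutionAug P))
    (P.exact₀.liftFromProjective (K.d 1 0 ≫ Projective.factorThru ε (resolutionAug P))
      (by
        change (K.d 1 0 ≫ Projective.factorThru ε (resolutionAug P)) ≫ resolutionAug P = 0
        rw [Category.assoc, Projective.factorThru_comp, hε]))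
    (P.exact₀.liftFromProjective_comp _ _)
    (fun n s => ⟨(P.exact_succ n).liftFromProjective (K.d (n + 2) (n + 1) ≫ s.2.1)
        (by
          change (K.d (n + 2) (n + 1) ≫ s.2.1) ≫ P.complex.d (n + 1) n = 0
          rw [Category.assoc, s.2.2, K.d_comp_d_assoc, Limits.zero_comp]),
      (P.exact_succ n).liftFromProjective_comp _ _⟩)

theorem comparison_aug {X : C} (K : ChainComplex C ℕ) [∀ n, Projective (K.X n)]
    (ε : K.X 0 ⟶ X) (hε : K.d 1 0 ≫ ε = 0) (P : ProjectiveResolution X) :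
    (comparison K ε hε P).f 0 ≫ resolutionAug P = ε := by
  rw [comparison, ChainComplex.mkHom_f_0]
  exact Projective.factorThru_comp _ _

theorem comparison_unique {X : C} {K : ChainComplex C ℕ} [∀ n, Projective (K.X n)]
    {P : ProjectiveResolution X} (f g : K ⟶ P.complex)
    (h : f.f 0 ≫ resolutionAug P = g.f 0 ≫ resolutionAug P) : Nonempty (Homotopy f g) := by
  suffices H : ∀ f : K ⟶ P.complex, f.f 0 ≫ resolutionAug P = 0 → Nonempty (Homotopy f 0) by
    obtain ⟨e⟩ := H (f - g) (by
      rw [HomologicalComplex.sub_f_apply, Preadditive.sub_comp, h, sub_self])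
    exact ⟨Homotopy.equivSubZero.invFun e⟩
  intro f hf
  obtain ⟨h0, e0⟩ : ∃ h0 : K.X 0 ⟶ P.complex.X 1, h0 ≫ P.complex.d 1 0 = f.f 0 :=
    ⟨_, P.exact₀.liftFromProjective_comp (f.f 0) hf⟩
  obtain ⟨h1, e1⟩ : ∃ h1 : K.X 1 ⟶ P.complex.X 2,
      h1 ≫ P.complex.d 2 1 = f.f 1 - K.d 1 0 ≫ h0 :=
    ⟨_, (P.exact_succ 0).liftFromProjective_comp (f.f 1 - K.d 1 0 ≫ h0) (by
      change (f.f 1 - K.d 1 0 ≫ h0) ≫ P.complex.d 1 0 = 0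
      rw [Preadditive.sub_comp, Category.assoc, e0, f.comm, sub_self])⟩
  have hs (n : ℕ) (g : K.X n ⟶ P.complex.X (n + 1)) (g' : K.X (n + 1) ⟶ P.complex.X (n + 2))
      (w : f.f (n + 1) = K.d (n + 1) n ≫ g + g' ≫ P.complex.d (n + 2) (n + 1)) :
      ∃ g'' : K.X (n + 2) ⟶ P.complex.X (n + 3),
        f.f (n + 2) = K.d (n + 2) (n + 1) ≫ g' + g'' ≫ P.complex.d (n + 3) (n + 2) :=
    ⟨_, (add_eq_of_eq_sub' ((P.exact_succ (n + 1)).liftFromProjective_comp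
      (f.f (n + 2) - K.d (n + 2) (n + 1) ≫ g') (by
        change (f.f (n + 2) - K.d (n + 2) (n + 1) ≫ g') ≫ P.complex.d (n + 2) (n + 1) = 0
        simp [w]))).symm⟩
  exact ⟨Homotopy.mkInductive f h0 e0.symm h1 (add_eq_of_eq_sub' e1).symm
    fun n s => ⟨(hs n s.1 s.2.1 s.2.2).choose, (hs n s.1 s.2.1 s.2.2).choose_spec⟩⟩

end Comparison

/-! ### Koszul complexes -/

section Koszul

variable {R : Type u} [CommRing R]

section LinearForm

variable {M : Type u} [AddCommGroup M] [Module R M]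

theorem contractLeft_mem_smul (φ : Module.Dual R M) (I : Ideal R) (hI : ∀ v, φ v ∈ I) (n : ℕ) :
    ∀ z ∈ ⋀[R]^(n + 1) M,
      CliffordAlgebra.contractLeft (Q := (0 : QuadraticForm R M)) φ z ∈ I • ⋀[R]^n M := by
  induction n with
  | zero =>
    intro z hz
    rw [zero_add, ExteriorAlgebra.exteriorPower, pow_one] at hz
    obtain ⟨v, rfl⟩ := hz
    rw [ExteriorAlgebra.exteriorPower, pow_zero]
    have h := CliffordAlgebra.contractLeft_ι (Q := (0 : QuadraticForm R M)) φ v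
    rw [show CliffordAlgebra.contractLeft (Q := (0 : QuadraticForm R M)) φ
      (ExteriorAlgebra.ι R v) = _ from h, Algebra.algebraMap_eq_smul_one]
    exact Submodule.smul_mem_smul (hI v) (Submodule.one_le.mp le_rfl)
  | succ n ih =>
    intro z hz
    rw [ExteriorAlgebra.exteriorPower, pow_succ'] at hz
    refine Submodule.mul_induction_on hz ?_ ?_
    · rintro _ ⟨v, rfl⟩ w hw
      have h := CliffordAlgebra.contractLeft_ι_mul (Q := (0 : QuadraticForm R M)) φ v w
      rw [show CliffordAlgebra.contractLeft (Q := (0 : QuadraticForm R M)) φ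
        (ExteriorAlgebra.ι R v * w) = _ from h]
      refine Submodule.sub_mem _ (Submodule.smul_mem_smul (hI v) hw) ?_
      refine Submodule.smul_induction_on (ih w hw) ?_ ?_
      · intro r hr y hy
        rw [mul_smul_comm]
        refine Submodule.smul_mem_smul hr ?_
        rw [ExteriorAlgebra.exteriorPower, pow_succ']
        exact Submodule.mul_mem_mul ⟨v, rfl⟩ hy
      · intro a b ha hb
        rw [mul_add]
        exact Submodule.add_mem _ ha hb
    · intro a b ha hb
      rw [map_add]
      exact Submodule.add_mem _ ha hb

/-- The Koszul differential `⋀ⁿ⁺¹ M → ⋀ⁿ M` of a linear form `φ : M → R`: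
`v₀ ∧ ⋯ ∧ vₙ ↦ ∑ (-1)ⁱ φ(vᵢ) v₀ ∧ ⋯ v̂ᵢ ⋯ ∧ vₙ`. -/
def koszulD (φ : Module.Dual R M) (n : ℕ) : ⋀[R]^(n + 1) M →ₗ[R] ⋀[R]^n M :=
  (CliffordAlgebra.contractLeft (Q := (0 : QuadraticForm R M)) φ).restrict
    (fun z hz => Submodule.smul_le_right (contractLeft_mem_smul φ ⊤ (fun _ => trivial) n z hz))

theorem koszulD_comp (φ : Module.Dual R M) (n : ℕ) :
    koszulD φ n ∘ₗ koszulD φ (n + 1) = 0 := by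
  refine LinearMap.ext fun z => Subtype.ext ?_
  exact CliffordAlgebra.contractLeft_contractLeft (Q := (0 : QuadraticForm R M)) φ z.1

theorem koszulD_mem_smul (φ : Module.Dual R M) (I : Ideal R) (hI : ∀ v, φ v ∈ I) (n : ℕ)
    (z : ⋀[R]^(n + 1) M) : koszulD φ n z ∈ I • (⊤ : Submodule R (⋀[R]^n M)) :=
  (Submodule.mem_smul_top_iff _ _ _).mpr (contractLeft_mem_smul φ I hI n z.1 z.2)

end LinearForm

variable {m : ℕ} (a : Fin m → R)

/-- The Koszul complex `K_•(a; R)` of a family `a₁, …, aₘ`: the exterior algebra of `Rᵐ` with the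
differential given by the linear form `eᵢ ↦ aᵢ`. -/
def koszulComplex : ChainComplex (ModuleCat.{u} R) ℕ :=
  ChainComplex.of (fun n => ModuleCat.of R (⋀[R]^n (Fin m → R)))
    (fun n => ModuleCat.ofHom (koszulD (Fintype.linearCombination R a) n))
    (fun n => by
      rw [← ModuleCat.ofHom_comp, koszulD_comp]
      rfl)

theorem koszulComplex_d (n : ℕ) : (koszulComplex a).d (n + 1) n =
    ModuleCat.ofHom (koszulD (Fintype.linearCombination R a) n) :=
  ChainComplex.of_d (fun n => ModuleCat.of R (⋀[R]^n (Fin m → R)))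
    (fun n => ModuleCat.ofHom (koszulD (Fintype.linearCombination R a) n)) n

instance koszulComplex_projective (n : ℕ) : Projective ((koszulComplex a).X n) :=
  ModuleCat.projective_of_categoryTheory_projective
    (R := R) (ModuleCat.of R (⋀[R]^n (Fin m → R)))

/-- The augmentation `K₀(a; R) = R → R/(a)`. -/
def koszulAug :
    (koszulComplex a).X 0 ⟶ ModuleCat.of R (R ⧸ Ideal.span (Set.range a)) :=
  ModuleCat.ofHom
    ((Ideal.span (Set.range a)).mkQ ∘ₗ (exteriorPower.zeroEquiv R (Fin m → R)).toLinearMap)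

theorem linearCombination_mem_span (v : Fin m → R) :
    Fintype.linearCombination R a v ∈ Ideal.span (Set.range a) := by
  rw [Fintype.linearCombination_apply]
  exact Ideal.sum_mem _ fun i _ => Ideal.mul_mem_left _ _ (Ideal.subset_span ⟨i, rfl⟩)

theorem koszulD_zero_mem (z : ⋀[R]^(0 + 1) (Fin m → R)) :
    exteriorPower.zeroEquiv R (Fin m → R) (koszulD (Fintype.linearCombination R a) 0 z) ∈
      Ideal.span (Set.range a) := by
  refine Submodule.smul_induction_on (koszulD_mem_smul (Fintype.linearCombination R a) _
    (linearCombination_mem_span a) 0 z) ?_ ?_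
  · intro r hr y _
    rw [map_smul]
    exact Ideal.mul_mem_right _ _ hr
  · intro y y' hy hy'
    rw [map_add]
    exact add_mem hy hy'

theorem koszulComplex_d_aug : (koszulComplex a).d 1 0 ≫ koszulAug a = 0 := by
  rw [koszulComplex_d a 0]
  apply ModuleCat.hom_ext
  apply LinearMap.ext
  intro z
  exact (Submodule.Quotient.mk_eq_zero _).mpr (koszulD_zero_mem a z)

variable [IsLocalRing R]

/-- The complex `K_•(a; R) ⊗ k`, where `k` is the residue field. -/
abbrev koszulTensorResidue : ChainComplex (ModuleCat.{u} R) ℕ :=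
  (((tensoringRight (ModuleCat.{u} R)).obj
    (ModuleCat.of R (ResidueField R))).mapHomologicalComplex _).obj (koszulComplex a)

/-- If all `aᵢ` lie in the maximal ideal, the differential of `K_•(a; R) ⊗ k` vanishes. -/
theorem koszulTensorResidue_d (ha : ∀ i, a i ∈ maximalIdeal R) (i j : ℕ) :
    (koszulTensorResidue a).d i j = 0 := by
  by_cases hij : j + 1 = i
  · subst hij
    change (koszulComplex a).d (j + 1) j ▷ (ModuleCat.of R (ResidueField R)) = 0
    rw [koszulComplex_d]
    apply ModuleCat.hom_ext
    refine TensorProduct.ext' fun z c => ?_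
    change (koszulD (Fintype.linearCombination R a) j z) ⊗ₜ[R] c = 0
    have hm : ∀ v, Fintype.linearCombination R a v ∈ maximalIdeal R := fun v =>
      (Ideal.span_le.mpr (by rintro _ ⟨i, rfl⟩; exact ha i)) (linearCombination_mem_span a v)
    refine Submodule.smul_induction_on (koszulD_mem_smul _ _ hm j z) ?_ ?_
    · intro r hr y _
      rw [TensorProduct.smul_tmul, Algebra.smul_def,
        show algebraMap R (ResidueField R) r = 0 from (residue_eq_zero_iff r).mpr hr,
        zero_mul, TensorProduct.tmul_zero]
    · intro y y' hy hy'
      rw [TensorProduct.add_tmul, hy, hy', add_zero]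
  · exact (koszulTensorResidue a).shape i j hij

/-- The natural map `K_n(a; R) ⊗ k → Tor_n(R/(a), k)`, for `a₁, …, aₘ` in the maximal ideal. Since
the differential of `K_• ⊗ k` is zero, `K_n ⊗ k` consists of cycles; they are sent to
`Tor_n(R/(a), k) = H_n(P_• ⊗ k)` by the comparison map from `K_•` to a projective resolution
`P_•` of `R/(a)`. -/
def koszulToTor (ha : ∀ i, a i ∈ maximalIdeal R) (n : ℕ) :
    (koszulTensorResidue a).X n ⟶
      ((Tor' (ModuleCat.{u} R) n).obj (ModuleCat.of R (R ⧸ Ideal.span (Set.range a)))).obj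
        (ModuleCat.of R (ResidueField R)) :=
  let F := (tensoringRight (ModuleCat.{u} R)).obj (ModuleCat.of R (ResidueField R))
  let P := projectiveResolution (ModuleCat.of R (R ⧸ Ideal.span (Set.range a)))
  let φ : koszulComplex a ⟶ P.complex :=
    comparison (koszulComplex a) (koszulAug a) (koszulComplex_d_aug a) P
  (koszulTensorResidue a).liftCycles (𝟙 _) _ rfl (by
      rw [koszulTensorResidue_d a ha, Limits.comp_zero]) ≫
    (koszulTensorResidue a).homologyπ n ≫
    HomologicalComplex.homologyMap ((F.mapHomologicalComplex _).map φ) n ≫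
    (P.isoLeftDerivedObj F n).inv

end Koszul

/-! ### Minimal free resolutions, syzygies and free summands -/

section Syzygies

variable (R : Type u) [CommRing R]

/-- A minimal free resolution `⋯ → R^{b₂} → R^{b₁} → R^{b₀} → M → 0` over a local ring, by free
modules of finite rank: it is exact and the differentials have entries in the maximal ideal. -/
structure MinimalFreeResolution [IsLocalRing R] (M : Type v) [AddCommGroup M] [Module R M] where
  rank : ℕ → ℕ
  d (n : ℕ) : (Fin (rank (n + 1)) → R) →ₗ[R] (Fin (rank n) → R)
  aug : (Fin (rank 0) → R) →ₗ[R] M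
  aug_surjective : Function.Surjective aug
  exact_aug : Function.Exact (d 0) aug
  exact_d (n : ℕ) : Function.Exact (d (n + 1)) (d n)
  minimal (n : ℕ) : LinearMap.range (d n) ≤ maximalIdeal R • ⊤

variable {R}

/-- The `n`-th syzygy module `Syzⁿ(M) = coker (L_{n+1} → L_n)` in a minimal free resolution `L`. By
exactness it is `M` for `n = 0`, and the image of `L_n → L_{n-1}` for `n ≥ 1`. -/
abbrev MinimalFreeResolution.Syz [IsLocalRing R] {M : Type v} [AddCommGroup M] [Module R M]
    (L : MinimalFreeResolution R M) (n : ℕ) : Type u :=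
  (Fin (L.rank n) → R) ⧸ LinearMap.range (L.d n)

theorem exists_minimal_cover {R : Type u} [CommRing R] [IsLocalRing R] (M : Type v)
    [AddCommGroup M] [Module R M] [Module.Finite R M] :
    ∃ (n : ℕ) (f : (Fin n → R) →ₗ[R] M), Function.Surjective f ∧
      LinearMap.ker f ≤ maximalIdeal R • ⊤ := by
  let b := Module.finBasis (ResidueField R) (TensorProduct R (ResidueField R) M)
  have hs : Function.Surjective (TensorProduct.mk R (ResidueField R) M 1) :=
    TensorProduct.mk_surjective R M (ResidueField R) residue_surjective
  choose v hv using fun i => hs (b i)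
  refine ⟨_, Fintype.linearCombination R v, ?_, ?_⟩
  · rw [← LinearMap.range_eq_top, Fintype.range_linearCombination]
    exact IsLocalRing.span_eq_top_of_tmul_eq_basis v b hv
  · intro r hr
    have h : ∑ i, residue R (r i) • b i = 0 := by
      have := congrArg (TensorProduct.mk R (ResidueField R) M 1) (LinearMap.mem_ker.mp hr)
      rw [Fintype.linearCombination_apply, map_sum, map_zero] at this
      rw [← this]
      refine Finset.sum_congr rfl fun i _ => ?_
      rw [map_smul, hv]
      exact algebraMap_smul (ResidueField R) (r i) (b i)
    have h' := Fintype.linearIndependent_iff.mp b.linearIndependent _ h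
    rw [← Finset.univ_sum_single r]
    refine Submodule.sum_mem _ fun i _ => ?_
    rw [show Pi.single i (r i) = r i • (Pi.single i 1 : Fin _ → R) by
      rw [← Pi.single_smul, smul_eq_mul, mul_one]]
    exact Submodule.smul_mem_smul ((residue_eq_zero_iff _).mp (h' i)) trivial

/-- Every finitely generated module over a noetherian local ring has a minimal free resolution. -/
theorem nonempty_minimalFreeResolution {R : Type u} [CommRing R] [IsLocalRing R]
    [IsNoetherianRing R] (M : Type v) [AddCommGroup M] [Module R M] [Module.Finite R M] :
    Nonempty (MinimalFreeResolution R M) := by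
  obtain ⟨n₀, f₀, hf₀, hk₀⟩ := exists_minimal_cover (R := R) M
  have step : ∀ s : Σ n : ℕ, Submodule R (Fin n → R),
      ∃ (m : ℕ) (g : (Fin m → R) →ₗ[R] (Fin s.1 → R)),
      LinearMap.range g = s.2 ∧ LinearMap.ker g ≤ maximalIdeal R • ⊤ := by
    rintro ⟨n, S⟩
    obtain ⟨m, g, hg, hk⟩ := exists_minimal_cover (R := R) S
    refine ⟨m, S.subtype ∘ₗ g, ?_, ?_⟩
    · rw [LinearMap.range_comp, LinearMap.range_eq_top.mpr hg, Submodule.map_top,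
        Submodule.range_subtype]
    · rwa [LinearMap.ker_comp, Submodule.ker_subtype, ← LinearMap.ker]
  choose m g hg hk using step
  let s : ℕ → Σ n : ℕ, Submodule R (Fin n → R) := fun n =>
    Nat.rec ⟨n₀, LinearMap.ker f₀⟩ (fun _ t => ⟨m t, LinearMap.ker (g t)⟩) n
  have hs : ∀ n, (s n).2 ≤ maximalIdeal R • ⊤ := by
    rintro (_ | n)
    · exact hk₀
    · exact hk (s n)
  exact ⟨{
    rank := fun n => (s n).1
    d := fun n => g (s n)
    aug := f₀
    aug_surjective := hf₀
    exact_aug := LinearMap.exact_iff.mpr (hg (s 0)).symm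
    exact_d := fun n => LinearMap.exact_iff.mpr (hg (s (n + 1))).symm
    minimal := fun n => (hg (s n)).le.trans (hs n) }⟩

variable (R)

/-- `M` has a nonzero free direct summand. -/
def HasFreeSummand (M : Type v) [AddCommGroup M] [Module R M] : Prop :=
  ∃ N N' : Submodule R M, IsCompl N N' ∧ N ≠ ⊥ ∧ Module.Free R N

end Syzygies

/-! ### The condition `Sₙ`, maximal regular sequences, canonical modules -/

section Canonical

variable {R : Type u} [CommRing R]

/-- Serre's condition `Sₙ` for a noetherian ring `A`: `depth A_p ≥ min (n, dim A_p)` for every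
prime `p`, i.e. there is an `A_p`-regular sequence of at least that length. -/
def SerreCondition (n : ℕ) (A : Type u) [CommRing A] : Prop :=
  ∀ (p : Ideal A) [p.IsPrime], ∃ rs : List (Localization.AtPrime p),
    IsRegular (Localization.AtPrime p) rs ∧
      min (n : WithBot ℕ∞) (ringKrullDim (Localization.AtPrime p)) ≤ rs.length

/-- `xs` is a maximal `R`-sequence in the ideal `I`. -/
structure IsMaximalRegularSequence (I : Ideal R) (xs : List R) : Prop where
  regular : IsRegular R xs
  mem : ∀ x ∈ xs, x ∈ I
  maximal : ∀ y ∈ I, ¬ IsRegular R (xs ++ [y])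

/-- `Ω = Hom_R(R/I, R/X)`. When `R` is a regular local ring and `X ⊆ I` is generated by a maximal
`R`-sequence in `I`, this is the canonical module of `R/I`. -/
abbrev CanonicalModule (I X : Ideal R) : Type u := (R ⧸ I) →ₗ[R] (R ⧸ X)

/-- The natural injection `Ω = Hom_R(R/I, R/X) → R/X`, `f ↦ f 1`, whose image is `(X : I)/X`. -/
def canonicalInclusion (I X : Ideal R) : CanonicalModule I X →ₗ[R] (R ⧸ X) :=
  LinearMap.applyₗ (1 : R ⧸ I)

/-- The map `Tor_n(Ω, k) → Tor_n(R/X, k)` induced by `Ω → R/X`. -/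
def canonicalTorMap [IsLocalRing R] (I X : Ideal R) (n : ℕ) :
    ((Tor' (ModuleCat.{u} R) n).obj (ModuleCat.of R (CanonicalModule I X))).obj
        (ModuleCat.of R (ResidueField R)) ⟶
      ((Tor' (ModuleCat.{u} R) n).obj (ModuleCat.of R (R ⧸ X))).obj
        (ModuleCat.of R (ResidueField R)) :=
  ((Tor' (ModuleCat.{u} R) n).map (ModuleCat.ofHom (canonicalInclusion I X))).app
    (ModuleCat.of R (ResidueField R))

end Canonical

end DuttaSyz

end

/-! Both parts compare the minimal resolution `L` of Ω with the Koszul complex C of the regular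
sequence 𝐱. C resolves R/𝐱 and ends in degree d with C_d = R, so the top component of a chain map L
→ C is a functional on L_d killing the image of L_{d+1}, i.e. a functional on Syzᵈ(Ω). A free
summand of the syzygy amounts to a surjective functional.

For (1), let γ : L → C lift the inclusion Ω → R/𝐱. Since J = 𝐱 + (λ), the kernel of λ on R/𝐱 is the
image of Ω. Hence the cone of γ resolves (R/𝐱)/Ω, and the cone of a lift β : cone γ → C of
multiplication by λ resolves R/J. The Koszul complex of J is the cone of λ on C and maps into cone
β; its generator in degree d + 1 lands in a summand C_d, which boundaries reach only through ±γ_d.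
If γ_d took no unit value, the projection to C_d ⊗ k would be a cocycle detecting that generator,
against the vanishing hypothesis (`exists_isUnit_kosTop`). So γ_d takes a unit value and splits off
a summand.

For (2), start from a surjective functional on Syzᵈ(Ω). The elements of 𝐱 annihilate Ω, so they act
null-homotopically on L, and the functional is the top component of a chain map w : L → C
(`exists_chainMap_kos`). The induced map Ω → R/𝐱 is a multiple r of the inclusion, so w is homotopic
to r·f for any lift f of the inclusion. In degree d the homotopy terms vanish modulo 𝔪, by
minimality of L and because C_{d+1} = 0. If the map on Tor_d were zero, w_d would vanish modulo 𝔪,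
contradicting surjectivity (`canonicalTorMap_ne_zero`).

What remains is that S₂ makes every map Ω → R/𝐱 a multiple of the inclusion (`exists_eq_mul`). The
ideal of those s for which s·f is a multiplication is tested at a minimal prime P over it. In
codimension at most one over I the Gorenstein property of R decides (`simpleSocleAt_ofList`); in
higher codimension the depth of (R/I)_P is at least two, and faithfulness of Ω
(`mem_of_forall_mul_mem`) glues two multipliers into one. Equidimensionality of R/I, needed for
both, comes from Hartshorne's connectedness theorem (`SerreCondition.height_eq`). Unmixedness and
simplicity of socles are clear for regular parameters and pass to other regular sequences by
exchanging one element at a time (`RegularOver.exchange`). -/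

namespace DuttaSyz

/-! ### Complexes of modules, elementwise -/

/-- A nonnegative chain complex of `R`-modules. -/
structure ModComplex (R : Type u) [CommRing R] where
  X : ℕ → ModuleCat.{u} R
  d (n : ℕ) : X (n + 1) →ₗ[R] X n
  d_d (n : ℕ) (x : X (n + 2)) : d n (d (n + 1) x) = 0

namespace ModComplex

variable {R : Type u} [CommRing R]

/-- `K` together with `ε : K₀ → M` is a resolution of `M`. -/
structure IsResolution (K : ModComplex R) {M : Type v} [AddCommGroup M] [Module R M]
    (ε : K.X 0 →ₗ[R] M) : Prop where
  surjective : Function.Surjective ε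
  exact_zero : Function.Exact (K.d 0) ε
  exact_succ (n : ℕ) : Function.Exact (K.d (n + 1)) (K.d n)

/-- The family `f` is a chain map. -/
def IsChainMap (K L : ModComplex R) (f : ∀ n, K.X n →ₗ[R] L.X n) : Prop :=
  ∀ n x, L.d n (f (n + 1) x) = f n (K.d n x)

theorem exists_comp_eq_of_range_le {P A B : Type*} [AddCommGroup P] [AddCommGroup A]
    [AddCommGroup B] [Module R P] [Module R A] [Module R B] [Module.Projective R P]
    (a : A →ₗ[R] B) (u : P →ₗ[R] B) (h : ∀ x, u x ∈ LinearMap.range a) :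
    ∃ s : P →ₗ[R] A, ∀ x, a (s x) = u x := by
  obtain ⟨s, hs⟩ := Module.projective_lifting_property a.rangeRestrict
    (u.codRestrict _ h) a.surjective_rangeRestrict
  exact ⟨s, fun x => congrArg Subtype.val (LinearMap.congr_fun hs x)⟩

variable {M N : Type v} [AddCommGroup M] [Module R M] [AddCommGroup N] [Module R N]

theorem exists_chainMap {K L : ModComplex R} [∀ n, Module.Projective R (K.X n)]
    {ε : K.X 0 →ₗ[R] M} {η : L.X 0 →ₗ[R] N} (hK : ∀ x, ε (K.d 0 x) = 0)
    (hL : L.IsResolution η) (g : M →ₗ[R] N) :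
    ∃ f : ∀ n, K.X n →ₗ[R] L.X n, IsChainMap K L f ∧ ∀ x, η (f 0 x) = g (ε x) := by
  obtain ⟨f₀, hf₀⟩ := exists_comp_eq_of_range_le η (g ∘ₗ ε) (fun x => hL.surjective _)
  -- The inductive datum carries the fact that boundaries go to boundaries, which is all the next
  -- lifting needs.
  let S : ℕ → Type u := fun n =>
    {f : K.X n →ₗ[R] L.X n // ∀ x, f (K.d n x) ∈ LinearMap.range (L.d n)}
  have step : ∀ n (s : S n), ∃ t : S (n + 1), ∀ x, L.d n (t.1 x) = s.1 (K.d n x) := by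
    intro n s
    obtain ⟨t, ht⟩ := exists_comp_eq_of_range_le (L.d n) (s.1 ∘ₗ K.d n) s.2
    refine ⟨⟨t, fun x => (hL.exact_succ n _).mp ?_⟩, ht⟩
    rw [ht, LinearMap.comp_apply, K.d_d, map_zero]
  choose t ht using step
  let s₀ : S 0 := ⟨f₀, fun x => (hL.exact_zero _).mp (by
    rw [hf₀, LinearMap.comp_apply, hK, map_zero])⟩
  let s : ∀ n, S n := fun n => Nat.rec s₀ t n
  exact ⟨fun n => (s n).1, fun n x => ht n (s n) x, hf₀⟩

/-- Stated for lifts of zero: applied to a difference it gives uniqueness of lifts, applied to a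
scalar it gives null-homotopies for elements annihilating the resolved module. -/
theorem exists_homotopy {K L : ModComplex R} [∀ n, Module.Projective R (K.X n)]
    {η : L.X 0 →ₗ[R] N} (hL : L.IsResolution η) (f : ∀ n, K.X n →ₗ[R] L.X n)
    (hf : IsChainMap K L f) (h₀ : ∀ x, η (f 0 x) = 0) :
    ∃ s : ∀ n, K.X n →ₗ[R] L.X (n + 1), (∀ x, f 0 x = L.d 0 (s 0 x)) ∧
      ∀ n x, f (n + 1) x = L.d (n + 1) (s (n + 1) x) + s n (K.d n x) := by
  obtain ⟨s₀, hs₀⟩ := exists_comp_eq_of_range_le (L.d 0) (f 0)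
    (fun x => (hL.exact_zero _).mp (h₀ x))
  let S : ℕ → Type u := fun n =>
    {s : K.X n →ₗ[R] L.X (n + 1) // ∀ x, f (n + 1) x - s (K.d n x) ∈ LinearMap.range (L.d (n + 1))}
  have step : ∀ n (s : S n), ∃ t : S (n + 1), ∀ x,
      L.d (n + 1) (t.1 x) = f (n + 1) x - s.1 (K.d n x) := by
    intro n s
    obtain ⟨t, ht⟩ := exists_comp_eq_of_range_le (L.d (n + 1)) (f (n + 1) - s.1 ∘ₗ K.d n)
      (fun x => s.2 x)
    refine ⟨⟨t, fun x => (hL.exact_succ (n + 1) _).mp ?_⟩, ht⟩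
    rw [map_sub, hf, ht]
    simp [K.d_d]
  choose t ht using step
  let z : S 0 := ⟨s₀, fun x => (hL.exact_succ 0 _).mp (by rw [map_sub, hf, hs₀, sub_self])⟩
  let s : ∀ n, S n := fun n => Nat.rec z t n
  exact ⟨fun n => (s n).1, fun x => (hs₀ x).symm, fun n x => by
    rw [show L.d (n + 1) ((s (n + 1)).1 x) = _ from ht n (s n) x, sub_add_cancel]⟩

/-! ### Mapping cones -/

/-- The terms of the mapping cone of a map `K → L`. -/
def coneX (K L : ModComplex R) : ℕ → ModuleCat.{u} R
  | 0 => L.X 0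
  | n + 1 => ModuleCat.of R (K.X n × L.X (n + 1))

/-- The differential of the mapping cone. -/
def coneD {K L : ModComplex R} (f : ∀ n, K.X n →ₗ[R] L.X n) :
    ∀ n, coneX K L (n + 1) →ₗ[R] coneX K L n
  | 0 => (f 0).coprod (L.d 0)
  -- The alternating sign is put on the chain map, so the differentials of `K` and `L` both enter
  -- unsigned.
  | n + 1 => ((K.d n) ∘ₗ LinearMap.fst R _ _).prod
      (((-1 : R) ^ (n + 1) • f (n + 1)).coprod (L.d (n + 1)))

/-- The mapping cone of a chain map. -/
def cone {K L : ModComplex R} (f : ∀ n, K.X n →ₗ[R] L.X n) (hf : IsChainMap K L f) :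
    ModComplex R where
  X := coneX K L
  d := coneD f
  d_d
    | 0, (k, l) => by
      change f 0 (K.d 0 k) + L.d 0 ((-1 : R) ^ (0 + 1) • f (0 + 1) k + L.d (0 + 1) l) = 0
      rw [map_add, map_smul, hf 0 k, L.d_d]
      simp
    | n + 1, (k, l) => by
      refine Prod.ext (K.d_d n k) ?_
      change (-1 : R) ^ (n + 1) • f (n + 1) (K.d (n + 1) k) +
        L.d (n + 1) ((-1 : R) ^ (n + 2) • f (n + 2) k + L.d (n + 2) l) = 0
      rw [map_add, map_smul, hf (n + 1) k, L.d_d, pow_succ _ (n + 1)]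
      simp

variable {K L : ModComplex R} {f : ∀ n, K.X n →ₗ[R] L.X n} (hf : IsChainMap K L f)

theorem cone_d_zero (k : K.X 0) (l : L.X 1) :
    (cone f hf).d 0 ((k, l) : K.X 0 × L.X 1) = f 0 k + L.d 0 l := rfl

theorem cone_d_succ (n : ℕ) (k : K.X (n + 1)) (l : L.X (n + 2)) :
    (cone f hf).d (n + 1) ((k, l) : K.X (n + 1) × L.X (n + 2)) =
      ((K.d n k, (-1 : R) ^ (n + 1) • f (n + 1) k + L.d (n + 1) l) : K.X n × L.X (n + 1)) := rfl

/-- The inclusion of the target of a chain map into its mapping cone. -/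
def coneInr : ∀ n, L.X n →ₗ[R] (cone f hf).X n
  | 0 => LinearMap.id
  | n + 1 => LinearMap.inr R (K.X n) (L.X (n + 1))

/-- The projection of the mapping cone of `K → L` to `L`; it is not a chain map. -/
def coneSnd : ∀ n, (cone f hf).X n →ₗ[R] L.X n
  | 0 => LinearMap.id
  | n + 1 => LinearMap.snd R (K.X n) (L.X (n + 1))

theorem coneSnd_coneInr (n : ℕ) (l : L.X n) : coneSnd hf n (coneInr hf n l) = l := by
  cases n <;> rfl

theorem coneSnd_d (n : ℕ) (k : K.X n) (l : L.X (n + 1)) :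
    coneSnd hf n ((cone f hf).d n ((k, l) : K.X n × L.X (n + 1))) =
      (-1 : R) ^ n • f n k + L.d n l := by
  cases n with
  | zero => rw [pow_zero, one_smul]; rfl
  | succ n => rfl

theorem isChainMap_coneInr : IsChainMap L (cone f hf) (coneInr hf) := by
  rintro (_ | n) l
  · exact (cone_d_zero hf 0 l).trans (by rw [map_zero, zero_add]; rfl)
  · refine (cone_d_succ hf n 0 l).trans ?_
    rw [map_zero, map_zero, smul_zero, zero_add]
    rfl

instance cone_projective [∀ n, Module.Projective R (K.X n)] [∀ n, Module.Projective R (L.X n)] :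
    ∀ n, Module.Projective R ((cone f hf).X n)
  | 0 => inferInstanceAs (Module.Projective R (L.X 0))
  | n + 1 => inferInstanceAs (Module.Projective R (K.X n × L.X (n + 1)))

/-- The mapping cone of a map of resolutions lifting an injection `g : M → N` resolves `N / g M`. -/
theorem isResolution_cone {Q : Type v} [AddCommGroup Q] [Module R Q]
    {ε : K.X 0 →ₗ[R] M} {η : L.X 0 →ₗ[R] N} (hK : K.IsResolution ε) (hL : L.IsResolution η)
    {g : M →ₗ[R] N} (hg : Function.Injective g) (hfg : ∀ x, η (f 0 x) = g (ε x))
    {π : N →ₗ[R] Q} (hπ : Function.Surjective π) (he : Function.Exact g π) :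
    (cone f hf).IsResolution (π ∘ₗ η : L.X 0 →ₗ[R] Q) where
  surjective := hπ.comp hL.surjective
  exact_zero := by
    intro (y : L.X 0)
    constructor
    · intro hy
      obtain ⟨m, hm⟩ := (he _).mp hy
      obtain ⟨k, rfl⟩ := hK.surjective m
      obtain ⟨l, hl⟩ := (hL.exact_zero (y - f 0 k)).mp (by
        rw [map_sub, sub_eq_zero]; exact (hm.symm.trans (hfg k).symm))
      exact ⟨((k, l) : K.X 0 × L.X 1), by
        rw [cone_d_zero, hl]; exact add_sub_cancel _ _⟩
    · rintro ⟨⟨k, l⟩, rfl⟩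
      change π (η (f 0 k + L.d 0 l)) = 0
      rw [map_add, hfg, hL.exact_zero.apply_apply_eq_zero, add_zero,
        he.apply_apply_eq_zero]
  exact_succ := by
    rintro (_ | n) ⟨k, l⟩
    · constructor
      · intro h
        have h : f 0 k + L.d 0 l = 0 := h
        have hk : ε k = 0 := hg (by
          rw [← hfg, map_zero, eq_neg_of_add_eq_zero_left h, map_neg,
            hL.exact_zero.apply_apply_eq_zero, neg_zero])
        obtain ⟨k', rfl⟩ := (hK.exact_zero k).mp hk
        obtain ⟨l', hl'⟩ := (hL.exact_succ 0 (l + f 1 k')).mp (by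
          rw [map_add, hf, add_comm, h])
        refine ⟨((k', l') : K.X 1 × L.X 2), ?_⟩
        rw [cone_d_succ, hl']
        refine Prod.ext rfl ?_
        simp
      · rintro ⟨y, hy⟩
        rw [← hy]
        exact (cone f hf).d_d 0 y
    · constructor
      · intro h
        have h1 : K.d n k = 0 := congrArg Prod.fst h
        have h2 : (-1 : R) ^ (n + 1) • f (n + 1) k + L.d (n + 1) l = 0 := congrArg Prod.snd h
        obtain ⟨k', rfl⟩ := (hK.exact_succ n k).mp h1
        -- The correction subtracts what the cone differential will contribute from `k'`, with the
        -- sign it carries one degree up.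
        obtain ⟨l', hl'⟩ := (hL.exact_succ (n + 1) (l - (-1 : R) ^ (n + 2) • f (n + 2) k')).mp (by
          rw [map_sub, map_smul, hf, ← h2, pow_succ _ (n + 1)]
          simp [add_comm])
        refine ⟨((k', l') : K.X (n + 2) × L.X (n + 3)), ?_⟩
        rw [cone_d_succ, hl']
        refine Prod.ext rfl ?_
        simp
      · rintro ⟨y, hy⟩
        rw [← hy]
        exact (cone f hf).d_d (n + 1) y

end ModComplex

variable {R : Type u} [CommRing R]

/-! ### Regular sequences over an ideal -/

/-- The sequence `ys`, read from right to left, is weakly regular on `R ⧸ 𝔟`. -/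
def RegularOver (𝔟 : Ideal R) : List R → Prop
  | [] => True
  | y :: ys => RegularOver 𝔟 ys ∧ ∀ r, y * r ∈ 𝔟 ⊔ Ideal.ofList ys → r ∈ 𝔟 ⊔ Ideal.ofList ys

theorem sup_ofList_cons (𝔟 : Ideal R) (y : R) (ys : List R) :
    𝔟 ⊔ Ideal.ofList (y :: ys) = 𝔟 ⊔ Ideal.ofList ys ⊔ Ideal.span {y} := by
  rw [Ideal.ofList_cons, sup_assoc, sup_comm (Ideal.span {y})]

theorem ofList_reverse (ys : List R) : Ideal.ofList ys.reverse = Ideal.ofList ys := by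
  simp [Ideal.ofList]

/-- The head of the list is the last element of the sequence. This matches the recursion of the
Koszul complex, where the head is adjoined by the outermost cone, and explains the reversals below.
-/
theorem isWeaklyRegular_reverse_iff (ys : List R) :
    IsWeaklyRegular R ys.reverse ↔ RegularOver ⊥ ys := by
  induction ys with
  | nil => simp [RegularOver]
  | cons y ys ih =>
    rw [List.reverse_cons, isWeaklyRegular_append_iff, ih, isWeaklyRegular_singleton_iff,
      isSMulRegular_quotient_iff_mem_of_smul_mem, ofList_reverse]
    simp [RegularOver]

namespace ModComplex

/-! ### Koszul complexes as iterated mapping cones -/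

/-- The ring, as a complex concentrated in degree zero. -/
def unitComplex (R : Type u) [CommRing R] : ModComplex R where
  X
    | 0 => ModuleCat.of R R
    | _ + 1 => ModuleCat.of R PUnit.{u + 1}
  d _ := 0
  d_d _ _ := rfl

theorem isChainMap_smul (K : ModComplex R) (y : R) :
    IsChainMap K K (fun n => y • (LinearMap.id : K.X n →ₗ[R] K.X n)) :=
  fun n x => by simp

/-- The Koszul complex of a list of elements, as an iterated mapping cone. -/
def kos : List R → ModComplex R
  | [] => unitComplex R
  | y :: ys => cone _ (isChainMap_smul (kos ys) y)

instance kos_projective : ∀ (ys : List R) (n : ℕ), Module.Projective R ((kos ys).X n)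
  | [], 0 => inferInstanceAs (Module.Projective R R)
  | [], _ + 1 => inferInstanceAs (Module.Projective R PUnit.{u + 1})
  | _ :: ys, n =>
    have := kos_projective ys
    cone_projective _ n

/-- The identification of the degree zero part of the Koszul complex with the ring. -/
def kosZero : ∀ ys : List R, (kos ys).X 0 →ₗ[R] R
  | [] => LinearMap.id
  | _ :: ys => kosZero ys

/-- The identification of the top degree part of the Koszul complex with the ring. -/
def kosTop : ∀ ys : List R, (kos ys).X ys.length →ₗ[R] R
  | [] => LinearMap.id
  | _ :: ys => kosTop ys ∘ₗ LinearMap.fst R ((kos ys).X ys.length) ((kos ys).X (ys.length + 1))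

/-- The generator of the top degree part of the Koszul complex. -/
def kosGen : ∀ ys : List R, (kos ys).X ys.length
  | [] => (1 : R)
  | _ :: ys => ((kosGen ys, 0) : (kos ys).X ys.length × (kos ys).X (ys.length + 1))

theorem kosTop_kosGen : ∀ ys : List R, kosTop ys (kosGen ys) = 1
  | [] => rfl
  | _ :: ys => kosTop_kosGen ys

theorem subsingleton_kos : ∀ (ys : List R) (n : ℕ), ys.length < n → Subsingleton ((kos ys).X n)
  | _, 0, h => absurd h (Nat.not_lt_zero _)
  | [], _ + 1, _ => inferInstanceAs (Subsingleton PUnit.{u + 1})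
  | _ :: ys, n + 1, h => by
    have h1 := subsingleton_kos ys n (by simpa using h)
    have h2 := subsingleton_kos ys (n + 1) (by simp at h; omega)
    exact inferInstanceAs (Subsingleton ((kos ys).X n × (kos ys).X (n + 1)))

theorem kos_d_length (ys : List R) (z : (kos ys).X (ys.length + 1)) :
    (kos ys).d ys.length z = 0 := by
  have := subsingleton_kos ys (ys.length + 1) (Nat.lt_succ_self _)
  rw [Subsingleton.elim z 0, map_zero]

/-- Linear maps from the Koszul complex to the residue field vanish on boundaries. -/
theorem map_kos_d_eq_zero [IsLocalRing R] {ys : List R} (hys : ∀ y ∈ ys, y ∈ maximalIdeal R)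
    (n : ℕ) (f : (kos ys).X n →ₗ[R] ResidueField R) (z : (kos ys).X (n + 1)) :
    f ((kos ys).d n z) = 0 := by
  induction ys generalizing n with
  | nil => exact f.map_zero
  | cons y ys ih =>
    have hy : ∀ c : ResidueField R, y • c = 0 := fun c => by
      rw [Algebra.smul_def, show algebraMap R (ResidueField R) y = 0 from
        (residue_eq_zero_iff y).mpr (hys y (by simp)), zero_mul]
    have ih := ih (fun r hr => hys r (by simp [hr]))
    obtain ⟨k, l⟩ := z
    cases n with
    | zero =>
      let g : (kos ys).X 0 →ₗ[R] ResidueField R := f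
      change g (y • k + (kos ys).d 0 l) = 0
      rw [map_add, map_smul, hy, zero_add]
      exact ih 0 g l
    | succ n =>
      let g : (kos ys).X n × (kos ys).X (n + 1) →ₗ[R] ResidueField R := f
      have h1 := ih n (g ∘ₗ LinearMap.inl R ((kos ys).X n) ((kos ys).X (n + 1))) k
      have h2 := ih (n + 1) (g ∘ₗ LinearMap.inr R ((kos ys).X n) ((kos ys).X (n + 1))) l
      -- The off-diagonal term of the cone differential is multiplication by ±`y`, which acts as
      -- zero on the residue field; the two diagonal terms are inductive.
      have h3 : (kos (y :: ys)).d (n + 1) (k, l) =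
          LinearMap.inl R ((kos ys).X n) ((kos ys).X (n + 1)) ((kos ys).d n k) +
          (y • LinearMap.inr R ((kos ys).X n) ((kos ys).X (n + 1)) ((-1 : R) ^ (n + 1) • k) +
          LinearMap.inr R ((kos ys).X n) ((kos ys).X (n + 1)) ((kos ys).d (n + 1) l)) := by
        refine Prod.ext ?_ ?_
        · simp only [LinearMap.inl_apply, LinearMap.inr_apply, Prod.fst_add, Prod.smul_fst,
            smul_zero, add_zero]
          rfl
        · simp only [LinearMap.inl_apply, LinearMap.inr_apply, Prod.snd_add, Prod.smul_snd,
            zero_add]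
          rw [smul_comm]
          rfl
      rw [h3]
      change g _ = 0
      rw [map_add, map_add, map_smul, hy, zero_add]
      exact (congrArg₂ _ h1 h2).trans (add_zero 0)

/-- The Koszul complex of a regular sequence is a resolution. -/
theorem isResolution_kos {ys : List R} (hys : RegularOver ⊥ ys) {X : Ideal R}
    (hX : Ideal.ofList ys = X) :
    (kos ys).IsResolution (X.mkQ ∘ₗ kosZero ys : (kos ys).X 0 →ₗ[R] R ⧸ X) := by
  induction ys generalizing X with
  | nil =>
    subst hX
    refine ⟨(Submodule.mkQ_surjective _).comp Function.surjective_id, ?_, ?_⟩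
    · intro (r : R)
      constructor
      · intro hr
        have hr : (Submodule.Quotient.mk r : R ⧸ (Ideal.ofList [] : Ideal R)) = 0 := hr
        rw [Submodule.Quotient.mk_eq_zero, Ideal.ofList_nil, Submodule.mem_bot] at hr
        exact ⟨(PUnit.unit : PUnit), hr.symm⟩
      · rintro ⟨_, rfl⟩
        exact map_zero _
    · intro n r
      exact ⟨fun _ => ⟨(PUnit.unit : PUnit), rfl⟩, fun _ => by cases n <;> rfl⟩
  | cons y ys ih =>
    have hle : Ideal.ofList ys ≤ X := by
      rw [← hX, Ideal.ofList_cons]; exact le_sup_right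
    have hyX : y ∈ X := by
      rw [← hX, Ideal.ofList_cons]
      exact Ideal.mem_sup_left (Ideal.mem_span_singleton_self y)
    have hreg := hys.2
    rw [bot_sup_eq] at hreg
    -- The cone resolves the cokernel of multiplication by `y` on `R ⧸ (ys)`, injective by
    -- regularity.
    have key := isResolution_cone (isChainMap_smul (kos ys) y) (ih hys.1 rfl) (ih hys.1 rfl)
      (g := y • LinearMap.id) ?_ (fun x => by simp)
      (π := Submodule.factor hle) (Submodule.factor_surjective hle) ?_
    · refine ⟨key.1, ?_, key.3⟩
      exact key.2
    · rw [← LinearMap.ker_eq_bot, LinearMap.ker_eq_bot']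
      intro m
      obtain ⟨r, rfl⟩ := Submodule.Quotient.mk_surjective _ m
      intro hm
      rw [Submodule.Quotient.mk_eq_zero]
      exact hreg r ((Submodule.Quotient.mk_eq_zero _).mp hm)
    · intro m
      obtain ⟨r, rfl⟩ := Submodule.Quotient.mk_surjective _ m
      change (Submodule.Quotient.mk r : R ⧸ X) = 0 ↔ _
      rw [Submodule.Quotient.mk_eq_zero]
      constructor
      · intro hr
        rw [← hX, Ideal.ofList_cons] at hr
        obtain ⟨a, ha, b, hb, rfl⟩ := Submodule.mem_sup.mp hr
        obtain ⟨c, rfl⟩ := Ideal.mem_span_singleton'.mp ha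
        refine ⟨Submodule.Quotient.mk c, ?_⟩
        refine (Submodule.Quotient.eq _).mpr ?_
        have : y • c - (c * y + b) = -b := by rw [smul_eq_mul]; ring
        exact this ▸ neg_mem hb
      · rintro ⟨m, hm⟩
        obtain ⟨c, rfl⟩ := Submodule.Quotient.mk_surjective _ m
        have := (Submodule.Quotient.eq _).mp hm
        have h2 : r = y * c - (y • c - r) := by rw [smul_eq_mul]; ring
        rw [h2]
        exact sub_mem (Ideal.mul_mem_right _ _ hyX) (hle this)

/-- The truncation `⋯ → L₂ → L₁` of a complex. -/
def shift (L : ModComplex R) : ModComplex R where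
  X n := L.X (n + 1)
  d n := L.d (n + 1)
  d_d n := L.d_d (n + 1)

/-- Multiplication by `y` is null-homotopic on `L` in positive degrees. -/
def SMulNull (L : ModComplex R) (y : R) : Prop :=
  ∃ s : ∀ n, L.X n →ₗ[R] L.X (n + 1), ∀ n x,
    L.d (n + 1) (s (n + 1) x) + s n (L.d n x) = y • x

/-- In the lowest degree of the truncation the term `s ∘ d` would be lost. Demanding the identity
only in positive degrees is what makes the condition stable. -/
theorem SMulNull.shift {L : ModComplex R} {y : R} (h : L.SMulNull y) : L.shift.SMulNull y := by
  obtain ⟨s, hs⟩ := h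
  exact ⟨fun n => s (n + 1), fun n x => hs (n + 1) x⟩

/-- Every cocycle `L_d → R` is the top component of a chain map to the Koszul complex of
a sequence of length `d` whose members act null-homotopically on `L`. -/
theorem exists_chainMap_kos (ys : List R) (L : ModComplex R) (hL : ∀ y ∈ ys, L.SMulNull y)
    (φ : L.X ys.length →ₗ[R] R) (hφ : ∀ x, φ (L.d ys.length x) = 0) :
    ∃ w : ∀ n, L.X n →ₗ[R] (kos ys).X n, IsChainMap L (kos ys) w ∧
      ∀ x, kosTop ys (w ys.length x) = φ x := by
  induction ys generalizing L with
  | nil =>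
    refine ⟨fun n => match n with
      | 0 => φ
      | _ + 1 => 0, ?_, fun x => rfl⟩
    rintro (_ | n) x
    · exact (hφ x).symm
    · rfl
  | cons y ys ih =>
    -- The induction runs on the truncation: `u` lowers degree by one and supplies the first cone
    -- component, which carries the top degree and hence `φ`.
    obtain ⟨u, hu, hut⟩ := ih L.shift (fun z hz => (hL z (by simp [hz])).shift) φ hφ
    obtain ⟨s, hs⟩ := hL y (by simp)
    -- The second cone component is `u` composed with the null-homotopy of `y`; the homotopy
    -- identity produces exactly the term `± y • u` of the cone differential.
    let v : ∀ n, L.X n →ₗ[R] (kos ys).X n := fun n => (-1 : R) ^ n • (u n ∘ₗ s n)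
    have hv : ∀ n x, v n (L.d n x) = (-1 : R) ^ n • (y • u n x) + (kos ys).d n (v (n + 1) x) := by
      intro n x
      have h1 := hs n x
      have h2 := hu n (s (n + 1) x)
      have h3 : s n (L.d n x) = y • x - L.d (n + 1) (s (n + 1) x) := by rw [← h1]; abel
      change (-1 : R) ^ n • u n (s n (L.d n x)) =
        _ + (kos ys).d n ((-1 : R) ^ (n + 1) • u (n + 1) (s (n + 1) x))
      rw [map_smul, h2, h3]
      have h4 := (u n).map_sub (y • x) (L.d (n + 1) (s (n + 1) x))
      have h5 := (u n).map_smul y x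
      refine (congrArg _ (h4.trans (congrArg₂ _ h5 rfl))).trans ?_
      rw [smul_sub, pow_succ, mul_neg_one, neg_smul, sub_eq_add_neg]
      rfl
    refine ⟨fun n => match n with
      | 0 => v 0
      | n + 1 => (u n).prod (v (n + 1)), ?_, hut⟩
    rintro (_ | n) x
    · refine Eq.trans ?_ (hv 0 x).symm
      rw [pow_zero, one_smul]
      rfl
    · exact Prod.ext (hu n x) (hv (n + 1) x).symm

/-! ### Comparison with the exterior algebra -/

section Exterior

variable {M : Type u} [AddCommGroup M] [Module R M] (φ : Module.Dual R M)

/-- The map `(k, l) ↦ ± v ∧ k + l` from the iterated mapping cone to the exterior algebra. -/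
def kosToExterior : ∀ (vs : List M) (n : ℕ), (kos (vs.map φ)).X n →ₗ[R] ExteriorAlgebra R M
  | [], 0 => Algebra.linearMap R (ExteriorAlgebra R M)
  | [], _ + 1 => 0
  | _ :: vs, 0 => kosToExterior vs 0
  | v :: vs, n + 1 => ((-1 : R) ^ n •
      (LinearMap.mulLeft R (ExteriorAlgebra.ι R v) ∘ₗ kosToExterior vs n)).coprod
        (kosToExterior vs (n + 1))

theorem kosToExterior_mem : ∀ (vs : List M) (n : ℕ) (z : (kos (vs.map φ)).X n),
    kosToExterior φ vs n z ∈ ⋀[R]^n M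
  | [], 0, z => by
    rw [ExteriorAlgebra.exteriorPower, pow_zero]
    exact Submodule.algebraMap_mem (A := ExteriorAlgebra R M) (show R from z)
  | [], _ + 1, _ => zero_mem _
  | _ :: vs, 0, z => kosToExterior_mem vs 0 z
  | v :: vs, n + 1, (k, l) => by
    refine add_mem (Submodule.smul_mem _ _ ?_) (kosToExterior_mem vs (n + 1) l)
    rw [ExteriorAlgebra.exteriorPower, pow_succ']
    exact Submodule.mul_mem_mul (LinearMap.mem_range_self _ v) (kosToExterior_mem vs n k)

/-- Contraction is an antiderivation, φ⌋(v ∧ k) = φ(v) k − v ∧ (φ⌋k). The two terms are the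
off-diagonal and the diagonal part of the cone differential, and the sign `(-1) ^ n` in
`kosToExterior` accounts for the minus. -/
theorem contractLeft_kosToExterior : ∀ (vs : List M) (n : ℕ) (z : (kos (vs.map φ)).X (n + 1)),
    CliffordAlgebra.contractLeft (Q := (0 : QuadraticForm R M)) φ (kosToExterior φ vs (n + 1) z) =
      kosToExterior φ vs n ((kos (vs.map φ)).d n z)
  | [], n, z => by
    refine (map_zero (CliffordAlgebra.contractLeft (Q := (0 : QuadraticForm R M)) φ)).trans ?_
    exact (map_zero (kosToExterior φ [] n)).symm
  | v :: vs, n, (k, l) => by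
    have hl := contractLeft_kosToExterior vs n l
    have hv := CliffordAlgebra.contractLeft_ι_mul (Q := (0 : QuadraticForm R M)) φ v
      (kosToExterior φ vs n k)
    have h0 : CliffordAlgebra.contractLeft (Q := (0 : QuadraticForm R M)) φ
        (kosToExterior φ (v :: vs) (n + 1) (k, l)) =
        (-1 : R) ^ n • (φ v • kosToExterior φ vs n k - ExteriorAlgebra.ι R v *
          CliffordAlgebra.contractLeft (Q := (0 : QuadraticForm R M)) φ
            (kosToExterior φ vs n k)) + kosToExterior φ vs n ((kos (vs.map φ)).d n l) := by
      rw [← hl]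
      refine (map_add (CliffordAlgebra.contractLeft (Q := (0 : QuadraticForm R M)) φ)
        ((-1 : R) ^ n • (ExteriorAlgebra.ι R v * kosToExterior φ vs n k)) _).trans ?_
      rw [map_smul]
      exact congrArg₂ _ (congrArg _ hv) rfl
    rw [h0]
    cases n with
    | zero =>
      have hk : CliffordAlgebra.contractLeft (Q := (0 : QuadraticForm R M)) φ
          (kosToExterior φ vs 0 k) = 0 := by
        have := kosToExterior_mem φ vs 0 k
        rw [ExteriorAlgebra.exteriorPower, pow_zero, Submodule.one_eq_range] at this
        obtain ⟨r, hr⟩ := this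
        rw [← hr]
        exact CliffordAlgebra.contractLeft_algebraMap (Q := (0 : QuadraticForm R M)) φ r
      rw [hk, mul_zero, sub_zero, pow_zero, one_smul]
      refine Eq.trans ?_ (map_add (kosToExterior φ vs 0) (φ v • k) ((kos (vs.map φ)).d 0 l)).symm
      rw [map_smul]
    | succ n =>
      rw [contractLeft_kosToExterior vs n k]
      change _ = (-1 : R) ^ n • (ExteriorAlgebra.ι R v *
        kosToExterior φ vs n ((kos (vs.map φ)).d n k)) + kosToExterior φ vs (n + 1)
          ((-1 : R) ^ (n + 1) • (φ v • k) + (kos (vs.map φ)).d (n + 1) l)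
      rw [map_add, map_smul, map_smul, smul_sub, pow_succ, mul_neg_one]
      simp only [neg_smul]
      abel

end Exterior

end ModComplex

/-- The pairing of cycles with cocycles factors through homology, so a map that is zero on homology
pairs to zero. -/
theorem comp_eq_zero_of_homologyMap_eq_zero {C : Type*} [Category C] [Abelian C]
    {K L : ChainComplex C ℕ} (f : K ⟶ L) (n : ℕ) (h : HomologicalComplex.homologyMap f n = 0)
    {A W : C} (z : A ⟶ K.X n) (j : ℕ) (hj : (ComplexShape.down ℕ).next n = j)
    (hz : z ≫ K.d n j = 0) (σ : L.X n ⟶ W) (hσ : L.d (n + 1) n ≫ σ = 0) :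
    z ≫ f.f n ≫ σ = 0 := by
  have h1 : K.liftCycles z j hj hz ≫ HomologicalComplex.cyclesMap f n ≫ L.homologyπ n = 0 := by
    rw [← HomologicalComplex.homologyπ_naturality, h, Limits.comp_zero, Limits.comp_zero]
  have h2 : L.homologyπ n ≫ L.homologyι n ≫ L.descOpcycles σ (n + 1) (by simp) hσ =
      L.iCycles n ≫ σ := by
    rw [HomologicalComplex.homology_π_ι_assoc, HomologicalComplex.p_descOpcycles]
  have h3 : K.liftCycles z j hj hz ≫ HomologicalComplex.cyclesMap f n ≫ L.iCycles n ≫ σ = 0 := by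
    rw [← h2, reassoc_of% h1, Limits.zero_comp]
  rwa [HomologicalComplex.cyclesMap_i_assoc, HomologicalComplex.liftCycles_i_assoc] at h3

/-! ### Vanishing on Tor, expressed by cocycles with values in the residue field -/

variable {R : Type u} [CommRing R]

namespace ModComplex

/-- The elementwise complex of a chain complex in `ModuleCat R`. -/
def ofChainComplex (K : ChainComplex (ModuleCat.{u} R) ℕ) : ModComplex R where
  X := K.X
  d n := (K.d (n + 1) n).hom
  d_d n x := by
    rw [← ModuleCat.comp_apply, K.d_comp_d]
    rfl

theorem isChainMap_ofChainComplex {K L : ChainComplex (ModuleCat.{u} R) ℕ} (f : K ⟶ L) :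
    IsChainMap (ofChainComplex K) (ofChainComplex L) (fun n => (f.f n).hom) :=
  fun n x => ((ModuleCat.comp_apply _ _ _).symm.trans
    (congrArg (fun g => (ConcreteCategory.hom g) x) (f.comm (n + 1) n))).trans
      (ModuleCat.comp_apply _ _ _)

theorem isResolution_ofChainComplex {M : Type u} [AddCommGroup M] [Module R M]
    (P : ProjectiveResolution (ModuleCat.of R M)) :
    (ofChainComplex P.complex).IsResolution
      ((resolutionAug P).hom : P.complex.X 0 →ₗ[R] M) where
  surjective := (ModuleCat.epi_iff_surjective (resolutionAug P)).mp inferInstance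
  exact_zero := (ShortComplex.ShortExact.moduleCat_exact_iff_function_exact _).mp P.exact₀
  exact_succ n :=
    (ShortComplex.ShortExact.moduleCat_exact_iff_function_exact _).mp (P.exact_succ n)

instance projective_ofChainComplex {X : ModuleCat.{u} R} (P : ProjectiveResolution X) (n : ℕ) :
    Module.Projective R ((ofChainComplex P.complex).X n) :=
  (IsProjective.iff_projective _).mpr (P.projective n)

theorem IsChainMap.comp {K L N : ModComplex R} {f : ∀ n, K.X n →ₗ[R] L.X n}
    {g : ∀ n, L.X n →ₗ[R] N.X n} (hg : IsChainMap L N g) (hf : IsChainMap K L f) :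
    IsChainMap K N (fun n => g n ∘ₗ f n) :=
  fun n x => by rw [LinearMap.comp_apply, LinearMap.comp_apply, hg, hf]

end ModComplex

open ModComplex

theorem map_mem_smul_top {I : Ideal R} {M N : Type*} [AddCommGroup M] [Module R M]
    [AddCommGroup N] [Module R N] (f : M →ₗ[R] N) {x : M}
    (hx : x ∈ I • (⊤ : Submodule R M)) : f x ∈ I • (⊤ : Submodule R N) := by
  have := Submodule.mem_map_of_mem (f := f) hx
  rw [Submodule.map_smul''] at this
  exact Submodule.smul_mono le_rfl le_top this

/-- The map `kos → K` from the iterated mapping cone to the exterior algebra. -/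
def kosToKoszul {m : ℕ} (a : Fin m → R) (vs : List (Fin m → R)) (n : ℕ) :
    (kos (vs.map (Fintype.linearCombination R a))).X n →ₗ[R] (koszulComplex a).X n :=
  (kosToExterior (Fintype.linearCombination R a) vs n).codRestrict (⋀[R]^n (Fin m → R))
    (kosToExterior_mem _ vs n)

theorem isChainMap_kosToKoszul {m : ℕ} (a : Fin m → R) (vs : List (Fin m → R)) :
    IsChainMap (kos (vs.map (Fintype.linearCombination R a))) (ofChainComplex (koszulComplex a))
      (kosToKoszul a vs) := by
  intro n z
  change ((koszulComplex a).d (n + 1) n).hom _ = _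
  rw [koszulComplex_d]
  exact Subtype.ext (contractLeft_kosToExterior (Fintype.linearCombination R a) vs n z)

theorem kosToExterior_zero {M : Type u} [AddCommGroup M] [Module R M] (φ : Module.Dual R M)
    (vs : List M) (z : (kos (vs.map φ)).X 0) :
    kosToExterior φ vs 0 z = algebraMap R _ (kosZero (vs.map φ) z) := by
  induction vs with
  | nil => rfl
  | cons v vs ih => exact ih z

variable [IsLocalRing R]

theorem smul_residueField_eq_zero {r : R} (hr : r ∈ maximalIdeal R) (c : ResidueField R) :
    r • c = 0 := by
  rw [Algebra.smul_def, show algebraMap R (ResidueField R) r = 0 from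
    (residue_eq_zero_iff r).mpr hr, zero_mul]

theorem tmul_eq_zero_of_mem_smul {M : Type u} [AddCommGroup M] [Module R M] {x : M}
    (hx : x ∈ maximalIdeal R • (⊤ : Submodule R M)) (c : ResidueField R) : x ⊗ₜ[R] c = 0 := by
  refine Submodule.smul_induction_on hx ?_ ?_
  · intro r hr y _
    rw [TensorProduct.smul_tmul, smul_residueField_eq_zero hr, TensorProduct.tmul_zero]
  · intro y y' hy hy'
    rw [TensorProduct.add_tmul, hy, hy', add_zero]

/-- If `K_n(a; R) ⊗ k → Tor_n(R/(a), k)` vanishes, then the comparison map from the Koszul complex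
to a projective resolution is annihilated by all cocycles with values in `k`. -/
theorem comparison_eq_zero_of_koszulToTor_eq_zero {m : ℕ} (a : Fin m → R)
    (ha : ∀ i, a i ∈ maximalIdeal R) (n : ℕ) (h : koszulToTor a ha n = 0)
    (σ : (projectiveResolution (ModuleCat.of R (R ⧸ Ideal.span (Set.range a)))).complex.X n →ₗ[R]
      ResidueField R)
    (hσ : ∀ x, σ (((projectiveResolution (ModuleCat.of R
      (R ⧸ Ideal.span (Set.range a)))).complex.d (n + 1) n).hom x) = 0)
    (z : (koszulComplex a).X n) :
    σ (((comparison (koszulComplex a) (koszulAug a) (koszulComplex_d_aug a)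
      (projectiveResolution (ModuleCat.of R (R ⧸ Ideal.span (Set.range a))))).f n).hom z) = 0 := by
  let F := (tensoringRight (ModuleCat.{u} R)).obj (ModuleCat.of R (ResidueField R))
  let P := projectiveResolution (ModuleCat.of R (R ⧸ Ideal.span (Set.range a)))
  let φ : koszulComplex a ⟶ P.complex :=
    comparison (koszulComplex a) (koszulAug a) (koszulComplex_d_aug a) P
  let τ : P.complex.X n ⟶ ModuleCat.of R (ResidueField R) := ModuleCat.ofHom σ
  have hτ : P.complex.d (n + 1) n ≫ τ = 0 := ModuleCat.hom_ext (LinearMap.ext hσ)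
  have h0 : (koszulTensorResidue a).liftCycles (𝟙 _) _ rfl (by
      rw [koszulTensorResidue_d a ha, Limits.comp_zero]) ≫
      (koszulTensorResidue a).homologyπ n ≫
      HomologicalComplex.homologyMap ((F.mapHomologicalComplex _).map φ) n = 0 := by
    refine (cancel_mono (P.isoLeftDerivedObj F n).inv).mp ?_
    refine (Category.assoc _ _ _).trans ((congrArg (fun t => _ ≫ t) (Category.assoc _ _ _)).trans ?_)
    exact h.trans Limits.zero_comp.symm
  -- The differential of `K ⊗ k` is zero, so the inclusion of cycles is an isomorphism and the lift
  -- of the identity can be cancelled.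
  have h1 : (koszulTensorResidue a).homologyπ n ≫
      HomologicalComplex.homologyMap ((F.mapHomologicalComplex _).map φ) n = 0 := by
    have : Epi ((koszulTensorResidue a).iCycles n) := by
      have : IsIso ((koszulTensorResidue a).iCycles n) :=
        (koszulTensorResidue a).isIso_iCycles n _ rfl (koszulTensorResidue_d a ha _ _)
      infer_instance
    have h2 : (koszulTensorResidue a).iCycles n ≫
        (koszulTensorResidue a).liftCycles (𝟙 _) _ rfl (by
          rw [koszulTensorResidue_d a ha, Limits.comp_zero]) = 𝟙 _ := by
      rw [← cancel_mono ((koszulTensorResidue a).iCycles n)]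
      simp
    have h3 := congrArg (fun t => (koszulTensorResidue a).iCycles n ≫ t) h0
    simp only [Limits.comp_zero] at h3
    rw [reassoc_of% h2] at h3
    exact h3
  have h2 : HomologicalComplex.homologyMap ((F.mapHomologicalComplex _).map φ) n = 0 := by
    rw [← cancel_epi ((koszulTensorResidue a).homologyπ n), h1, Limits.comp_zero]
  have h3 := comp_eq_zero_of_homologyMap_eq_zero _ n h2 (𝟙 _) _ rfl
    (by rw [koszulTensorResidue_d a ha, Limits.comp_zero]) (F.map τ)
    (by
      change F.map (P.complex.d (n + 1) n) ≫ F.map τ = 0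
      rw [← F.map_comp, hτ, F.map_zero])
  rw [Category.id_comp] at h3
  have h4 : F.map (φ.f n ≫ τ) = 0 := by rw [F.map_comp]; exact h3
  -- Vanishing is known only after tensoring with `k`; multiplication `k ⊗ k → k` recovers the value
  -- of `σ`.
  have h5 : (σ ((φ.f n).hom z)) ⊗ₜ[R] (1 : ResidueField R) = 0 :=
    congrArg (fun g => g.hom (z ⊗ₜ[R] (1 : ResidueField R))) h4
  have h6 := congrArg (LinearMap.mul' R (ResidueField R)) h5
  rw [LinearMap.mul'_apply, mul_one, map_zero] at h6
  exact h6

/-- Transfers the vanishing hypothesis from the exterior algebra to the iterated cone, in the only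
form used later: cocycles into `k` kill the comparison map in degree `n`. -/
theorem exists_resolution_of_koszulToTor_eq_zero {m : ℕ} (a : Fin m → R)
    (ha : ∀ i, a i ∈ maximalIdeal R) (n : ℕ) (h : koszulToTor a ha n = 0)
    {ws : List R} (hws : (List.ofFn a).reverse = ws) :
    ∃ (P : ModComplex R) (ε : P.X 0 →ₗ[R] R ⧸ Ideal.span (Set.range a)),
      (∀ n, Module.Projective R (P.X n)) ∧ P.IsResolution ε ∧
      ∃ φ : ∀ n, (kos ws).X n →ₗ[R] P.X n,
        IsChainMap (kos ws) P φ ∧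
        (∀ x, ε (φ 0 x) = (Ideal.span (Set.range a)).mkQ (kosZero _ x)) ∧
        ∀ σ : P.X n →ₗ[R] ResidueField R, (∀ x, σ (P.d n x) = 0) → ∀ z, σ (φ n z) = 0 := by
  obtain ⟨vs, hvs⟩ : ∃ vs : List (Fin m → R),
      (List.ofFn a).reverse = vs.map (Fintype.linearCombination R a) := by
    refine ⟨(List.ofFn fun i => Pi.single i 1).reverse, ?_⟩
    rw [List.map_reverse, List.map_ofFn]
    congr 2
    funext i
    simp [Fintype.linearCombination_apply_single]
  obtain rfl := hws.symm.trans hvs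
  let P := projectiveResolution (ModuleCat.of R (R ⧸ Ideal.span (Set.range a)))
  let φ : koszulComplex a ⟶ P.complex :=
    comparison (koszulComplex a) (koszulAug a) (koszulComplex_d_aug a) P
  refine ⟨ofChainComplex P.complex, (resolutionAug P).hom, inferInstance,
    isResolution_ofChainComplex P, fun n => (φ.f n).hom ∘ₗ kosToKoszul a vs n,
    (isChainMap_ofChainComplex φ).comp (isChainMap_kosToKoszul a vs), ?_, ?_⟩
  · intro x
    have h1 : (resolutionAug P).hom ((φ.f 0).hom (kosToKoszul a vs 0 x)) =
        (koszulAug a).hom (kosToKoszul a vs 0 x) :=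
      congrArg (fun g => g.hom (kosToKoszul a vs 0 x))
        (comparison_aug (koszulComplex a) (koszulAug a) (koszulComplex_d_aug a) P)
    refine h1.trans (congrArg (Ideal.span (Set.range a)).mkQ ?_)
    refine (LinearEquiv.eq_symm_apply (exteriorPower.zeroEquiv R (Fin m → R))).mp (Subtype.ext ?_)
    refine (kosToExterior_zero _ vs x).trans ?_
    simp [exteriorPower.zeroEquiv_symm_apply, Algebra.algebraMap_eq_smul_one]
  · intro σ hσ z
    exact comparison_eq_zero_of_koszulToTor_eq_zero a ha n h σ hσ _

/-- The elementwise complex of a minimal free resolution. -/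
def MinimalFreeResolution.complex {M : Type v} [AddCommGroup M] [Module R M]
    (L : MinimalFreeResolution R M) : ModComplex R where
  X n := ModuleCat.of R (Fin (L.rank n) → R)
  d := L.d
  d_d n x := (L.exact_d n).apply_apply_eq_zero x

instance {M : Type v} [AddCommGroup M] [Module R M] (L : MinimalFreeResolution R M) (n : ℕ) :
    Module.Projective R (L.complex.X n) :=
  inferInstanceAs (Module.Projective R (Fin (L.rank n) → R))

theorem MinimalFreeResolution.isResolution {M : Type v} [AddCommGroup M] [Module R M]
    (L : MinimalFreeResolution R M) :
    L.complex.IsResolution (L.aug : (Fin (L.rank 0) → R) →ₗ[R] M) :=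
  ⟨L.aug_surjective, L.exact_aug, L.exact_d⟩

/-- If `Tor_n(Ω, k) → Tor_n(R/X, k)` vanishes, then some lift of `Ω → R/X` to resolutions is
annihilated in degree `n` by all cocycles with values in `k`. -/
theorem exists_chainMap_of_canonicalTorMap_eq_zero (I X : Ideal R) (n : ℕ)
    (h : canonicalTorMap I X n = 0) (L : MinimalFreeResolution R (CanonicalModule I X))
    {C : ModComplex R} {η : C.X 0 →ₗ[R] R ⧸ X} (hC : C.IsResolution η) :
    ∃ f : ∀ n, L.complex.X n →ₗ[R] C.X n, IsChainMap L.complex C f ∧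
      (∀ x, η (f 0 x) = canonicalInclusion I X (L.aug x)) ∧
      ∀ σ : C.X n →ₗ[R] ResidueField R, (∀ x, σ (C.d n x) = 0) → ∀ l, σ (f n l) = 0 := by
  let F := (tensoringRight (ModuleCat.{u} R)).obj (ModuleCat.of R (ResidueField R))
  let P := projectiveResolution (ModuleCat.of R (CanonicalModule I X))
  let Q := projectiveResolution (ModuleCat.of R (R ⧸ X))
  let ι : ModuleCat.of R (CanonicalModule I X) ⟶ ModuleCat.of R (R ⧸ X) :=
    ModuleCat.ofHom (canonicalInclusion I X)
  let g : P.complex ⟶ Q.complex := ProjectiveResolution.lift ι P Q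
  have hg : g.f 0 ≫ Q.π.f 0 = P.π.f 0 ≫ ι := ProjectiveResolution.lift_commutes_zero ι P Q
  have hP := isResolution_ofChainComplex P
  have hQ := isResolution_ofChainComplex Q
  obtain ⟨τ, hτ, hτ0⟩ := exists_chainMap (K := L.complex) (L := ofChainComplex P.complex)
    (ε := L.aug) (fun x => L.exact_aug.apply_apply_eq_zero x) hP LinearMap.id
  obtain ⟨ρ, hρ, hρ0⟩ := exists_chainMap (K := ofChainComplex Q.complex) (L := C)
    (fun x => hQ.exact_zero.apply_apply_eq_zero x) hC LinearMap.id
  have hmap : HomologicalComplex.homologyMap ((F.mapHomologicalComplex _).map g) n = 0 := by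
    have h1 := ProjectiveResolution.isoLeftDerivedObj_hom_naturality ι P Q g hg F n
    have h2 : (F.leftDerived n).map ι = 0 := h
    rw [h2, Limits.zero_comp] at h1
    refine (cancel_epi (P.isoLeftDerivedObj F n).hom).mp ?_
    exact h1.symm.trans Limits.comp_zero.symm
  -- The lift is routed through the projective resolutions that compute Tor, so that the hypothesis
  -- applies to its middle factor.
  refine ⟨fun n => ρ n ∘ₗ (g.f n).hom ∘ₗ τ n,
    hρ.comp ((isChainMap_ofChainComplex g).comp hτ), ?_, ?_⟩
  · intro x
    have h1 : (Q.π.f 0).hom ((g.f 0).hom (τ 0 x)) = ι.hom ((P.π.f 0).hom (τ 0 x)) :=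
      congrArg (fun t => t.hom (τ 0 x)) hg
    refine (hρ0 _).trans (h1.trans ?_)
    exact congrArg _ (hτ0 x)
  · intro σ hσ l
    let z : ModuleCat.of R R ⟶ F.obj (P.complex.X n) :=
      ModuleCat.ofHom (LinearMap.toSpanSingleton R _ (τ n l ⊗ₜ[R] (1 : ResidueField R)))
    let s : Q.complex.X n ⟶ ModuleCat.of R (ResidueField R) := ModuleCat.ofHom (σ ∘ₗ ρ n)
    have hs : Q.complex.d (n + 1) n ≫ s = 0 := by
      refine ModuleCat.hom_ext (LinearMap.ext fun x => ?_)
      exact (congrArg σ (hρ n x)).symm.trans (hσ _)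
    -- By minimality the boundary of any `l` lies in `𝔪 L`, so `τ l ⊗ 1` is a cycle of `P ⊗ k`
    -- whatever `l` is.
    have hz : ∀ j, z ≫ F.map (P.complex.d n j) = 0 := by
      intro j
      by_cases hj : j + 1 = n
      · subst hj
        refine ModuleCat.hom_ext (LinearMap.ext_ring ?_)
        change F.map (P.complex.d (j + 1) j) ((1 : R) • (τ (j + 1) l ⊗ₜ[R] (1 : ResidueField R))) = 0
        rw [one_smul]
        change ((P.complex.d (j + 1) j).hom (τ (j + 1) l)) ⊗ₜ[R] (1 : ResidueField R) = 0
        have h1 : (P.complex.d (j + 1) j).hom (τ (j + 1) l) = τ j (L.d j l) := hτ j l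
        rw [h1]
        exact tmul_eq_zero_of_mem_smul
          (map_mem_smul_top (τ j) (L.minimal j (LinearMap.mem_range_self _ l))) _
      · rw [P.complex.shape n j hj, F.map_zero, Limits.comp_zero]
    have h3 := comp_eq_zero_of_homologyMap_eq_zero _ n hmap z _ rfl (hz _) (F.map s)
      (by
        change F.map (Q.complex.d (n + 1) n) ≫ F.map s = 0
        rw [← F.map_comp, hs, F.map_zero])
    have h5 := congrArg (fun t => t.hom (1 : R)) h3
    change F.map s (F.map (g.f n) ((1 : R) • (τ n l ⊗ₜ[R] (1 : ResidueField R)))) = 0 at h5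
    rw [one_smul] at h5
    have h5 : (σ (ρ n ((g.f n).hom (τ n l)))) ⊗ₜ[R] (1 : ResidueField R) = 0 := h5
    have h6 := congrArg (LinearMap.mul' R (ResidueField R)) h5
    rw [LinearMap.mul'_apply, mul_one, map_zero] at h6
    exact h6

variable {R : Type u} [CommRing R]

open ModComplex

/-! ### Free summands and linear functionals -/

/-- A preimage of `1` splits the functional and spans a free complement of its kernel. -/
theorem hasFreeSummand_of_surjective [Nontrivial R] {M : Type v} [AddCommGroup M] [Module R M]
    (f : M →ₗ[R] R) (hf : Function.Surjective f) : HasFreeSummand R M := by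
  obtain ⟨m, hm⟩ := hf 1
  have hfm : ∀ r : R, f (r • m) = r := fun r => by rw [map_smul, hm, smul_eq_mul, mul_one]
  have hinj : Function.Injective (LinearMap.toSpanSingleton R M m) :=
    Function.LeftInverse.injective (g := f) hfm
  refine ⟨LinearMap.range (LinearMap.toSpanSingleton R M m), LinearMap.ker f, ⟨?_, ?_⟩, ?_,
    Module.Free.of_equiv (LinearEquiv.ofInjective _ hinj)⟩
  · rw [Submodule.disjoint_def]
    rintro _ ⟨r, rfl⟩ hr
    have h0 : r = 0 := (hfm r).symm.trans hr
    rw [h0, map_zero]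
  · rw [codisjoint_iff, eq_top_iff]
    intro x _
    refine Submodule.mem_sup.mpr ⟨f x • m, ⟨f x, rfl⟩, x - f x • m, ?_, add_sub_cancel _ _⟩
    rw [LinearMap.mem_ker, map_sub, hfm, sub_self]
  · intro h
    have : m ∈ LinearMap.range (LinearMap.toSpanSingleton R M m) := ⟨1, one_smul _ _⟩
    rw [h, Submodule.mem_bot] at this
    rw [this, map_zero] at hm
    exact zero_ne_one hm

theorem exists_surjective_of_hasFreeSummand {M : Type v} [AddCommGroup M]
    [Module R M] (h : HasFreeSummand R M) : ∃ f : M →ₗ[R] R, Function.Surjective f := by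
  obtain ⟨N, N', hc, hN, hfree⟩ := h
  let b := Module.Free.chooseBasis R N
  have : Nontrivial N := Submodule.nontrivial_iff_ne_bot.mpr hN
  obtain ⟨i⟩ := b.index_nonempty
  refine ⟨b.coord i ∘ₗ N.projectionOnto N' hc, fun r => ⟨r • (b i : M), ?_⟩⟩
  rw [map_smul, LinearMap.comp_apply, Submodule.projectionOnto_apply_left]
  simp

theorem smul_canonicalModule_eq_zero {I X : Ideal R} {y : R} (hy : y ∈ I)
    (ω : CanonicalModule I X) : y • ω = 0 := by
  refine LinearMap.ext fun q => ?_
  obtain ⟨r, rfl⟩ := Submodule.Quotient.mk_surjective _ q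
  have h : y • (Submodule.Quotient.mk r : R ⧸ I) = 0 :=
    (Submodule.Quotient.mk_eq_zero I).mpr (Ideal.mul_mem_right r I hy)
  rw [LinearMap.smul_apply, ← map_smul, LinearMap.zero_apply, h, map_zero]

theorem canonicalInclusion_injective (I X : Ideal R) :
    Function.Injective (canonicalInclusion I X) := by
  intro f g h
  refine LinearMap.ext fun q => ?_
  obtain ⟨r, rfl⟩ := Submodule.Quotient.mk_surjective _ q
  have h1 : (Submodule.Quotient.mk r : R ⧸ I) = r • (1 : R ⧸ I) := by
    rw [Algebra.smul_def, mul_one]; rfl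
  rw [h1, map_smul, map_smul]
  exact congrArg _ h

theorem mem_range_canonicalInclusion {I X : Ideal R} (q : R ⧸ X) :
    q ∈ LinearMap.range (canonicalInclusion I X) ↔ ∀ y ∈ I, y • q = 0 := by
  constructor
  · rintro ⟨ω, rfl⟩ y hy
    rw [← map_smul, smul_canonicalModule_eq_zero hy, map_zero]
  · intro h
    have hle : I ≤ LinearMap.ker (LinearMap.toSpanSingleton R (R ⧸ X) q) := h
    refine ⟨Submodule.liftQ I _ hle, ?_⟩
    exact (Submodule.liftQ_apply I (LinearMap.toSpanSingleton R (R ⧸ X) q) (h := hle) (1 : R)).trans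
      (one_smul R q)

theorem ofList_ofFn {d : ℕ} (x : Fin d → R) :
    Ideal.ofList (List.ofFn x) = Ideal.span (Set.range x) := by
  rw [Ideal.ofList]
  congr 1
  ext r
  simp [List.mem_ofFn]

/-! ### Part (1): a double mapping cone resolving `R/J` -/

section Local

variable [IsLocalRing R]

/-- If some lift `γ` of `Ω → R/X` to the Koszul complex has a unit value in top degree, the
syzygy module has a free summand. -/
theorem hasFreeSummand_of_isUnit {M : Type v} [AddCommGroup M] [Module R M]
    (L : MinimalFreeResolution R M) (ys : List R)
    (γ : ∀ n, L.complex.X n →ₗ[R] (kos ys).X n) (hγ : IsChainMap L.complex (kos ys) γ)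
    (l : L.complex.X ys.length) (hl : IsUnit (kosTop ys (γ ys.length l))) :
    HasFreeSummand R (L.Syz ys.length) := by
  let φ : (Fin (L.rank ys.length) → R) →ₗ[R] R := kosTop ys ∘ₗ γ ys.length
  have hφ : LinearMap.range (L.d ys.length) ≤ LinearMap.ker φ := by
    rintro _ ⟨x, rfl⟩
    rw [LinearMap.mem_ker]
    exact (congrArg (kosTop ys) ((hγ _ _).symm.trans (kos_d_length ys _))).trans (map_zero _)
  obtain ⟨c, hc⟩ := hl
  refine hasFreeSummand_of_surjective ((LinearMap.range (L.d ys.length)).liftQ φ hφ) fun r =>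
    ⟨Submodule.Quotient.mk ((r * ↑c⁻¹ : R) • (show Fin (L.rank ys.length) → R from l)), ?_⟩
  rw [Submodule.liftQ_apply, map_smul]
  change (r * ↑c⁻¹ : R) • kosTop ys (γ ys.length l) = r
  rw [← hc, smul_eq_mul, mul_assoc, Units.inv_mul, mul_one]

/-- The chain of resolutions is 0 → Ω → R/X → (R/X)/Ω → 0, resolved by `cone γ`, followed by 0 →
(R/X)/Ω → R/X → R/J → 0 with first map multiplication by `lam`, resolved by `cone β`. Without a unit
value of `γ` in top degree, a cocycle on `cone β` would detect the top Koszul generator. -/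
theorem exists_isUnit_kosTop {ys : List R} (hys : RegularOver ⊥ ys)
    {lam : R} (hm : ∀ y ∈ lam :: ys, y ∈ maximalIdeal R)
    {X J : Ideal R} (hX : Ideal.ofList ys = X) (hJ : Ideal.ofList (lam :: ys) = J)
    (L : MinimalFreeResolution R (CanonicalModule J X))
    {γ : ∀ n, L.complex.X n →ₗ[R] (kos ys).X n} (hγ : IsChainMap L.complex (kos ys) γ)
    (hγ0 : ∀ x, X.mkQ (kosZero ys (γ 0 x)) = canonicalInclusion J X (L.aug x))
    {P : ModComplex R} {ε : P.X 0 →ₗ[R] R ⧸ J} [∀ n, Module.Projective R (P.X n)]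
    (hP : P.IsResolution ε) {φ : ∀ n, (kos (lam :: ys)).X n →ₗ[R] P.X n}
    (hφ : IsChainMap (kos (lam :: ys)) P φ) (hφ0 : ∀ x, ε (φ 0 x) = J.mkQ (kosZero _ x))
    (hφσ : ∀ σ : P.X (ys.length + 1) →ₗ[R] ResidueField R,
      (∀ x, σ (P.d _ x) = 0) → ∀ z, σ (φ _ z) = 0) :
    ∃ l, IsUnit (kosTop ys (γ ys.length l)) := by
  have hlamJ : lam ∈ J := by
    rw [← hJ, Ideal.ofList_cons]
    exact Ideal.mem_sup_left (Ideal.mem_span_singleton_self lam)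
  have hXJ : X ≤ J := by
    rw [← hJ, ← hX, Ideal.ofList_cons]; exact le_sup_right
  have hJsup : ∀ r ∈ J, ∃ c, ∃ b ∈ X, c * lam + b = r := by
    intro r hr
    rw [← hJ, Ideal.ofList_cons, hX] at hr
    obtain ⟨a, ha, b, hb, rfl⟩ := Submodule.mem_sup.mp hr
    obtain ⟨c, rfl⟩ := Ideal.mem_span_singleton'.mp ha
    exact ⟨c, b, hb, rfl⟩
  have hXq : ∀ b ∈ X, ∀ q : R ⧸ X, b • q = 0 := by
    intro b hb q
    obtain ⟨r, rfl⟩ := Submodule.Quotient.mk_surjective _ q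
    exact (Submodule.Quotient.mk_eq_zero X).mpr (Ideal.mul_mem_right r X hb)
  have hC := isResolution_kos hys hX
  set ι := canonicalInclusion J X with hι
  have hF := isResolution_cone hγ L.isResolution hC (canonicalInclusion_injective J X) hγ0
    (LinearMap.range ι).mkQ_surjective (LinearMap.exact_map_mkQ_range ι)
  -- As `lam` kills Ω, the map `lam • γ` lifts zero. Its null-homotopy extends multiplication by
  -- `lam` from `kos ys` to the cone of `γ`.
  obtain ⟨s, hs0, hs⟩ := exists_homotopy hC (fun n => lam • γ n)
    (fun n x => by simp [hγ n x]) (fun x => by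
      have h1 : ι (L.aug x) = X.mkQ (kosZero ys (γ 0 x)) := (hγ0 x).symm
      rw [LinearMap.smul_apply, map_smul, LinearMap.comp_apply, ← h1, ← map_smul,
        smul_canonicalModule_eq_zero hlamJ, map_zero])
  let β : ∀ n, (cone γ hγ).X n →ₗ[R] (kos ys).X n := fun n => match n with
    | 0 => lam • (LinearMap.id : (kos ys).X 0 →ₗ[R] (kos ys).X 0)
    | n + 1 => ((-1 : R) ^ n • s n).coprod
      (lam • (LinearMap.id : (kos ys).X (n + 1) →ₗ[R] (kos ys).X (n + 1)))
  have hβ : IsChainMap (cone γ hγ) (kos ys) β := by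
    rintro (_ | n) ⟨l, k⟩
    · change (kos ys).d 0 ((-1 : R) ^ 0 • s 0 l + lam • k) = lam • (γ 0 l + (kos ys).d 0 k)
      have h0 : lam • γ 0 l = (kos ys).d 0 (s 0 l) := hs0 l
      rw [pow_zero, one_smul, map_add, ← h0, map_smul, smul_add]
    · change (kos ys).d (n + 1) ((-1 : R) ^ (n + 1) • s (n + 1) l + lam • k) =
        (-1 : R) ^ n • s n (L.complex.d n l) +
          lam • ((-1 : R) ^ (n + 1) • γ (n + 1) l + (kos ys).d (n + 1) k)
      have h0 : lam • γ (n + 1) l =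
        (kos ys).d (n + 1) (s (n + 1) l) + s n (L.complex.d n l) := hs n l
      rw [smul_add, smul_comm lam, h0, map_add, map_smul, map_smul, pow_succ, mul_neg_one]
      simp only [neg_smul, smul_add]
      abel
  let g : ((R ⧸ X) ⧸ LinearMap.range ι) →ₗ[R] R ⧸ X :=
    (LinearMap.range ι).liftQ (lam • LinearMap.id) (by
      rintro _ ⟨ω, rfl⟩
      rw [LinearMap.mem_ker, LinearMap.smul_apply, LinearMap.id_apply, ← map_smul,
        smul_canonicalModule_eq_zero hlamJ, map_zero])
  -- The kernel of `lam` on `R ⧸ X` is annihilated by all of `J = X + (lam)`, so it is exactly the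
  -- image of Ω.
  have hg : Function.Injective g := by
    rw [← LinearMap.ker_eq_bot, LinearMap.ker_eq_bot']
    intro q hq
    obtain ⟨q, rfl⟩ := Submodule.Quotient.mk_surjective _ q
    have hq : lam • q = 0 := hq
    rw [Submodule.Quotient.mk_eq_zero, mem_range_canonicalInclusion]
    intro y hy
    obtain ⟨c, b, hb, rfl⟩ := hJsup y hy
    rw [add_smul, mul_smul, hq, smul_zero, hXq b hb, add_zero]
  have hgπ : Function.Exact g (Submodule.factor hXJ) := by
    intro m
    obtain ⟨r, rfl⟩ := Submodule.Quotient.mk_surjective _ m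
    change (Submodule.Quotient.mk r : R ⧸ J) = 0 ↔ _
    rw [Submodule.Quotient.mk_eq_zero]
    constructor
    · intro hr
      obtain ⟨c, b, hb, rfl⟩ := hJsup r hr
      refine ⟨Submodule.Quotient.mk (Submodule.Quotient.mk c), ?_⟩
      refine (Submodule.Quotient.eq X).mpr ?_
      have : lam • c - (c * lam + b) = -b := by rw [smul_eq_mul]; ring
      exact this ▸ neg_mem hb
    · rintro ⟨m, hm⟩
      obtain ⟨m, rfl⟩ := Submodule.Quotient.mk_surjective _ m
      obtain ⟨c, rfl⟩ := Submodule.Quotient.mk_surjective _ m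
      have := (Submodule.Quotient.eq X).mp hm
      have h2 : r = lam * c - (lam • c - r) := by rw [smul_eq_mul]; ring
      rw [h2]
      exact sub_mem (Ideal.mul_mem_right _ _ hlamJ) (hXJ this)
  have hG := isResolution_cone hβ hF hC hg (fun x => map_smul _ lam _)
    (Submodule.factor_surjective hXJ) hgπ
  obtain ⟨η, hη, hG⟩ : ∃ η : (cone β hβ).X 0 →ₗ[R] R ⧸ J,
      (∀ x : (kos ys).X 0, η x = J.mkQ (kosZero ys x)) ∧ (cone β hβ).IsResolution η :=
    ⟨_, fun _ => rfl, hG⟩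
  -- `kos (lam :: ys)` is the cone of `lam` on `kos ys`. Including `kos ys` in `cone γ` maps it to
  -- `cone β`, because `β` restricts to `lam` there.
  let ψ : ∀ n, (kos (lam :: ys)).X n →ₗ[R] (cone β hβ).X n := fun n => match n with
    | 0 => (LinearMap.id : (kos ys).X 0 →ₗ[R] (kos ys).X 0)
    | n + 1 => (coneInr hγ n).prodMap
      (LinearMap.id : (kos ys).X (n + 1) →ₗ[R] (kos ys).X (n + 1))
  have hψ : IsChainMap (kos (lam :: ys)) (cone β hβ) ψ := by
    rintro (_ | n) ⟨u, v⟩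
    · rfl
    · refine Prod.ext (isChainMap_coneInr hγ n u) ?_
      change (-1 : R) ^ (n + 1) • ((-1 : R) ^ n • s n 0 + lam • u) + (kos ys).d (n + 1) v =
        (-1 : R) ^ (n + 1) • (lam • u) + (kos ys).d (n + 1) v
      rw [map_zero, smul_zero, zero_add]
  obtain ⟨θ, hθ, hθ0⟩ := exists_chainMap (fun x => hP.exact_zero.apply_apply_eq_zero x) hG
    LinearMap.id
  obtain ⟨t, -, ht⟩ := exists_homotopy hG (fun n => ψ n - θ n ∘ₗ φ n) (fun n x => by
      rw [LinearMap.sub_apply, LinearMap.sub_apply, map_sub, hψ, LinearMap.comp_apply,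
        LinearMap.comp_apply, hθ, hφ]) (fun x => by
      rw [LinearMap.sub_apply, map_sub, LinearMap.comp_apply, hθ0, LinearMap.id_apply, hφ0,
        sub_eq_zero]
      exact hη x)
  by_contra! hcon
  let q : (cone β hβ).X (ys.length + 1) →ₗ[R] (kos ys).X ys.length :=
    coneSnd hγ ys.length ∘ₗ LinearMap.fst R ((cone γ hγ).X ys.length) ((kos ys).X (ys.length + 1))
  -- The component in `kos ys` of degree `ys.length`, reduced modulo 𝔪. Boundaries contribute only
  -- `± γ l` to it, since `kos ys` is zero above that degree; these values are nonunits by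
  -- assumption.
  let σ : (cone β hβ).X (ys.length + 1) →ₗ[R] ResidueField R :=
    Algebra.linearMap R (ResidueField R) ∘ₗ kosTop ys ∘ₗ q
  have hσ : ∀ x, σ ((cone β hβ).d (ys.length + 1) x) = 0 := by
    rintro ⟨⟨l, k⟩, c⟩
    have h1 : q ((cone β hβ).d (ys.length + 1)
        (((l, k), c) : (L.complex.X ys.length × (kos ys).X (ys.length + 1)) ×
          (kos ys).X (ys.length + 2))) = (-1 : R) ^ ys.length • γ ys.length l := by
      refine (coneSnd_d hγ ys.length l k).trans ?_
      rw [kos_d_length, add_zero]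
    refine (congrArg (fun z => algebraMap R (ResidueField R) (kosTop ys z)) h1).trans ?_
    refine (residue_eq_zero_iff _).mpr ?_
    rw [map_smul]
    exact Ideal.mul_mem_left _ _ ((mem_maximalIdeal _).mpr (hcon l))
  have h1 := ht ys.length (kosGen (lam :: ys))
  have h2 := congrArg σ h1
  rw [map_add, hσ, zero_add] at h2
  -- `ψ` and `θ ∘ φ` are homotopic. Of the two homotopy terms one dies because `σ` is a cocycle, the
  -- other because Koszul differentials are zero modulo 𝔪.
  have h3 : σ (t ys.length ((kos (lam :: ys)).d ys.length (kosGen (lam :: ys)))) = 0 :=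
    map_kos_d_eq_zero hm ys.length (σ ∘ₗ t ys.length) _
  have h4 : σ (θ (ys.length + 1) (φ (ys.length + 1) (kosGen (lam :: ys)))) = 0 := by
    refine hφσ (σ ∘ₗ θ (ys.length + 1)) (fun x => ?_) _
    rw [LinearMap.comp_apply, ← hθ, hσ]
  have h5 : σ (ψ (ys.length + 1) (kosGen (lam :: ys))) = 1 := by
    have h6 : q (ψ (ys.length + 1) (kosGen (lam :: ys))) = kosGen ys :=
      coneSnd_coneInr hγ ys.length (kosGen ys)
    refine (congrArg (fun z => algebraMap R (ResidueField R) (kosTop ys z)) h6).trans ?_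
    rw [kosTop_kosGen, map_one]
  have h7 := (congrArg σ (LinearMap.sub_apply (ψ (ys.length + 1))
    (θ (ys.length + 1) ∘ₗ φ (ys.length + 1)) (kosGen (lam :: ys)))).symm.trans (h2.trans h3)
  rw [map_sub, h5, sub_eq_zero] at h7
  exact one_ne_zero (h7.trans h4)

theorem hasFreeSummand_of_koszulToTor_eq_zero {d : ℕ} (x : Fin d → R) (lam : R) (J : Ideal R)
    (a : Fin (d + 1) → R) (hax : a = Fin.snoc x lam) (hJ : J = Ideal.span (Set.range a))
    (hx : IsRegular R (List.ofFn x)) (ha : ∀ i, a i ∈ maximalIdeal R)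
    (h : koszulToTor a ha (d + 1) = 0)
    (L : MinimalFreeResolution R (CanonicalModule J (Ideal.span (Set.range x)))) :
    HasFreeSummand R (L.Syz d) := by
  subst hJ
  obtain ⟨ys, hys⟩ : ∃ ys, (List.ofFn x).reverse = ys := ⟨_, rfl⟩
  -- Since `lam` comes last in `a`, it heads the reversed list and is adjoined by the outermost
  -- cone.
  have hlist : (List.ofFn a).reverse = lam :: ys := by
    rw [hax, List.ofFn_succ', List.concat_eq_append, List.reverse_append, ← hys]
    simp
  have hX : Ideal.ofList ys = Ideal.span (Set.range x) := by
    rw [← hys, ofList_reverse, ofList_ofFn]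
  obtain rfl : ys.length = d := by rw [← hys, List.length_reverse, List.length_ofFn]
  have hreg : RegularOver ⊥ ys := by
    rw [← isWeaklyRegular_reverse_iff, ← hys, List.reverse_reverse]
    exact hx.toIsWeaklyRegular
  have hJ : Ideal.ofList (lam :: ys) = Ideal.span (Set.range a) := by
    rw [← hlist, ofList_reverse, ofList_ofFn]
  obtain ⟨P, ε, hproj, hP, φ, hφ, hφ0, hφσ⟩ :=
    exists_resolution_of_koszulToTor_eq_zero a ha _ h hlist
  obtain ⟨γ, hγ, hγ0⟩ := exists_chainMap (K := L.complex) (ε := L.aug)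
    (fun x => L.exact_aug.apply_apply_eq_zero x) (isResolution_kos hreg hX)
    (canonicalInclusion _ _)
  have hm : ∀ y ∈ lam :: ys, y ∈ maximalIdeal R := by
    intro y hy
    rw [← hlist, List.mem_reverse, List.mem_ofFn] at hy
    obtain ⟨i, rfl⟩ := hy
    exact ha i
  obtain ⟨l, hl⟩ := exists_isUnit_kosTop hreg hm hX hJ L hγ hγ0 hP hφ hφ0 hφσ
  exact hasFreeSummand_of_isUnit L ys γ hγ l hl

end Local

/-! ### Part (2): from a free summand to a nonzero map on Tor -/

section Converse

variable {R : Type u} [CommRing R] [IsLocalRing R]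

open ModComplex

/-- If every homomorphism `Ω → R/X` is a multiple of the inclusion and `Syzᵈ(Ω)` has a free
summand, then `Tor_d(Ω, k) → Tor_d(R/X, k)` is nonzero. -/
theorem canonicalTorMap_ne_zero {I X : Ideal R} {ys : List R} (hys : RegularOver ⊥ ys)
    (hX : Ideal.ofList ys = X) (hI : ∀ y ∈ ys, y ∈ I)
    (hend : ∀ h : CanonicalModule I X →ₗ[R] R ⧸ X, ∃ r : R, ∀ ω,
      h ω = r • canonicalInclusion I X ω)
    (L : MinimalFreeResolution R (CanonicalModule I X)) (hL : HasFreeSummand R (L.Syz ys.length)) :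
    canonicalTorMap I X ys.length ≠ 0 := by
  intro htor
  have hC := isResolution_kos hys hX
  obtain ⟨φ, hφ⟩ := exists_surjective_of_hasFreeSummand hL
  let ψ : L.complex.X ys.length →ₗ[R] R := φ ∘ₗ (LinearMap.range (L.d ys.length)).mkQ
  have hψ : ∀ x, ψ (L.complex.d ys.length x) = 0 := fun x => by
    have h1 : (LinearMap.range (L.d ys.length)).mkQ (L.d ys.length x) = 0 :=
      (Submodule.Quotient.mk_eq_zero _).mpr (LinearMap.mem_range_self _ _)
    exact (congrArg φ h1).trans (map_zero φ)
  -- Multiplication by `y` lifts the zero endomorphism of Ω, hence is null-homotopic.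
  have hnull : ∀ y ∈ ys, L.complex.SMulNull y := by
    intro y hy
    obtain ⟨s, -, hs⟩ := exists_homotopy L.isResolution
      (fun n => y • (LinearMap.id : L.complex.X n →ₗ[R] L.complex.X n))
      (isChainMap_smul L.complex y) (fun x => (map_smul L.aug y x).trans
        (smul_canonicalModule_eq_zero (hI y hy) _))
    exact ⟨s, fun n x => (hs n x).symm⟩
  obtain ⟨w, hw, hwψ⟩ := exists_chainMap_kos ys L.complex hnull ψ hψ
  obtain ⟨f, hf, hf0, hfσ⟩ := exists_chainMap_of_canonicalTorMap_eq_zero I X _ htor L hC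
  let η : (kos ys).X 0 →ₗ[R] R ⧸ X := X.mkQ ∘ₗ kosZero ys
  -- `h` is the map that `w` induces on the resolved modules.
  obtain ⟨h, hh⟩ : ∃ h : CanonicalModule I X →ₗ[R] R ⧸ X, ∀ x, h (L.aug x) = η (w 0 x) := by
    have hker : LinearMap.ker L.aug ≤ LinearMap.ker (η ∘ₗ w 0) := by
      intro x hx
      obtain ⟨z, rfl⟩ := (L.exact_aug x).mp hx
      exact (congrArg η (hw 0 z)).symm.trans (hC.exact_zero.apply_apply_eq_zero _)
    refine ⟨(LinearMap.ker L.aug).liftQ _ hker ∘ₗ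
      (L.aug.quotKerEquivOfSurjective L.aug_surjective).symm.toLinearMap, fun x => ?_⟩
    rw [LinearMap.comp_apply, LinearEquiv.coe_coe,
      (LinearEquiv.symm_apply_eq _).mpr (show L.aug x =
        L.aug.quotKerEquivOfSurjective L.aug_surjective (Submodule.Quotient.mk x) from rfl)]
    rfl
  obtain ⟨r, hr⟩ := hend h
  obtain ⟨s, hs0, hs⟩ := exists_homotopy hC (fun n => w n - r • f n)
    (fun n x => by simp [hw n x, hf n x])
    (fun x => by
      have h1 : (X.mkQ ∘ₗ kosZero ys) (w 0 x) = h (L.aug x) := (hh x).symm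
      rw [LinearMap.sub_apply, LinearMap.smul_apply, map_sub, map_smul, hf0, h1, hr, sub_self])
  let σ : (kos ys).X ys.length →ₗ[R] ResidueField R :=
    Algebra.linearMap R (ResidueField R) ∘ₗ kosTop ys
  have hσ : ∀ x, σ ((kos ys).d ys.length x) = 0 := fun x => by rw [kos_d_length, map_zero]
  -- The degree is made a variable because the homotopy formula distinguishes degree zero. In
  -- positive degree the term `s ∘ d` dies in `k` by minimality of `L`.
  have key : ∀ n, n = ys.length → ∀ (τ : (kos ys).X n →ₗ[R] ResidueField R),
      (∀ x, τ ((kos ys).d n x) = 0) → ∀ l, τ ((w n - r • f n) l) = 0 := by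
    rintro (_ | n) - τ hτ l
    · rw [hs0, hτ]
    · rw [hs, map_add, hτ, zero_add]
      have h1 : (τ ∘ₗ s n) (L.complex.d n l) ∈ maximalIdeal R • (⊤ : Submodule R (ResidueField R)) :=
        map_mem_smul_top (τ ∘ₗ s n) (L.minimal n (LinearMap.mem_range_self _ l))
      refine Submodule.smul_induction_on h1 (fun a ha c _ => smul_residueField_eq_zero ha c) ?_
      intro a b ha hb
      rw [ha, hb, add_zero]
  obtain ⟨l, h3⟩ : ∃ l : L.complex.X ys.length, ψ l = 1 := by
    obtain ⟨q, hq⟩ := hφ 1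
    obtain ⟨l, rfl⟩ := Submodule.Quotient.mk_surjective _ q
    exact ⟨l, hq⟩
  have h1 := key ys.length rfl σ hσ l
  rw [LinearMap.sub_apply, LinearMap.smul_apply, map_sub, map_smul, hfσ σ hσ, smul_zero,
    sub_zero] at h1
  have h2 : σ (w ys.length l) = algebraMap R (ResidueField R) (ψ l) :=
    congrArg (algebraMap R (ResidueField R)) (hwψ l)
  rw [h1, h3, map_one] at h2
  exact zero_ne_one h2

end Converse

/-! ### Associated primes and exchange along regular sequences -/

section RegularSequences

variable {R : Type u} [CommRing R]

theorem mem_sup_span_singleton_iff {𝔟 : Ideal R} {a r : R} :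
    r ∈ 𝔟 ⊔ Ideal.span {a} ↔ ∃ c, r - a * c ∈ 𝔟 := by
  constructor
  · intro h
    obtain ⟨b, hb, y, hy, rfl⟩ := Submodule.mem_sup.mp h
    obtain ⟨c, rfl⟩ := Ideal.mem_span_singleton'.mp hy
    exact ⟨c, by rwa [mul_comm a c, add_sub_cancel_right]⟩
  · rintro ⟨c, hc⟩
    refine Submodule.mem_sup.mpr ⟨_, hc, a * c, ?_, sub_add_cancel _ _⟩
    exact Ideal.mul_mem_right _ _ (Ideal.mem_span_singleton_self a)

/-- The element `y` is a nonzerodivisor on `R ⧸ 𝔟`. -/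
def NZDMod (𝔟 : Ideal R) (y : R) : Prop := ∀ r, y * r ∈ 𝔟 → r ∈ 𝔟

/-- The ideal `P` is an associated prime of `R ⧸ 𝔶`. -/
def AssocAt (𝔶 P : Ideal R) : Prop := P.IsPrime ∧ ∃ v, ∀ s, s * v ∈ 𝔶 ↔ s ∈ P

theorem AssocAt.le {𝔶 P : Ideal R} (h : AssocAt 𝔶 P) : 𝔶 ≤ P := by
  obtain ⟨_, v, hv⟩ := h
  exact fun s hs => (hv s).mp (Ideal.mul_mem_right _ _ hs)

theorem AssocAt.notMem {𝔶 P : Ideal R} (h : AssocAt 𝔶 P) {y : R} (hy : NZDMod 𝔶 y) : y ∉ P := by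
  obtain ⟨hP, v, hv⟩ := h
  intro hyP
  refine hP.ne_top ((Ideal.eq_top_iff_one P).mpr ((hv 1).mp ?_))
  rw [one_mul]
  exact hy v ((hv y).mpr hyP)

section Noetherian

variable [IsNoetherianRing R]

theorem isAssociatedPrime_quotient_iff {𝔶 P : Ideal R} :
    IsAssociatedPrime P (R ⧸ 𝔶) ↔ AssocAt 𝔶 P := by
  rw [isAssociatedPrime_iff, AssocAt, and_congr_right_iff]
  intro _
  constructor
  · rintro ⟨x, rfl⟩
    obtain ⟨v, rfl⟩ := Submodule.Quotient.mk_surjective _ x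
    refine ⟨v, fun s => ?_⟩
    rw [Submodule.mem_colon_singleton, Submodule.mem_bot, ← Submodule.Quotient.mk_smul,
      Submodule.Quotient.mk_eq_zero, smul_eq_mul]
  · rintro ⟨v, hv⟩
    refine ⟨Submodule.Quotient.mk v, Ideal.ext fun s => ?_⟩
    rw [Submodule.mem_colon_singleton, Submodule.mem_bot, ← Submodule.Quotient.mk_smul,
      Submodule.Quotient.mk_eq_zero, smul_eq_mul, hv]

/-- An element nonzero in the localization of `R ⧸ 𝔶` at `Q` has a multiple whose annihilator is
a prime contained in `Q`. -/
theorem exists_assoc_le {𝔶 Q : Ideal R} [hQ : Q.IsPrime] {v : R} (hv : ∀ s ∉ Q, s * v ∉ 𝔶) :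
    ∃ (c : R) (P : Ideal R), P.IsPrime ∧ P ≤ Q ∧ ∀ s, s * (c * v) ∈ 𝔶 ↔ s ∈ P := by
  -- Annihilators of those multiples of `v` that stay nonzero at `Q`; a maximal one is prime.
  let S : Set (Ideal R) :=
    {P | ∃ c, (∀ s ∉ Q, s * (c * v) ∉ 𝔶) ∧ ∀ s, s * (c * v) ∈ 𝔶 ↔ s ∈ P}
  have key : ∀ c, (∀ s ∉ Q, s * (c * v) ∉ 𝔶) → ∃ P ∈ S, ∀ s, s * (c * v) ∈ 𝔶 ↔ s ∈ P := by
    intro c hc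
    refine ⟨Submodule.comap (LinearMap.mulRight R (c * v)) 𝔶, ⟨c, hc, fun s => Iff.rfl⟩, fun s => Iff.rfl⟩
  have hS : S.Nonempty := by
    obtain ⟨P, hP, -⟩ := key 1 (by simpa using hv)
    exact ⟨P, hP⟩
  obtain ⟨P, ⟨c, hc, hP⟩, hmax⟩ := set_has_maximal_iff_noetherian.mpr ‹_› S hS
  have hPQ : P ≤ Q := fun s hs => by
    by_contra h
    exact hc s h ((hP s).mpr hs)
  refine ⟨c, P, ⟨fun h => ?_, fun {a b} hab => ?_⟩, hPQ, hP⟩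
  · exact hQ.ne_top (top_le_iff.mp (h ▸ hPQ))
  · by_contra! hcon
    -- By maximality, a further factor `t` that keeps the element nonzero at `Q` does not enlarge
    -- its annihilator.
    have hstep : ∀ t, (∀ s ∉ Q, s * ((t * c) * v) ∉ 𝔶) → ∀ s, s * t ∈ P → s ∈ P := by
      intro t ht s hs
      obtain ⟨P', hP', hP''⟩ := key (t * c) ht
      have hle : P ≤ P' := fun x hx => (hP'' x).mp (by
        have := Ideal.mul_mem_left 𝔶 t ((hP x).mpr hx)
        convert this using 1; ring)
      have heq : P = P' := by
        by_contra hne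
        exact hmax P' hP' (lt_of_le_of_ne hle hne)
      rw [heq]
      refine (hP'' s).mp ?_
      have := (hP _).mpr hs
      convert this using 1; ring
    by_cases ha : ∀ s ∉ Q, s * ((a * c) * v) ∉ 𝔶
    · exact hcon.2 (hstep a ha b (by rwa [mul_comm]))
    -- Here some `s ∉ Q` kills `a * c * v`. Then `s * a` lies in `P`, and `s` is itself an
    -- admissible factor, so `a` lies in `P`.
    · push Not at ha
      obtain ⟨s, hs, hsa⟩ := ha
      refine hcon.1 (hstep s (fun t ht h => ?_) a ((hP _).mp (by convert hsa using 1; ring)))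
      refine hc (t * s) (fun h' => (hQ.mem_or_mem h').elim ht hs) ?_
      convert h using 1; ring

/-- The class of `1` is nonzero at `P`, so some associated prime lies inside `P`; minimality makes
it equal to `P`. -/
theorem assocAt_of_mem_minimalPrimes {𝔶 P : Ideal R} (hP : P ∈ 𝔶.minimalPrimes) :
    AssocAt 𝔶 P := by
  have := hP.1.1
  obtain ⟨c, P', hP', hle, h⟩ := exists_assoc_le (𝔶 := 𝔶) (Q := P) (v := 1)
    (fun s hs h => hs (hP.1.2 (by simpa using h)))
  have hA : AssocAt 𝔶 P' := ⟨hP', _, h⟩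
  rwa [← le_antisymm hle (hP.2 ⟨hP', hA.le⟩ hle)]

/-- Prime avoidance for the associated primes of two ideals. -/
theorem exists_nzdMod {𝔶 𝔷 p : Ideal R} (h₁ : ∀ P, AssocAt 𝔶 P → ¬ p ≤ P)
    (h₂ : ∀ P, AssocAt 𝔷 P → ¬ p ≤ P) : ∃ w ∈ p, NZDMod 𝔶 w ∧ NZDMod 𝔷 w := by
  have hfin := (associatedPrimes.finite R (R ⧸ 𝔶)).union (associatedPrimes.finite R (R ⧸ 𝔷))
  have hnot : ¬ ((p : Set R) ⊆
      ⋃ P ∈ associatedPrimes R (R ⧸ 𝔶) ∪ associatedPrimes R (R ⧸ 𝔷), (P : Set R)) := by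
    intro h
    obtain ⟨P, hP, hle⟩ := (p.subset_union_prime_finite hfin (f := id) 0 0
      fun P hP _ _ => hP.elim (fun h => h.isPrime) (fun h => h.isPrime)).mp h
    rcases hP with hP | hP
    · exact h₁ P (isAssociatedPrime_quotient_iff.mp hP) hle
    · exact h₂ P (isAssociatedPrime_quotient_iff.mp hP) hle
  obtain ⟨w, hw, hwn⟩ := Set.not_subset.mp hnot
  have hz : ∀ 𝔞 : Ideal R, w ∉ ⋃ P ∈ associatedPrimes R (R ⧸ 𝔞), (P : Set R) → NZDMod 𝔞 w := by
    intro 𝔞 h r hr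
    rw [biUnion_associatedPrimes_eq_zero_divisors] at h
    by_contra hr'
    refine h ⟨Submodule.Quotient.mk r, fun h0 => hr' ((Submodule.Quotient.mk_eq_zero _).mp h0), ?_⟩
    exact (Submodule.Quotient.mk_eq_zero 𝔞).mpr hr
  refine ⟨w, hw, hz 𝔶 fun h => hwn ?_, hz 𝔷 fun h => hwn ?_⟩
  · exact Set.biUnion_subset_biUnion_left Set.subset_union_left h
  · exact Set.biUnion_subset_biUnion_left Set.subset_union_right h

/-- A minimal prime over the earlier elements is associated to them, so it misses the next regular
element and the height must grow. -/
theorem length_le_height {xs : List R} (hxs : RegularOver ⊥ xs) {P : Ideal R} [P.IsPrime]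
    (hP : ∀ x ∈ xs, x ∈ P) : (xs.length : ℕ∞) ≤ P.height := by
  induction xs generalizing P with
  | nil => simp
  | cons y ys ih =>
    have hle : Ideal.ofList ys ≤ P := Ideal.span_le.mpr fun x hx => hP x (by simp [show x ∈ ys from hx])
    obtain ⟨P', hP', hP'le⟩ := Ideal.exists_minimalPrimes_le hle
    have := hP'.1.1
    have hA := assocAt_of_mem_minimalPrimes hP'
    have hy : NZDMod (Ideal.ofList ys) y := by
      have := hxs.2
      rwa [bot_sup_eq] at this
    have hlt : P' < P := lt_of_le_of_ne hP'le fun h =>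
      hA.notMem hy (h ▸ hP y (by simp))
    have h1 := ih hxs.1 (P := P') fun x hx => hP'.1.2 (Ideal.subset_span hx)
    rw [List.length_cons, Nat.cast_add, Nat.cast_one]
    exact (add_le_add_left h1 1).trans (Ideal.height_add_one_le_of_lt_of_isPrime hlt)

end Noetherian

/-- For nonzerodivisors `a`, `b` in `P`, Hom(R/P, R/(𝔶 + a)) and Hom(R/P, R/(𝔶 + b)) are both
Ext¹(R/P, R/𝔶). This is the isomorphism on elements: `u` corresponds to the `u'` with `a u ≡ b u'`
modulo `𝔶`. -/
theorem exchange_aux {P 𝔶 : Ideal R} {a b : R} (ha : a ∈ P) (h₂ : NZDMod 𝔶 b) {u : R}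
    (hu : ∀ p ∈ P, p * u ∈ 𝔶 ⊔ Ideal.span {b}) :
    ∃ u', a * u - b * u' ∈ 𝔶 ∧ ∀ p ∈ P, p * u' ∈ 𝔶 ⊔ Ideal.span {a} := by
  obtain ⟨u', hu'⟩ := mem_sup_span_singleton_iff.mp (hu a ha)
  refine ⟨u', hu', fun p hp => ?_⟩
  obtain ⟨c, hc⟩ := mem_sup_span_singleton_iff.mp (hu p hp)
  refine mem_sup_span_singleton_iff.mpr ⟨c, h₂ _ ?_⟩
  have := sub_mem (Ideal.mul_mem_left 𝔶 a hc) (Ideal.mul_mem_left 𝔶 p hu')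
  convert this using 1; ring

/-- The socle of the localization of `R ⧸ 𝔶` at `P` has dimension at most one. -/
def SimpleSocleAt (P 𝔶 : Ideal R) : Prop :=
  ∀ u v, (∀ p ∈ P, p * u ∈ 𝔶) → (∀ p ∈ P, p * v ∈ 𝔶) → (∀ s ∉ P, s * v ∉ 𝔶) →
    ∃ s ∉ P, ∃ t, s * u - t * v ∈ 𝔶

/-- The correspondence of `exchange_aux` preserves both linear relations and nonvanishing at `P`,
since `a` can be cancelled modulo `𝔶`. -/
theorem SimpleSocleAt.exchange {P 𝔶 : Ideal R} {a b : R} (ha : a ∈ P)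
    (h₁ : NZDMod 𝔶 a) (h₂ : NZDMod 𝔶 b) (h : SimpleSocleAt P (𝔶 ⊔ Ideal.span {a})) :
    SimpleSocleAt P (𝔶 ⊔ Ideal.span {b}) := by
  intro u v hu hv hvn
  obtain ⟨u', hu', hu''⟩ := exchange_aux ha h₂ hu
  obtain ⟨v', hv', hv''⟩ := exchange_aux ha h₂ hv
  obtain ⟨s, hs, t, hst⟩ := h u' v' hu'' hv'' (by
    intro s hs hsv
    obtain ⟨e, he⟩ := mem_sup_span_singleton_iff.mp hsv
    refine hvn s hs (mem_sup_span_singleton_iff.mpr ⟨e, h₁ _ ?_⟩)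
    have := add_mem (Ideal.mul_mem_left 𝔶 s hv') (Ideal.mul_mem_left 𝔶 b he)
    convert this using 1; ring)
  refine ⟨s, hs, t, ?_⟩
  obtain ⟨e, he⟩ := mem_sup_span_singleton_iff.mp hst
  refine mem_sup_span_singleton_iff.mpr ⟨e, h₁ _ ?_⟩
  have := add_mem (sub_mem (Ideal.mul_mem_left 𝔶 s hu') (Ideal.mul_mem_left 𝔶 t hv'))
    (Ideal.mul_mem_left 𝔶 b he)
  convert this using 1; ring

theorem AssocAt.exchange {P 𝔶 : Ideal R} {a b : R} (hb : b ∈ P)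
    (h₁ : NZDMod 𝔶 a) (h₂ : NZDMod 𝔶 b) (h : AssocAt (𝔶 ⊔ Ideal.span {a}) P) :
    AssocAt (𝔶 ⊔ Ideal.span {b}) P := by
  obtain ⟨hP, v, hv⟩ := h
  obtain ⟨v', hv', hv''⟩ := exchange_aux hb h₁ (fun p hp => (hv p).mpr hp)
  refine ⟨hP, v', fun s => ⟨fun hs => (hv s).mp ?_, hv'' s⟩⟩
  obtain ⟨e, he⟩ := mem_sup_span_singleton_iff.mp hs
  refine mem_sup_span_singleton_iff.mpr ⟨e, h₂ _ ?_⟩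
  have := add_mem (Ideal.mul_mem_left 𝔶 s hv') (Ideal.mul_mem_left 𝔶 a he)
  convert this using 1; ring

variable [IsLocalRing R] [IsNoetherianRing R]

/-- Nakayama's lemma for the image of `U` in `R ⧸ 𝔟`. -/
theorem le_of_le_sup_smul {U 𝔟 : Ideal R} {a : R} (ha : a ∈ maximalIdeal R)
    (h : ∀ u ∈ U, ∃ u' ∈ U, u - a * u' ∈ 𝔟) : U ≤ 𝔟 := by
  refine Submodule.le_of_le_smul_of_le_jacobson_bot (I := maximalIdeal R)
    (IsNoetherian.noetherian U) (maximalIdeal_le_jacobson _) fun u hu => ?_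
  obtain ⟨u', hu', h'⟩ := h u hu
  exact Submodule.mem_sup.mpr ⟨_, h', a * u', Submodule.smul_mem_smul ha hu', sub_add_cancel _ _⟩

/-- Permutability of a two-term regular sequence in a local ring. The annihilator of `w` modulo `𝔟`
equals `a` times itself, so it is zero by Nakayama; the second claim is direct cancellation of `a`.
-/
theorem NZDMod.swap {𝔟 : Ideal R} {a w : R} (ha : a ∈ maximalIdeal R) (h₁ : NZDMod 𝔟 a)
    (h₂ : NZDMod (𝔟 ⊔ Ideal.span {a}) w) :
    NZDMod 𝔟 w ∧ NZDMod (𝔟 ⊔ Ideal.span {w}) a := by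
  constructor
  · refine le_of_le_sup_smul (U := Submodule.comap (LinearMap.mulLeft R w) 𝔟) ha fun r hr => ?_
    have hr : w * r ∈ 𝔟 := hr
    obtain ⟨c, hc⟩ := mem_sup_span_singleton_iff.mp (h₂ r (Ideal.mem_sup_left hr))
    refine ⟨c, h₁ _ ?_, hc⟩
    change a * (w * c) ∈ 𝔟
    have := sub_mem hr (Ideal.mul_mem_left 𝔟 w hc)
    convert this using 1; ring
  · intro r hr
    obtain ⟨t, ht⟩ := mem_sup_span_singleton_iff.mp hr
    have h3 : w * t ∈ 𝔟 ⊔ Ideal.span {a} := mem_sup_span_singleton_iff.mpr ⟨r, by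
      have := neg_mem ht
      convert this using 1; ring⟩
    obtain ⟨t', ht'⟩ := mem_sup_span_singleton_iff.mp (h₂ t h3)
    refine mem_sup_span_singleton_iff.mpr ⟨t', h₁ _ ?_⟩
    have := add_mem ht (Ideal.mul_mem_left 𝔟 w ht')
    convert this using 1; ring

/-- The last element `w` is moved to the front by successive swaps. -/
theorem RegularOver.cons_front {𝔟 : Ideal R} {w : R} {ys : List R}
    (hm : ∀ y ∈ ys, y ∈ maximalIdeal R) (h : RegularOver 𝔟 (w :: ys)) :
    RegularOver (𝔟 ⊔ Ideal.span {w}) ys := by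
  induction ys with
  | nil => trivial
  | cons y ys ih =>
    obtain ⟨⟨h1, h2⟩, h3⟩ := h
    rw [sup_ofList_cons] at h3
    obtain ⟨h4, h5⟩ := NZDMod.swap (hm y (by simp)) h2 h3
    refine ⟨ih (fun z hz => hm z (by simp [hz])) ⟨h1, h4⟩, ?_⟩
    rw [sup_right_comm]
    exact h5

/-- A property of ideals that can be exchanged along one element of a regular sequence can be
exchanged along regular sequences of the same length. -/
theorem RegularOver.exchange {P : Ideal R} (hP : P ≤ maximalIdeal R) (Φ : Ideal R → Prop)
    (hΦ : ∀ 𝔶 a b, a ∈ P → b ∈ P → NZDMod 𝔶 a → NZDMod 𝔶 b →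
      Φ (𝔶 ⊔ Ideal.span {a}) → Φ (𝔶 ⊔ Ideal.span {b})) {ys zs : List R}
    (hlen : ys.length = zs.length) {𝔟 : Ideal R} (hys : RegularOver 𝔟 ys)
    (hzs : RegularOver 𝔟 zs) (hyP : ∀ y ∈ ys, y ∈ P) (hzP : ∀ z ∈ zs, z ∈ P)
    (h : Φ (𝔟 ⊔ Ideal.ofList ys)) : Φ (𝔟 ⊔ Ideal.ofList zs) := by
  induction ys generalizing zs 𝔟 with
  | nil =>
    obtain rfl := List.length_eq_zero_iff.mp hlen.symm
    exact h
  | cons y ys ih =>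
    obtain _ | ⟨z, zs⟩ := zs
    · simp at hlen
    -- A common `w`, regular after both shortened sequences, mediates: exchange `y` for `w`, move
    -- `w` into the base ideal, exchange the shorter sequences inductively, then exchange `w` for
    -- `z`.
    obtain ⟨w, hwP, hw1, hw2⟩ := exists_nzdMod (𝔶 := 𝔟 ⊔ Ideal.ofList ys)
      (𝔷 := 𝔟 ⊔ Ideal.ofList zs) (p := P)
      (fun Q hQ hle => hQ.notMem hys.2 (hle (hyP y (by simp))))
      (fun Q hQ hle => hQ.notMem hzs.2 (hle (hzP z (by simp))))
    have hyP' : ∀ y ∈ ys, y ∈ P := fun x hx => hyP x (by simp [hx])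
    have hzP' : ∀ y ∈ zs, y ∈ P := fun x hx => hzP x (by simp [hx])
    rw [sup_ofList_cons] at h ⊢
    refine hΦ _ w z hwP (hzP z (by simp)) hw2 hzs.2 ?_
    have h1 := hΦ _ y w (hyP y (by simp)) hwP hys.2 hw1 h
    rw [sup_right_comm] at h1 ⊢
    exact ih (by simpa using hlen)
      (RegularOver.cons_front (fun x hx => hP (hyP' x hx)) ⟨hys.1, hw1⟩)
      (RegularOver.cons_front (fun x hx => hP (hzP' x hx)) ⟨hzs.1, hw2⟩) hyP' hzP' h1

/-- If `y` is regular on `R ⧸ 𝔟`, every associated prime of `R ⧸ 𝔟` is properly contained in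
an associated prime of `R ⧸ (𝔟 + y)`. -/
theorem AssocAt.exists_gt {𝔟 P : Ideal R} {y : R} (hy : y ∈ maximalIdeal R) (h : NZDMod 𝔟 y)
    (hP : AssocAt 𝔟 P) : ∃ Q, AssocAt (𝔟 ⊔ Ideal.span {y}) Q ∧ P ≤ Q ∧ y ∈ Q := by
  obtain ⟨hPp, v, hv⟩ := id hP
  -- If every element of `𝔟 : P` lay in `𝔟 + (y)`, cancelling `y` would give `𝔟 : P ⊆ 𝔟 + y (𝔟 :
  -- P)`, and Nakayama would put `v` in `𝔟`.
  obtain ⟨u, hu, hun⟩ : ∃ u, (∀ p ∈ P, p * u ∈ 𝔟) ∧ u ∉ 𝔟 ⊔ Ideal.span {y} := by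
    by_contra! hcon
    have hU : 𝔟.colon (P : Set R) ≤ 𝔟 := by
      refine le_of_le_sup_smul hy fun u hu => ?_
      rw [Submodule.mem_colon] at hu
      obtain ⟨c, hc⟩ := mem_sup_span_singleton_iff.mp (hcon u fun p hp => by
        rw [mul_comm]; exact hu p hp)
      refine ⟨c, Submodule.mem_colon.mpr fun p hp => h _ ?_, hc⟩
      have := sub_mem (hu p hp) (Ideal.mul_mem_left 𝔟 p hc)
      convert this using 1
      rw [smul_eq_mul, smul_eq_mul]; ring
    have hvb : v ∈ 𝔟 := hU (Submodule.mem_colon.mpr fun p hp => by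
      rw [smul_eq_mul, mul_comm]; exact (hv p).mpr hp)
    exact hPp.ne_top ((Ideal.eq_top_iff_one P).mpr ((hv 1).mp (by rwa [one_mul])))
  obtain ⟨c, Q, hQ, -, hQv⟩ := exists_assoc_le (𝔶 := 𝔟 ⊔ Ideal.span {y}) (Q := maximalIdeal R)
    (v := u) (fun s hs hsu => hun (by
      rw [mem_maximalIdeal, mem_nonunits_iff, not_not] at hs
      exact (Ideal.unit_mul_mem_iff_mem _ hs).mp hsu))
  refine ⟨Q, ⟨hQ, _, hQv⟩, fun p hp => (hQv p).mp (Ideal.mem_sup_left ?_), (hQv y).mp ?_⟩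
  · have := Ideal.mul_mem_left 𝔟 c (hu p hp)
    convert this using 1; ring
  · exact Ideal.mem_sup_right (Ideal.mul_mem_right _ _ (Ideal.mem_span_singleton_self y))

theorem AssocAt.exists_height_add_length_le {𝔟 P : Ideal R} {ys : List R}
    (hm : ∀ y ∈ ys, y ∈ maximalIdeal R) (h : RegularOver 𝔟 ys) (hP : AssocAt 𝔟 P) :
    ∃ Q, AssocAt (𝔟 ⊔ Ideal.ofList ys) Q ∧ P.height + ys.length ≤ Q.height := by
  induction ys with
  | nil => exact ⟨P, by simpa using hP, by simp⟩
  | cons y ys ih =>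
    obtain ⟨Q, hQ, hle⟩ := ih (fun z hz => hm z (by simp [hz])) h.1
    obtain ⟨Q', hQ', hQQ', hyQ'⟩ := hQ.exists_gt (hm y (by simp)) h.2
    have := hQ.1
    have := hQ'.1
    have hlt : Q < Q' := lt_of_le_of_ne hQQ' fun he => hQ.notMem h.2 (he ▸ hyQ')
    refine ⟨Q', by rwa [sup_ofList_cons], ?_⟩
    rw [List.length_cons, Nat.cast_add, Nat.cast_one, ← add_assoc]
    exact (add_le_add_left hle 1).trans (Ideal.height_add_one_le_of_lt_of_isPrime hlt)

end RegularSequences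

/-! ### Regular parameters form a regular sequence -/

section RegularParameters

/-- Let `Q` be the bottom of a prime chain of maximal length, which is at least `n + 1`. Then `z ∉
Q`, as otherwise the chain survives modulo `z`. Also `Q ⊆ (z)`: otherwise cutting the domain `R/(z)`
by an element of `Q` lowers its dimension, while cutting `R/Q` by `z` loses at most one, and the
chain is too short. So `Q = zQ`, and Nakayama gives `Q = 0`. -/
theorem eq_bot_of_span_prime {R : Type u} [CommRing R] [IsLocalRing R] [IsNoetherianRing R] {z : R}
    {n : ℕ} (hz : z ∈ maximalIdeal R) (hp : (Ideal.span {z}).IsPrime)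
    (hd : ringKrullDim (R ⧸ Ideal.span {z}) ≤ n) (hn : ((n + 1 : ℕ) : WithBot ℕ∞) ≤ ringKrullDim R) :
    (⊥ : Ideal R).IsPrime ∧ z ≠ 0 := by
  obtain ⟨l, hl⟩ := Ideal.exists_ltSeries_length_eq_height (maximalIdeal R)
  have hlen : n + 1 ≤ l.length := by
    rw [← maximalIdeal_height_eq_ringKrullDim, ← hl.2] at hn
    exact_mod_cast hn
  set Q := l.head.asIdeal with hQdef
  have hQ : Q.IsPrime := l.head.2
  have hdim : ∀ I : Ideal R, I ≤ Q → (l.length : WithBot ℕ∞) ≤ ringKrullDim (R ⧸ I) := by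
    intro I hI
    rw [ringKrullDim_quotient]
    let l' : LTSeries (PrimeSpectrum.zeroLocus (R := R) I) :=
      { length := l.length
        toFun := fun i => ⟨l i, (SetLike.coe_subset_coe.mpr hI).trans (l.monotone (Fin.zero_le i))⟩
        step := fun i => l.step i }
    exact Order.LTSeries.length_le_krullDim l'
  have hzQ : z ∉ Q := fun h => by
    have h1 := hdim (Ideal.span {z}) ((Ideal.span_singleton_le_iff_mem _).mpr h)
    have h2 : (l.length : WithBot ℕ∞) ≤ n := h1.trans hd
    have h3 : l.length ≤ n := by exact_mod_cast h2
    omega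
  have hQz : Q ≤ Ideal.span {z} := by
    by_contra hcon
    obtain ⟨q, hq, hqz⟩ := SetLike.not_le_iff_exists.mp hcon
    have hdom : IsDomain (R ⧸ Ideal.span {z}) := (Ideal.Quotient.isDomain_iff_prime _).mpr hp
    let I := Q ⊔ Ideal.span {z}
    have h1 : ringKrullDim (R ⧸ I) + 1 ≤ ringKrullDim (R ⧸ Ideal.span {z}) := by
      refine ringKrullDim_succ_le_of_surjective (Ideal.Quotient.factor le_sup_right)
        (Ideal.Quotient.factor_surjective _) (r := Ideal.Quotient.mk _ q)
        (mem_nonZeroDivisors_of_ne_zero fun h => hqz (Ideal.Quotient.eq_zero_iff_mem.mp h)) ?_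
      exact Ideal.Quotient.eq_zero_iff_mem.mpr (Ideal.mem_sup_left hq)
    have h2 : ringKrullDim (R ⧸ Q) ≤ ringKrullDim (R ⧸ I) + 1 := by
      have hloc : IsLocalRing (R ⧸ Q) := .of_surjective' (Ideal.Quotient.mk Q) Ideal.Quotient.mk_surjective
      have hlh : IsLocalHom (Ideal.Quotient.mk Q) := .of_surjective _ Ideal.Quotient.mk_surjective
      have h3 := Ideal.height_le_ringKrullDim_quotient_add_one
        (map_nonunit (Ideal.Quotient.mk Q) z hz)
      rw [maximalIdeal_height_eq_ringKrullDim] at h3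
      refine h3.trans ?_
      gcongr
      let J : Ideal (R ⧸ Q) := Ideal.span {Ideal.Quotient.mk Q z}
      refine ringKrullDim_le_of_surjective
        (Ideal.Quotient.lift I ((Ideal.Quotient.mk J).comp (Ideal.Quotient.mk Q)) fun r hr => ?_)
        (Ideal.Quotient.lift_surjective_of_surjective _ _
          (Ideal.Quotient.mk_surjective.comp Ideal.Quotient.mk_surjective))
      obtain ⟨c, hc⟩ := mem_sup_span_singleton_iff.mp hr
      refine Ideal.Quotient.eq_zero_iff_mem.mpr (Ideal.mem_span_singleton'.mpr
        ⟨Ideal.Quotient.mk Q c, ?_⟩)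
      rw [← map_mul, mul_comm, eq_comm]
      exact Ideal.Quotient.eq.mpr hc
    have h4 := (hdim Q le_rfl).trans (h2.trans (h1.trans hd))
    have h5 : l.length ≤ n := by exact_mod_cast h4
    omega
  have hQ0 : Q ≤ ⊥ := by
    refine le_of_le_sup_smul hz fun u hu => ?_
    obtain ⟨c, rfl⟩ := Ideal.mem_span_singleton'.mp (hQz hu)
    exact ⟨c, (hQ.mem_or_mem hu).resolve_right hzQ, by simp [mul_comm]⟩
  have hQ' : Q = ⊥ := le_bot_iff.mp hQ0
  exact ⟨hQ' ▸ hQ, fun h => hzQ (h ▸ zero_mem _)⟩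

/-- Induction on the number of generators, passing to the quotient by the first one; hence the
quantification over all rings. Primality and the dimension bound for the quotient are what
`eq_bot_of_span_prime` consumes, so the three conclusions are proved together. -/
theorem isPrime_bot_of_ofList_eq_maximalIdeal (n : ℕ) : ∀ {R : Type u} [CommRing R]
    [IsLocalRing R] [IsNoetherianRing R] (zs : List R), zs.length = n →
    Ideal.ofList zs = maximalIdeal R → (n : WithBot ℕ∞) ≤ ringKrullDim R →
    (⊥ : Ideal R).IsPrime ∧ IsWeaklyRegular R zs ∧ ringKrullDim R ≤ n := by
  induction n with
  | zero =>
    intro R _ _ _ zs hlen hm _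
    obtain rfl := List.length_eq_zero_iff.mp hlen
    rw [Ideal.ofList_nil] at hm
    have hp : (⊥ : Ideal R).IsPrime := hm ▸ (inferInstance : (maximalIdeal R).IsPrime)
    refine ⟨hp, by simp, ?_⟩
    rw [← maximalIdeal_height_eq_ringKrullDim, ← hm, Ideal.height_bot]
    rfl
  | succ n ih =>
    intro R _ _ _ zs hlen hm hn
    obtain _ | ⟨z, ws⟩ := zs
    · simp at hlen
    have hz : z ∈ maximalIdeal R := hm ▸ Ideal.subset_span (by simp)
    let R' := R ⧸ Ideal.span {z}
    have hle : Ideal.span {z} ≤ maximalIdeal R := (Ideal.span_singleton_le_iff_mem _).mpr hz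
    have : Nontrivial R' := Ideal.Quotient.nontrivial_iff.mpr
      (ne_top_of_le_ne_top (Ideal.IsPrime.ne_top') hle)
    have : IsLocalRing R' :=
      .of_surjective' (Ideal.Quotient.mk (Ideal.span {z})) Ideal.Quotient.mk_surjective
    have hdim : ringKrullDim R ≤ ringKrullDim R' + 1 := by
      rw [← maximalIdeal_height_eq_ringKrullDim]
      exact Ideal.height_le_ringKrullDim_quotient_add_one hz
    have hm' : Ideal.ofList (ws.map (Ideal.Quotient.mk (Ideal.span {z}))) = maximalIdeal R' := by
      rw [← Ideal.map_ofList, ← map_maximalIdeal_of_surjective (Ideal.Quotient.mk (Ideal.span {z}))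
        Ideal.Quotient.mk_surjective, ← hm, Ideal.ofList_cons, Ideal.map_sup,
        Ideal.map_quotient_self, bot_sup_eq]
    have hn' : (n : WithBot ℕ∞) ≤ ringKrullDim R' := by
      have := hn.trans hdim
      rw [Nat.cast_add, Nat.cast_one] at this
      exact ENat.WithBot.add_le_add_one_right_iff.mp this
    obtain ⟨h1, h2, h3⟩ := ih (R := R') _ (by simpa using hlen) hm' hn'
    have hp : (Ideal.span {z}).IsPrime := by
      have : IsDomain R' := IsDomain.of_bot_isPrime R'
      exact (Ideal.Quotient.isDomain_iff_prime _).mp this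
    obtain ⟨h4, h5⟩ := eq_bot_of_span_prime hz hp h3 hn
    refine ⟨h4, ?_, ?_⟩
    · have : IsDomain R := IsDomain.of_bot_isPrime R
      rw [isWeaklyRegular_cons_iff]
      refine ⟨fun a b h => mul_left_cancel₀ h5 h, ?_⟩
      have h6 := (isWeaklyRegular_map_algebraMap_iff (R := R) (S := R') (M := R') ws).mp h2
      refine (LinearEquiv.isWeaklyRegular_congr (Submodule.quotEquivOfEq _ _ ?_) ws).mpr h6
      ext r
      simp [Submodule.mem_smul_pointwise_iff_exists, Ideal.mem_span_singleton', mul_comm, eq_comm]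
    · refine hdim.trans ?_
      rw [Nat.cast_add, Nat.cast_one]
      gcongr

/-- The maximal ideal of a regular local ring is generated by a regular sequence. -/
theorem exists_regularOver_ofList_eq_maximalIdeal (R : Type u) [CommRing R] [IsRegularLocalRing R] :
    ∃ zs : List R, RegularOver ⊥ zs ∧ Ideal.ofList zs = maximalIdeal R ∧
      (maximalIdeal R).height = zs.length := by
  obtain ⟨s, hs, hspan⟩ := Submodule.FG.exists_span_finset_card_eq_spanFinrank
    (IsNoetherian.noetherian (maximalIdeal R))
  have hdim := IsRegularLocalRing.spanFinrank_maximalIdeal (R := R)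
  have hl : Ideal.ofList s.toList = maximalIdeal R := by
    rw [Ideal.ofList, ← hspan]
    simp [Ideal.span]
  have hc : s.toList.length = (maximalIdeal R).spanFinrank := by rw [Finset.length_toList, hs]
  have := isPrime_bot_of_ofList_eq_maximalIdeal _ s.toList hc hl hdim.le
  refine ⟨s.toList.reverse, ?_, by rw [ofList_reverse, hl], ?_⟩
  · rw [← isWeaklyRegular_reverse_iff, List.reverse_reverse]
    exact this.2.1
  · rw [List.length_reverse, hc]
    have h := hdim
    rw [← maximalIdeal_height_eq_ringKrullDim] at h
    exact_mod_cast h.symm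

end RegularParameters
-- Localizing regularity, associated primes and socles
section Localization

variable {R : Type u} [CommRing R] {Q : Ideal R} [Q.IsPrime]

local notation "B" => Localization.AtPrime Q

theorem algebraMap_mem_map_iff {𝔶 : Ideal R} {r : R} :
    algebraMap R B r ∈ 𝔶.map (algebraMap R B) ↔ ∃ s ∉ Q, s * r ∈ 𝔶 := by
  rw [IsLocalization.algebraMap_mem_map_algebraMap_iff Q.primeCompl]
  rfl

theorem mk'_mem_map_iff {𝔶 : Ideal R} {r : R} {s : Q.primeCompl} :
    IsLocalization.mk' B r s ∈ 𝔶.map (algebraMap R B) ↔ ∃ s ∉ Q, s * r ∈ 𝔶 := by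
  rw [← algebraMap_mem_map_iff, ← IsLocalization.mk'_spec B r s,
    Ideal.mul_unit_mem_iff_mem _ (IsLocalization.map_units B s)]

theorem map_sup_span_singleton (𝔶 : Ideal R) (y : R) :
    (𝔶 ⊔ Ideal.span {y}).map (algebraMap R B) =
      𝔶.map (algebraMap R B) ⊔ Ideal.span {algebraMap R B y} := by
  rw [Ideal.map_sup, Ideal.map_span, Set.image_singleton]

theorem NZDMod.localization {𝔶 : Ideal R} {y : R} (h : NZDMod 𝔶 y) :
    NZDMod (𝔶.map (algebraMap R B)) (algebraMap R B y) := by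
  intro b hb
  obtain ⟨r, s, rfl⟩ := IsLocalization.exists_mk'_eq Q.primeCompl b
  rw [IsLocalization.mul_mk'_eq_mk'_of_mul, mk'_mem_map_iff] at hb
  obtain ⟨t, ht, htr⟩ := hb
  exact mk'_mem_map_iff.mpr ⟨t, ht, h _ (by convert htr using 1; ring)⟩

theorem AssocAt.localization {𝔶 P : Ideal R} (h : AssocAt 𝔶 P) (hPQ : P ≤ Q) :
    AssocAt (𝔶.map (algebraMap R B)) (P.map (algebraMap R B)) := by
  obtain ⟨hP, v, hv⟩ := h
  refine ⟨IsLocalization.isPrime_of_isPrime_disjoint Q.primeCompl B P hP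
    (Set.disjoint_left.mpr fun _ hx hx' => hx (hPQ hx')), algebraMap R B v, fun b => ?_⟩
  obtain ⟨r, s, rfl⟩ := IsLocalization.exists_mk'_eq Q.primeCompl b
  rw [mul_comm, IsLocalization.mul_mk'_eq_mk'_of_mul, mk'_mem_map_iff, mk'_mem_map_iff]
  refine exists_congr fun t => and_congr_right fun _ => ?_
  rw [← hv, mul_assoc, mul_comm v]

theorem comap_map_of_le {P : Ideal R} [hP : P.IsPrime] (hPQ : P ≤ Q) :
    (P.map (algebraMap R B)).comap (algebraMap R B) = P :=
  IsLocalization.under_map_of_isPrime_disjoint Q.primeCompl B hP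
    (Set.disjoint_left.mpr fun _ hx hx' => hx (hPQ hx'))

/-- `P` is finitely generated, so the product of the denominators of its generators serves
uniformly. -/
theorem exists_forall_mul_mem [IsNoetherianRing R] {P 𝔶 : Ideal R} {u : R}
    (h : ∀ p ∈ P, ∃ s ∉ Q, s * (p * u) ∈ 𝔶) : ∃ s ∉ Q, ∀ p ∈ P, p * (s * u) ∈ 𝔶 := by
  obtain ⟨S, hS⟩ := (IsNoetherian.noetherian P : P.FG)
  choose! s hs hsu using h
  have hSP : ∀ p ∈ S, p ∈ P := fun p hp => hS ▸ Ideal.subset_span hp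
  refine ⟨∏ p ∈ S, s p, fun hmem => ?_, fun p hp => ?_⟩
  · obtain ⟨p, hp, hp'⟩ := (Ideal.IsPrime.prod_mem_iff).mp hmem
    exact hs p (hSP p hp) hp'
  · have : P ≤ Submodule.comap (LinearMap.mulRight R ((∏ p ∈ S, s p) * u)) 𝔶 := by
      rw [← hS]
      refine Ideal.span_le.mpr fun p hp => ?_
      change p * ((∏ p ∈ S, s p) * u) ∈ 𝔶
      obtain ⟨c, hc⟩ := Finset.dvd_prod_of_mem s hp
      rw [hc]
      have := Ideal.mul_mem_left 𝔶 c (hsu p (hSP p hp))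
      convert this using 1; ring
    exact this hp

theorem SimpleSocleAt.localization [IsNoetherianRing R] {𝔶 : Ideal R} (h : SimpleSocleAt Q 𝔶) :
    SimpleSocleAt (maximalIdeal B) (𝔶.map (algebraMap R B)) := by
  have key : ∀ b : B, (∀ p ∈ maximalIdeal B, p * b ∈ 𝔶.map (algebraMap R B)) →
      ∃ (u : R) (w : B), IsUnit w ∧ b * w = algebraMap R B u ∧ ∀ p ∈ Q, p * u ∈ 𝔶 := by
    intro b hb
    obtain ⟨r, s, rfl⟩ := IsLocalization.exists_mk'_eq Q.primeCompl b
    obtain ⟨t, ht, htr⟩ := exists_forall_mul_mem (Q := Q) (P := Q) (𝔶 := 𝔶) (u := r) fun p hp => by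
      have := hb (algebraMap R B p) ((IsLocalization.AtPrime.to_map_mem_maximal_iff B Q p).mpr hp)
      rwa [IsLocalization.mul_mk'_eq_mk'_of_mul, mk'_mem_map_iff] at this
    refine ⟨t * r, algebraMap R B s * algebraMap R B t, ?_, ?_, htr⟩
    · exact (IsLocalization.map_units B s).mul
        (IsLocalization.map_units B (⟨t, ht⟩ : Q.primeCompl))
    · rw [← mul_assoc, IsLocalization.mk'_spec, map_mul, mul_comm]
  intro b c hb hc hcn
  obtain ⟨u, w, hw, hbu, hu⟩ := key b hb
  obtain ⟨v, w', hw', hcv, hv⟩ := key c hc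
  obtain ⟨s, hs, t, hst⟩ := h u v hu hv fun s hs hsv => by
    refine hcn (algebraMap R B s)
      (fun hmem => hs ((IsLocalization.AtPrime.to_map_mem_maximal_iff B Q s).mp hmem)) ?_
    rw [← Ideal.mul_unit_mem_iff_mem _ hw', mul_assoc, hcv, ← map_mul]
    exact Ideal.mem_map_of_mem _ hsv
  refine ⟨algebraMap R B s * w, fun hmem => ?_, algebraMap R B t * w', ?_⟩
  · rcases (inferInstance : (maximalIdeal B).IsPrime).mem_or_mem hmem with h1 | h1
    · exact hs ((IsLocalization.AtPrime.to_map_mem_maximal_iff B Q s).mp h1)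
    · exact h1 hw
  · have := Ideal.mem_map_of_mem (algebraMap R B) hst
    rw [map_sub, map_mul, map_mul, ← hbu, ← hcv] at this
    convert this using 1; ring

theorem SimpleSocleAt.of_localization {𝔶 P : Ideal R} [P.IsPrime] (hPQ : P ≤ Q)
    (h : SimpleSocleAt (P.map (algebraMap R B)) (𝔶.map (algebraMap R B))) :
    SimpleSocleAt P 𝔶 := by
  have hmem : ∀ r, algebraMap R B r ∈ P.map (algebraMap R B) ↔ r ∈ P := fun r => by
    rw [← Ideal.mem_comap, comap_map_of_le hPQ]
  have key : ∀ u : R, (∀ p ∈ P, p * u ∈ 𝔶) →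
      ∀ p ∈ P.map (algebraMap R B), p * algebraMap R B u ∈ 𝔶.map (algebraMap R B) := by
    intro u hu
    have : P.map (algebraMap R B) ≤
        Submodule.comap (LinearMap.mulRight B (algebraMap R B u)) (𝔶.map (algebraMap R B)) := by
      refine Ideal.map_le_iff_le_comap.mpr fun p hp => ?_
      change algebraMap R B p * algebraMap R B u ∈ 𝔶.map (algebraMap R B)
      rw [← map_mul]
      exact Ideal.mem_map_of_mem _ (hu p hp)
    exact fun p hp => this hp
  intro u v hu hv hvn
  obtain ⟨b, hb, c, hbc⟩ := h _ _ (key u hu) (key v hv) (by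
    intro (b : B) hb hbv
    obtain ⟨r, s, rfl⟩ := IsLocalization.exists_mk'_eq Q.primeCompl b
    rw [mul_comm, IsLocalization.mul_mk'_eq_mk'_of_mul, mk'_mem_map_iff] at hbv
    obtain ⟨t, ht, htv⟩ := hbv
    refine hvn (t * r) (fun hmem' => ?_) (by convert htv using 1; ring)
    rcases (inferInstance : P.IsPrime).mem_or_mem hmem' with h1 | h1
    · exact ht (hPQ h1)
    · exact hb (mk'_mem_map_iff.mpr ⟨t, ht, Ideal.mul_mem_left _ _ h1⟩))
  obtain ⟨r, s, rfl⟩ := IsLocalization.exists_mk'_eq Q.primeCompl b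
  obtain ⟨r', s', rfl⟩ := IsLocalization.exists_mk'_eq Q.primeCompl c
  have h1 : algebraMap R B (s' * r * u - s * r' * v) ∈ 𝔶.map (algebraMap R B) := by
    have := Ideal.mul_mem_left _ (algebraMap R B s * algebraMap R B s') hbc
    convert this using 1
    rw [map_sub, map_mul, map_mul, map_mul, map_mul, ← IsLocalization.mk'_spec B r s,
      ← IsLocalization.mk'_spec B r' s']
    ring
  obtain ⟨t, ht, htm⟩ := algebraMap_mem_map_iff.mp h1
  refine ⟨t * (s' * r), fun hmem' => ?_, t * (s * r'), by convert htm using 1; ring⟩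
  rcases (inferInstance : P.IsPrime).mem_or_mem hmem' with h2 | h2
  · exact ht (hPQ h2)
  rcases (inferInstance : P.IsPrime).mem_or_mem h2 with h2 | h2
  · exact s'.2 (hPQ h2)
  · exact hb (mk'_mem_map_iff.mpr ⟨1, (Ideal.ne_top_iff_one Q).mp (Ideal.IsPrime.ne_top'),
      by rwa [one_mul]⟩)

end Localization

/-! ### Regular local rings: unmixedness and heights -/

section RegularLocal

theorem regularOver_append {R : Type u} [CommRing R] {𝔟 : Ideal R} {ys xs : List R} :
    RegularOver 𝔟 (ys ++ xs) ↔ RegularOver 𝔟 xs ∧ RegularOver (𝔟 ⊔ Ideal.ofList xs) ys := by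
  induction ys with
  | nil => simp [RegularOver]
  | cons y ys ih =>
    change RegularOver 𝔟 (ys ++ xs) ∧ (∀ r, y * r ∈ 𝔟 ⊔ Ideal.ofList (ys ++ xs) →
      r ∈ 𝔟 ⊔ Ideal.ofList (ys ++ xs)) ↔ _ ∧ RegularOver _ ys ∧ _
    rw [ih, and_assoc, Ideal.ofList_append, sup_comm (Ideal.ofList ys), ← sup_assoc]

variable {R : Type u} [CommRing R] [IsRegularLocalRing R]

/-- Otherwise the maximal ideal is associated to `xs`. By exchange it is then associated to equally
many regular parameters, yet the next parameter is a nonzerodivisor there. -/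
theorem exists_nzdMod_of_length_lt {xs : List R} (hxs : RegularOver ⊥ xs)
    (hm : ∀ x ∈ xs, x ∈ maximalIdeal R) (hlt : (xs.length : ℕ∞) < (maximalIdeal R).height) :
    ∃ y ∈ maximalIdeal R, NZDMod (Ideal.ofList xs) y := by
  by_contra! hcon
  obtain ⟨zs, hzs, hzm, hht⟩ := exists_regularOver_ofList_eq_maximalIdeal R
  have hlt' : xs.length < zs.length := by
    rw [hht] at hlt
    exact_mod_cast hlt
  have hzmem : ∀ z ∈ zs, z ∈ maximalIdeal R := fun z hz => hzm ▸ Ideal.subset_span hz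
  obtain ⟨P, hP, hle⟩ : ∃ P, AssocAt (Ideal.ofList xs) P ∧ maximalIdeal R ≤ P := by
    by_contra! h
    obtain ⟨w, hw, hw', -⟩ := exists_nzdMod h h
    exact hcon w hw hw'
  obtain rfl : P = maximalIdeal R := le_antisymm (le_maximalIdeal hP.1.ne_top) hle
  -- The tail of the list is the initial stretch of the sequence, and the last entry of `as` is the
  -- next parameter.
  obtain ⟨as, bs, rfl, hb⟩ : ∃ as bs, zs = as ++ bs ∧ bs.length = xs.length :=
    ⟨zs.take (zs.length - xs.length), zs.drop (zs.length - xs.length),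
      (List.take_append_drop _ _).symm, by rw [List.length_drop]; omega⟩
  obtain rfl | ⟨as, a, rfl⟩ := List.eq_nil_or_concat as
  · simp [hb] at hlt'
  rw [List.concat_eq_append] at hzs hzmem
  obtain ⟨hzs, hzs'⟩ := regularOver_append.mp hzs
  obtain ⟨h1, -⟩ := regularOver_append.mp hzs'
  have hA : AssocAt (⊥ ⊔ Ideal.ofList bs) (maximalIdeal R) :=
    RegularOver.exchange le_rfl (fun 𝔶 => AssocAt 𝔶 (maximalIdeal R))
      (fun 𝔶 a b _ hb h₁ h₂ h => h.exchange hb h₁ h₂) hb.symm hxs hzs hm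
      (fun z hz => hzmem z (by simp [hz])) (by rwa [bot_sup_eq])
  have hnz : NZDMod (⊥ ⊔ Ideal.ofList bs) a := by
    simpa [NZDMod] using h1.2
  exact hA.notMem hnz (hzmem a (by simp))

/-- The extension step is a hypothesis because it is available first for the maximal ideal only; for
general primes it needs unmixedness, which is itself derived from this lemma. -/
theorem RegularOver.exists_append {xs : List R} (hxs : RegularOver ⊥ xs) {p : Ideal R} [p.IsPrime]
    (hp : ∀ x ∈ xs, x ∈ p)
    (h : ∀ ys, RegularOver ⊥ ys → (∀ y ∈ ys, y ∈ p) → (ys.length : ℕ∞) < p.height →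
      ∃ y ∈ p, NZDMod (Ideal.ofList ys) y) :
    ∃ ys, RegularOver ⊥ (ys ++ xs) ∧ (∀ y ∈ ys, y ∈ p) ∧
      ((ys.length + xs.length : ℕ) : ℕ∞) = p.height := by
  have hfin : p.height ≠ ⊤ := Ideal.height_ne_top (Ideal.IsPrime.ne_top')
  obtain ⟨n, hn⟩ := ENat.ne_top_iff_exists.mp hfin
  have hle := length_le_height hxs hp
  have key : ∀ k, xs.length + k ≤ n → ∃ ys, RegularOver ⊥ (ys ++ xs) ∧ (∀ y ∈ ys, y ∈ p) ∧
      ys.length = k := by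
    intro k hk
    induction k with
    | zero => exact ⟨[], hxs, by simp, rfl⟩
    | succ k ih =>
      obtain ⟨ys, hys, hyp, hlen⟩ := ih (by omega)
      obtain ⟨y, hy, hy'⟩ := h (ys ++ xs) hys
        (fun y hy => (List.mem_append.mp hy).elim (hyp y) (hp y)) (by
          rw [← hn, List.length_append, hlen]
          exact_mod_cast (by omega : k + xs.length < n))
      refine ⟨y :: ys, ⟨hys, by rwa [bot_sup_eq]⟩, ?_, by simp [hlen]⟩
      intro z hz
      rcases List.mem_cons.mp hz with rfl | hz
      · exact hy
      · exact hyp z hz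
  rw [← hn] at hle
  have hle' : xs.length ≤ n := by exact_mod_cast hle
  obtain ⟨ys, h1, h2, h3⟩ := key (n - xs.length) (by omega)
  refine ⟨ys, h1, h2, ?_⟩
  rw [← hn, h3]
  congr 1
  omega

/-- A regular local ring is Cohen–Macaulay: ideals generated by regular sequences are unmixed. -/
theorem AssocAt.height_eq {xs : List R} (hxs : RegularOver ⊥ xs) {P : Ideal R}
    (hP : AssocAt (Ideal.ofList xs) P) : P.height = xs.length := by
  have hPp := hP.1
  have hxP : ∀ x ∈ xs, x ∈ P := fun x hx => hP.le (Ideal.subset_span hx)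
  have hPm : P ≤ maximalIdeal R := le_maximalIdeal hPp.ne_top
  refine le_antisymm ?_ (length_le_height hxs hxP)
  -- Extended to a sequence of length dim R, each new element raises the height of an associated
  -- prime over `P`; the total is bounded by dim R, which bounds the height of `P`.
  obtain ⟨ys, hys, hym, hlen⟩ := hxs.exists_append (p := maximalIdeal R)
    (fun x hx => hPm (hxP x hx)) (fun ys h1 h2 h3 => exists_nzdMod_of_length_lt h1 h2 h3)
  obtain ⟨-, hys⟩ := regularOver_append.mp hys
  rw [bot_sup_eq] at hys
  obtain ⟨Q, hQ, hle⟩ := hP.exists_height_add_length_le hym hys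
  have h2 := hle.trans (Ideal.height_mono (le_maximalIdeal hQ.1.ne_top))
  rw [← hlen, Nat.cast_add, add_comm, ENat.add_le_add_iff_left (ENat.natCast_ne_top _)] at h2
  exact h2

theorem exists_mem_nzdMod {xs : List R} (hxs : RegularOver ⊥ xs) {p : Ideal R}
    [p.IsPrime] (hlt : (xs.length : ℕ∞) < p.height) : ∃ y ∈ p, NZDMod (Ideal.ofList xs) y := by
  have h : ∀ P, AssocAt (Ideal.ofList xs) P → ¬ p ≤ P := by
    intro P hP hle
    have := hP.1
    have := Ideal.height_mono hle
    rw [hP.height_eq hxs] at this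
    exact absurd hlt (not_lt.mpr this)
  obtain ⟨y, hy, hy', -⟩ := exists_nzdMod h h
  exact ⟨y, hy, hy'⟩

theorem exists_regularOver_height (p : Ideal R) [p.IsPrime] :
    ∃ xs, RegularOver ⊥ xs ∧ (∀ x ∈ xs, x ∈ p) ∧ (xs.length : ℕ∞) = p.height := by
  obtain ⟨ys, h1, h2, h3⟩ := RegularOver.exists_append (xs := []) trivial (p := p) (by simp)
    (fun ys h1 _ h3 => exists_mem_nzdMod h1 h3)
  exact ⟨ys, by simpa using h1, h2, by simpa using h3⟩

theorem assocAt_of_height_eq {xs : List R} (hxs : RegularOver ⊥ xs) {p : Ideal R} [p.IsPrime]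
    (hp : Ideal.ofList xs ≤ p) (hlen : p.height = xs.length) : AssocAt (Ideal.ofList xs) p := by
  obtain ⟨P, hP, hle⟩ := Ideal.exists_minimalPrimes_le hp
  have hA := assocAt_of_mem_minimalPrimes hP
  have := hA.1
  rcases eq_or_lt_of_le hle with rfl | hlt
  · exact hA
  · have := Ideal.height_add_one_le_of_lt_of_isPrime hlt
    rw [hA.height_eq hxs, hlen] at this
    exact absurd this (by exact_mod_cast (by omega : ¬ xs.length + 1 ≤ xs.length))

/-- In a regular local ring, heights increase by one along covers of primes. -/
theorem height_eq_add_one {P Q : Ideal R} [hP : P.IsPrime] [hQ : Q.IsPrime] (hPQ : P < Q)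
    (hcov : ∀ P' : Ideal R, P'.IsPrime → P < P' → P' ≤ Q → P' = Q) :
    Q.height = P.height + 1 := by
  refine le_antisymm ?_ (Ideal.height_add_one_le_of_lt_of_isPrime hPQ)
  -- If the height jumped by two, `Q` would contain `y`, `w` continuing a regular sequence `xs` of
  -- length ht P. At `Q`, the associated prime `P` of `xs` lies in an associated prime of `(xs, y)`
  -- that contains `y`; the covering condition makes it `Q`, which contains the nonzerodivisor `w`.
  by_contra! hlt
  obtain ⟨xs, hxs, hxP, hlen⟩ := exists_regularOver_height P
  have hA := assocAt_of_height_eq hxs (Ideal.span_le.mpr hxP) hlen.symm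
  obtain ⟨y, hy, hy'⟩ := exists_mem_nzdMod (p := Q) hxs
    (by rw [hlen]; exact lt_of_le_of_lt le_self_add hlt)
  obtain ⟨w, hw, hw'⟩ := exists_mem_nzdMod (xs := y :: xs) (p := Q)
    ⟨hxs, by rwa [bot_sup_eq]⟩ (by rwa [List.length_cons, Nat.cast_add, Nat.cast_one, hlen])
  let B := Localization.AtPrime Q
  have hyB : algebraMap R B y ∈ maximalIdeal B :=
    (IsLocalization.AtPrime.to_map_mem_maximal_iff B Q y).mpr hy
  obtain ⟨P', hP', hle, hyP'⟩ := (hA.localization hPQ.le).exists_gt hyB hy'.localization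
  have hP'p := hP'.1
  have h1 : P'.comap (algebraMap R B) = Q := by
    refine hcov _ inferInstance (lt_of_le_of_ne ?_ ?_) ?_
    · exact Ideal.map_le_iff_le_comap.mp hle
    · intro h
      exact hA.notMem hy' (h ▸ hyP')
    · intro r hr
      exact (IsLocalization.AtPrime.to_map_mem_maximal_iff B Q r).mp
        (le_maximalIdeal hP'p.ne_top hr)
  rw [← map_sup_span_singleton] at hP'
  refine hP'.notMem (y := algebraMap R B w) (NZDMod.localization ?_) ?_
  · rwa [Ideal.ofList_cons, sup_comm] at hw'
  · rw [← Ideal.mem_comap, h1]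
    exact hw

end RegularLocal
-- Self-injectivity of Artinian quotients with simple socle
section SelfInjective

variable {B : Type u} [CommRing B]

/-- The ring `B ⧸ 𝔶` is self-injective, in terms of ideals of `B`. -/
def SelfInjectiveMod (𝔶 : Ideal B) : Prop :=
  ∀ (J : Ideal B) (f : J →ₗ[B] B ⧸ 𝔶), (∀ j : J, (j : B) ∈ 𝔶 → f j = 0) →
    ∃ r : B, ∀ j : J, f j = Ideal.Quotient.mk 𝔶 (r * j)

variable [IsLocalRing B]

/-- Induction along a composition series: the image of a simple module lies in the socle of `E`, so
Hom from it to `E` has length at most one. -/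
theorem length_linearMap_le {E : Type u} [AddCommGroup E] [Module B E]
    (hE : ∀ u v : E, (∀ p ∈ maximalIdeal B, p • u = 0) → (∀ p ∈ maximalIdeal B, p • v = 0) →
      v ≠ 0 → ∃ t : B, u = t • v) {M : Type u} [AddCommGroup M] [Module B M]
    (hM : IsFiniteLength B M) : Module.length B (M →ₗ[B] E) ≤ Module.length B M := by
  induction hM with
  | of_subsingleton => rw [Module.length_eq_zero]; exact zero_le
  | @of_simple_quotient M _ _ N hs _ ih =>
    let ρ : (M →ₗ[B] E) →ₗ[B] (N →ₗ[B] E) := LinearMap.lcomp B E N.subtype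
    let σ : (M ⧸ N →ₗ[B] E) →ₗ[B] (M →ₗ[B] E) := LinearMap.lcomp B E N.mkQ
    have hσ : Function.Injective σ := fun f g h => Submodule.linearMap_qext _ h
    have hker : LinearMap.ker ρ ≤ LinearMap.range σ := fun f hf => by
      have hle : N ≤ LinearMap.ker f := fun n hn =>
        LinearMap.congr_fun (LinearMap.mem_ker.mp hf) (⟨n, hn⟩ : N)
      exact ⟨N.liftQ f hle, N.liftQ_mkQ f hle⟩
    have h1 : Module.length B (M →ₗ[B] E) =
        Module.length B (LinearMap.ker ρ) + Module.length B (LinearMap.range ρ) :=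
      Module.length_eq_add_of_exact (LinearMap.ker ρ).subtype ρ.rangeRestrict
        (Submodule.subtype_injective _) (LinearMap.surjective_rangeRestrict _)
        (LinearMap.exact_iff.mpr (by rw [LinearMap.ker_rangeRestrict, Submodule.range_subtype]))
    have h2 : Module.length B (LinearMap.ker ρ) ≤ Module.length B (M ⧸ N →ₗ[B] E) := by
      rw [(LinearEquiv.ofInjective σ hσ).length_eq]
      exact Module.length_le_of_injective _ (Submodule.inclusion_injective hker)
    have h3 : Module.length B (M ⧸ N →ₗ[B] E) ≤ 1 := by
      by_cases hsub : Subsingleton (M ⧸ N →ₗ[B] E)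
      · rw [Module.length_eq_zero]; exact zero_le
      have : Nontrivial (M ⧸ N →ₗ[B] E) := not_subsingleton_iff_nontrivial.mp hsub
      refine le_of_eq (Module.length_eq_one_iff.mpr
        (isSimpleModule_iff_toSpanSingleton_surjective.mpr ⟨this, fun f hf g => ?_⟩))
      have := IsSimpleModule.nontrivial B (M ⧸ N)
      obtain ⟨x, hx⟩ := exists_ne (0 : M ⧸ N)
      have hgen := IsSimpleModule.toSpanSingleton_surjective B hx
      have hmx : ∀ p ∈ maximalIdeal B, p • x = 0 := by
        intro p hp
        by_contra hpx
        obtain ⟨r, hr⟩ := IsSimpleModule.toSpanSingleton_surjective B hpx x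
        have hr : r • p • x = x := hr
        have hu : IsUnit (1 - r * p) := by
          by_contra hnu
          refine (Ideal.ne_top_iff_one (maximalIdeal B)).mp (Ideal.IsPrime.ne_top') ?_
          have := add_mem (show 1 - r * p ∈ maximalIdeal B from hnu)
            (Ideal.mul_mem_left _ r hp)
          rwa [sub_add_cancel] at this
        refine hx (hu.smul_left_cancel.mp ?_)
        rw [sub_smul, one_smul, mul_smul, hr, sub_self, smul_zero]
      have hext : ∀ f g : M ⧸ N →ₗ[B] E, f x = g x → f = g := fun f g h => by
        refine LinearMap.ext fun y => ?_
        obtain ⟨r, rfl⟩ := hgen y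
        change f (r • x) = g (r • x)
        rw [map_smul, map_smul, h]
      obtain ⟨t, ht⟩ := hE (g x) (f x) (fun p hp => by rw [← map_smul, hmx p hp, map_zero])
        (fun p hp => by rw [← map_smul, hmx p hp, map_zero]) fun h => hf (hext _ _ (by simpa using h))
      exact ⟨t, hext _ _ ht.symm⟩
    have h4 : Module.length B M = Module.length B N + Module.length B (M ⧸ N) :=
      Module.length_eq_add_of_exact N.subtype N.mkQ (Submodule.subtype_injective _)
        (Submodule.mkQ_surjective _) (LinearMap.exact_subtype_mkQ _)
    have h5 : Module.length B (LinearMap.range ρ) ≤ Module.length B N :=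
      (Module.length_le_of_injective _ (Submodule.subtype_injective _)).trans ih
    rw [h1, h4, Module.length_eq_one B (M ⧸ N), add_comm]
    exact add_le_add h5 (h2.trans h3)

variable [IsNoetherianRing B]

/-- A length count. Restriction E → Hom(N, E) has kernel embedded in Hom(E/N, E), of length at most
ℓ(E/N), so its image has length at least ℓ(N) ≥ ℓ(Hom(N, E)), and it is onto. -/
theorem SimpleSocleAt.selfInjectiveMod {𝔶 : Ideal B} (h : SimpleSocleAt (maximalIdeal B) 𝔶)
    (hm : maximalIdeal B ∈ 𝔶.minimalPrimes) : SelfInjectiveMod 𝔶 := by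
  intro J f hf
  let E := B ⧸ 𝔶
  have : IsArtinianRing E := IsLocalRing.quotient_artinian_of_mem_minimalPrimes_of_isLocalRing 𝔶 hm
  have : IsArtinian B E := isArtinian_of_surjective_algebraMap
    (Ideal.Quotient.mk_surjective (I := 𝔶))
  have hfin : ∀ N : Submodule B E, IsFiniteLength B N := fun N =>
    isFiniteLength_iff_isNoetherian_isArtinian.mpr ⟨inferInstance, inferInstance⟩
  have hE : ∀ u v : E, (∀ p ∈ maximalIdeal B, p • u = 0) → (∀ p ∈ maximalIdeal B, p • v = 0) →
      v ≠ 0 → ∃ t : B, u = t • v := by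
    intro u v hu hv hv0
    obtain ⟨u, rfl⟩ := Ideal.Quotient.mk_surjective u
    obtain ⟨v, rfl⟩ := Ideal.Quotient.mk_surjective v
    obtain ⟨s, hs, t, hst⟩ := h u v
      (fun p hp => Ideal.Quotient.eq_zero_iff_mem.mp (hu p hp))
      (fun p hp => Ideal.Quotient.eq_zero_iff_mem.mp (hv p hp)) (fun s hs hsv => by
        rw [mem_maximalIdeal, mem_nonunits_iff, not_not] at hs
        exact hv0 (Ideal.Quotient.eq_zero_iff_mem.mpr ((Ideal.unit_mul_mem_iff_mem _ hs).mp hsv)))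
    rw [mem_maximalIdeal, mem_nonunits_iff, not_not] at hs
    obtain ⟨w, hw⟩ := hs.exists_left_inv
    refine ⟨w * t, Ideal.Quotient.eq.mpr ?_⟩
    have := Ideal.mul_mem_left 𝔶 w hst
    convert this using 1
    linear_combination -u * hw
  let π : J →ₗ[B] E := 𝔶.mkQ ∘ₗ J.subtype
  let N := LinearMap.range π
  have hker : LinearMap.ker π ≤ LinearMap.ker f := fun j hj =>
    hf j ((Submodule.Quotient.mk_eq_zero _).mp hj)
  let g : N →ₗ[B] E := (LinearMap.ker π).liftQ f hker ∘ₗ π.quotKerEquivRange.symm.toLinearMap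
  have hg : ∀ j, g ⟨π j, j, rfl⟩ = f j := fun j => by
    have : π.quotKerEquivRange.symm ⟨π j, j, rfl⟩ = Submodule.Quotient.mk j := by
      rw [LinearEquiv.symm_apply_eq]
      rfl
    change (LinearMap.ker π).liftQ f hker (π.quotKerEquivRange.symm ⟨π j, j, rfl⟩) = f j
    rw [this]
    rfl
  let ρ : E →ₗ[B] (N →ₗ[B] E) := LinearMap.lcomp B E N.subtype ∘ₗ LinearMap.mul B E
  have h1 : Module.length B E =
      Module.length B (LinearMap.ker ρ) + Module.length B (LinearMap.range ρ) :=
    Module.length_eq_add_of_exact (LinearMap.ker ρ).subtype ρ.rangeRestrict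
      (Submodule.subtype_injective _) (LinearMap.surjective_rangeRestrict _)
      (LinearMap.exact_iff.mpr (by rw [LinearMap.ker_rangeRestrict, Submodule.range_subtype]))
  have h2 : Module.length B E = Module.length B N + Module.length B (E ⧸ N) :=
    Module.length_eq_add_of_exact N.subtype N.mkQ (Submodule.subtype_injective _)
      (Submodule.mkQ_surjective _) (LinearMap.exact_subtype_mkQ _)
  have h3 : Module.length B (LinearMap.ker ρ) ≤ Module.length B (E ⧸ N) := by
    let τ : LinearMap.ker ρ →ₗ[B] (E ⧸ N →ₗ[B] E) :=
      { toFun := fun e => N.liftQ (LinearMap.mul B E e) fun n hn =>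
          LinearMap.congr_fun (LinearMap.mem_ker.mp e.2) ⟨n, hn⟩
        map_add' := fun e e' => Submodule.linearMap_qext _ (LinearMap.ext fun x => add_mul _ _ x)
        map_smul' := fun r e => Submodule.linearMap_qext _
          (LinearMap.ext fun x => smul_mul_assoc r _ x) }
    have hτ : Function.Injective τ := fun e e' h => Subtype.ext (by
      have : (e : E) * 1 = e' * 1 := LinearMap.congr_fun h (Submodule.Quotient.mk (1 : E))
      rwa [mul_one, mul_one] at this)
    exact (Module.length_le_of_injective τ hτ).trans (length_linearMap_le hE
      (isFiniteLength_iff_isNoetherian_isArtinian.mpr ⟨inferInstance, inferInstance⟩))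
  have h4 := length_linearMap_le hE (hfin N)
  have hNtop : Module.length B N ≠ ⊤ := Module.length_ne_top
  have hEtop : Module.length B (E ⧸ N) ≠ ⊤ := Module.length_ne_top
  have hfinHom : IsFiniteLength B (N →ₗ[B] E) :=
    Module.length_ne_top_iff.mp (ne_top_of_le_ne_top hNtop h4)
  obtain ⟨_, _⟩ := isFiniteLength_iff_isNoetherian_isArtinian.mp hfinHom
  have hrange : LinearMap.range ρ = ⊤ := by
    by_contra hne
    have h5 := (Submodule.length_lt hne).trans_le h4
    have h6 : Module.length B E < Module.length B E := by
      conv_lhs => rw [h1]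
      rw [h2, add_comm]
      exact ENat.add_lt_add_of_lt_of_le (ne_top_of_le_ne_top hEtop h3) h5 h3
    exact lt_irrefl _ h6
  obtain ⟨e, he⟩ := LinearMap.range_eq_top.mp hrange g
  obtain ⟨r, rfl⟩ := Ideal.Quotient.mk_surjective e
  refine ⟨r, fun j => ?_⟩
  rw [← hg, ← he]
  rfl

/-- Every ideal of a self-injective local ring is an annihilator. -/
theorem SelfInjectiveMod.exists_mul_notMem {𝔶 : Ideal B} (h : SelfInjectiveMod 𝔶)
    (hm : maximalIdeal B ∈ 𝔶.minimalPrimes) {I : Ideal B} (hI : 𝔶 ≤ I) {s : B} (hs : s ∉ I) :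
    ∃ w, (∀ i ∈ I, w * i ∈ 𝔶) ∧ w * s ∉ 𝔶 := by
  obtain ⟨-, v, hv⟩ := assocAt_of_mem_minimalPrimes hm
  have hv1 : v ∉ 𝔶 := fun h1 => (Ideal.ne_top_iff_one (maximalIdeal B)).mp (Ideal.IsPrime.ne_top')
    ((hv 1).mp (by rwa [one_mul]))
  have hc : ∀ c, s * c ∈ I → c * v ∈ 𝔶 := fun c hc => (hv c).mpr (by
    by_contra hcm
    rw [mem_maximalIdeal, mem_nonunits_iff, not_not] at hcm
    exact hs ((Ideal.mul_unit_mem_iff_mem _ hcm).mp hc))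
  let J := I ⊔ Ideal.span {s}
  -- The map sought on `I + (s)` kills `I` and sends `s` to the socle element `v`. The coefficient
  -- of `s` is chosen arbitrarily; `hcong` shows that the choice does not affect the product with
  -- `v`.
  let χ : J → B := fun j => (mem_sup_span_singleton_iff.mp j.2).choose
  have hχ : ∀ j : J, (j : B) - s * χ j ∈ I := fun j =>
    (mem_sup_span_singleton_iff.mp j.2).choose_spec
  have hcong : ∀ (j : J) c, (j : B) - s * c ∈ I →
      Ideal.Quotient.mk 𝔶 (χ j * v) = Ideal.Quotient.mk 𝔶 (c * v) := fun j c hj => by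
    refine Ideal.Quotient.eq.mpr ?_
    have := hc (χ j - c) (by have := sub_mem hj (hχ j); convert this using 1; ring)
    convert this using 1; ring
  let f : J →ₗ[B] B ⧸ 𝔶 :=
    { toFun := fun j => Ideal.Quotient.mk 𝔶 (χ j * v)
      map_add' := fun j j' => by
        rw [hcong (j + j') (χ j + χ j') (by
          have := add_mem (hχ j) (hχ j')
          convert this using 1
          rw [Submodule.coe_add]; ring), ← map_add, add_mul]
      map_smul' := fun r j => by
        rw [hcong (r • j) (r * χ j) (by
          have := Ideal.mul_mem_left I r (hχ j)
          convert this using 1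
          rw [Submodule.coe_smul, smul_eq_mul]; ring), mul_assoc]
        rfl }
  have hfI : ∀ j : J, (j : B) ∈ I → f j = 0 := fun j hj => by
    change Ideal.Quotient.mk 𝔶 (χ j * v) = 0
    rw [hcong j 0 (by simpa using hj)]
    simp
  obtain ⟨w, hw⟩ := h J f fun j hj => hfI j (hI hj)
  refine ⟨w, fun i hi => ?_, fun hws => hv1 ?_⟩
  · have := hw ⟨i, Ideal.mem_sup_left hi⟩
    rw [hfI _ hi] at this
    exact Ideal.Quotient.eq_zero_iff_mem.mp this.symm
  · have := hw ⟨s, Ideal.mem_sup_right (Ideal.mem_span_singleton_self s)⟩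
    change Ideal.Quotient.mk 𝔶 (χ _ * v) = _ at this
    rw [hcong _ 1 (by simp)] at this
    have h1 := Ideal.Quotient.eq.mp this
    have := add_mem h1 hws
    simpa using this

end SelfInjective

/-! ### Functionals nonzero on a given nontorsion element -/

section Functional

open scoped TensorProduct nonZeroDivisors

/-- A functional over the fraction field exists by linear algebra; finite presentation allows its
denominators to be cleared. -/
theorem exists_dual_ne_zero {A : Type u} [CommRing A] [IsDomain A] [IsNoetherianRing A] {M : Type u}
    [AddCommGroup M] [Module A M] [Module.Finite A M] {x : M} (hx : ∀ s : A, s ≠ 0 → s • x ≠ 0) :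
    ∃ e : M →ₗ[A] A, e x ≠ 0 := by
  let K := FractionRing A
  have : Module.FinitePresentation A M := Module.finitePresentation_of_finite A M
  have h1 : (1 : K) ⊗ₜ[A] x ≠ 0 := fun h => by
    obtain ⟨s, hs⟩ := (IsLocalizedModule.eq_zero_iff A⁰ (TensorProduct.mk A K M 1)).mp h
    exact hx s (nonZeroDivisors.ne_zero s.2) hs
  obtain ⟨l, hl⟩ : ∃ l : Module.Dual K (K ⊗[A] M), l ((1 : K) ⊗ₜ[A] x) ≠ 0 := by
    by_contra! hcon
    exact h1 ((Module.forall_dual_apply_eq_zero_iff K _).mp hcon)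
  obtain ⟨e, s, he⟩ := Module.FinitePresentation.exists_lift_of_isLocalizedModule A⁰
    (Algebra.linearMap A K) (l.restrictScalars A ∘ₗ TensorProduct.mk A K M 1)
  refine ⟨e, fun h => hl ?_⟩
  have h2 : algebraMap A K (e x) = (s : A) • l ((1 : K) ⊗ₜ[A] x) := LinearMap.congr_fun he x
  rw [h, map_zero, Algebra.smul_def, eq_comm, mul_eq_zero] at h2
  exact h2.resolve_left ((map_ne_zero_iff _ (IsFractionRing.injective A K)).mpr
    (nonZeroDivisors.ne_zero s.2))

theorem exists_linearMap_quotient_ne_zero {B : Type u} [CommRing B] [IsNoetherianRing B] {P : Ideal B}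
    [P.IsPrime] {M : Type u} [AddCommGroup M] [Module B M] [Module.Finite B M]
    (hM : ∀ p ∈ P, ∀ y : M, p • y = 0) {x : M} (hx : ∀ s ∉ P, s • x ≠ 0) :
    ∃ e : M →ₗ[B] B ⧸ P, e x ≠ 0 := by
  have ht : Module.IsTorsionBySet B M (P : Set B) := fun y p => hM p p.2 y
  let _ : Module (B ⧸ P) M := ht.module
  have : IsScalarTower B (B ⧸ P) M := ht.isScalarTower
  have : Module.Finite (B ⧸ P) M := Module.Finite.of_restrictScalars_finite B (B ⧸ P) M
  obtain ⟨e, he⟩ := exists_dual_ne_zero (A := B ⧸ P) (x := x) (fun s hs h => by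
    obtain ⟨s, rfl⟩ := Ideal.Quotient.mk_surjective s
    exact hx s (fun h' => hs (Ideal.Quotient.eq_zero_iff_mem.mpr h')) h)
  exact ⟨e.restrictScalars B, he⟩

end Functional

/-! ### Regular local rings are Gorenstein at every prime -/

section Gorenstein

variable {B : Type u} [CommRing B] [IsLocalRing B] [IsNoetherianRing B]

/-- Modulo `a`, self-injectivity turns `f` into multiplication by some `r`; here `hU` ensures that
the reduction kills `U ∩ (𝔵 + (a))`. Then `f - r` is divisible by `a`, with quotient a map of the
same kind, so Nakayama shows that all such maps are multiples of the projection. -/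
theorem SelfInjectiveMod.exists_eq_mul {𝔵 U : Ideal B} {a : B} (ha : a ∈ maximalIdeal B)
    (hna : NZDMod 𝔵 a) (h : SelfInjectiveMod (𝔵 ⊔ Ideal.span {a})) (hxU : 𝔵 ≤ U)
    (hU : ∀ c, a * c ∈ U → c ∈ U) (f : U →ₗ[B] B ⧸ 𝔵) (hf : ∀ u : U, (u : B) ∈ 𝔵 → f u = 0) :
    ∃ r : B, ∀ u : U, f u = Ideal.Quotient.mk 𝔵 (r * u) := by
  have hinj : ∀ e : B ⧸ 𝔵, a • e = 0 → e = 0 := fun e he => by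
    obtain ⟨c, rfl⟩ := Ideal.Quotient.mk_surjective e
    exact Ideal.Quotient.eq_zero_iff_mem.mpr (hna c (Ideal.Quotient.eq_zero_iff_mem.mp he))
  let ι : U →ₗ[B] B ⧸ 𝔵 := 𝔵.mkQ ∘ₗ U.subtype
  let H : Submodule B (U →ₗ[B] B ⧸ 𝔵) :=
    { carrier := {f | ∀ u : U, (u : B) ∈ 𝔵 → f u = 0}
      add_mem' := fun {f g} hf hg u hu => by
        rw [LinearMap.add_apply, hf u hu, hg u hu, add_zero]
      zero_mem' := fun u _ => rfl
      smul_mem' := fun r f hf u hu => by rw [LinearMap.smul_apply, hf u hu, smul_zero] }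
  have hmain : H ≤ Submodule.span B {ι} := by
    refine Submodule.le_of_le_smul_of_le_jacobson_bot (I := maximalIdeal B)
      (IsNoetherian.noetherian H) (maximalIdeal_le_jacobson _) fun f hf => ?_
    obtain ⟨r, hr⟩ := h U (Submodule.factor (le_sup_left : 𝔵 ≤ 𝔵 ⊔ Ideal.span {a}) ∘ₗ f) (by
      intro u hu
      obtain ⟨c, hc⟩ := mem_sup_span_singleton_iff.mp hu
      have hac : a * c ∈ U := by
        have := sub_mem u.2 (hxU hc)
        rwa [sub_sub_cancel] at this
      have h1 : u = ⟨u - a * c, hxU hc⟩ + a • (⟨c, hU c hac⟩ : U) := Subtype.ext (by simp)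
      obtain ⟨y, hy⟩ := Ideal.Quotient.mk_surjective (f ⟨c, hU c hac⟩)
      rw [h1, map_add, LinearMap.comp_apply, hf _ hc, map_zero, zero_add, map_smul,
        LinearMap.comp_apply, ← hy]
      exact Ideal.Quotient.eq_zero_iff_mem.mpr (Ideal.mem_sup_right
        (Ideal.mul_mem_right _ _ (Ideal.mem_span_singleton_self a))))
    have hdiv : ∀ u, ∃ e, a • e = (f - r • ι) u := fun u => by
      obtain ⟨y, hy⟩ := Ideal.Quotient.mk_surjective (f u)
      have h2 := hr u
      rw [LinearMap.comp_apply, ← hy] at h2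
      obtain ⟨c, hc⟩ := mem_sup_span_singleton_iff.mp (Ideal.Quotient.eq.mp h2)
      have hc : y - r * u - a * c ∈ 𝔵 := hc
      refine ⟨Ideal.Quotient.mk 𝔵 c, ?_⟩
      rw [LinearMap.sub_apply, ← hy]
      refine (Ideal.Quotient.eq.mpr (?_ : a * c - (y - r * u) ∈ 𝔵))
      have := neg_mem hc
      convert this using 1; ring
    choose g hg using hdiv
    have hginj : ∀ e e' : B ⧸ 𝔵, a • e = a • e' → e = e' := fun e e' h =>
      sub_eq_zero.mp (hinj _ (by rw [smul_sub, h, sub_self]))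
    let g' : U →ₗ[B] B ⧸ 𝔵 :=
      { toFun := g
        map_add' := fun u u' => hginj _ _ (by rw [hg, smul_add, hg, hg, map_add])
        map_smul' := fun s u => hginj _ _ (by
          rw [hg, RingHom.id_apply, smul_comm, hg, map_smul]) }
    have hg' : g' ∈ H := fun u hu => hinj _ (by
      change a • g u = 0
      rw [hg, LinearMap.sub_apply, hf u hu, LinearMap.smul_apply,
        show ι u = 0 from Ideal.Quotient.eq_zero_iff_mem.mpr hu, smul_zero, sub_zero])
    refine Submodule.mem_sup.mpr ⟨r • ι, Submodule.smul_mem _ _ (Submodule.mem_span_singleton_self ι),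
      a • g', Submodule.smul_mem_smul ha hg', LinearMap.ext fun u => ?_⟩
    change r • ι u + a • g u = f u
    rw [hg, LinearMap.sub_apply, LinearMap.smul_apply, add_sub_cancel]
  obtain ⟨r, hr⟩ := Submodule.mem_span_singleton.mp (hmain (show f ∈ H from hf))
  exact ⟨r, fun u => by rw [← hr]; rfl⟩

/-- If `u` is not a multiple of `v` at `P`, a functional on `(𝔵 : P)` modulo `v` with values in `B ⧸
P` is nonzero at `u`. Following it by `1 ↦ v` gives a map that must be multiplication by some `r`.
From `r v = 0` comes `r ∈ P`, so `u` maps to zero, although its image is `s v` with `s ∉ P`. -/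
theorem SelfInjectiveMod.simpleSocleAt {𝔵 P : Ideal B} [P.IsPrime] {a : B}
    (ha : a ∈ maximalIdeal B) (hna : NZDMod 𝔵 a) (h : SelfInjectiveMod (𝔵 ⊔ Ideal.span {a})) :
    SimpleSocleAt P 𝔵 := by
  intro u v hu hv hvn
  by_contra! hcon
  let U : Ideal B := 𝔵.colon (P : Set B)
  have hU : ∀ w, w ∈ U ↔ ∀ p ∈ P, p * w ∈ 𝔵 := fun w => by
    rw [Submodule.mem_colon]
    exact forall₂_congr fun p _ => by rw [smul_eq_mul, mul_comm]
  let W : Submodule B U := Submodule.comap U.subtype (𝔵 ⊔ Ideal.span {v})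
  have hW : ∀ w : U, w ∈ W ↔ ∃ c, (w : B) - v * c ∈ 𝔵 := fun w => mem_sup_span_singleton_iff
  obtain ⟨e, he⟩ := exists_linearMap_quotient_ne_zero (P := P) (M := U ⧸ W)
    (x := W.mkQ ⟨u, (hU u).mpr hu⟩) (fun p hp y => by
      obtain ⟨w, rfl⟩ := W.mkQ_surjective y
      rw [← map_smul]
      refine (Submodule.Quotient.mk_eq_zero _).mpr ((hW _).mpr ⟨0, ?_⟩)
      rw [mul_zero, sub_zero]
      exact (hU w).mp w.2 p hp) (fun s hs hsu => by
      rw [← map_smul] at hsu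
      obtain ⟨c, hc⟩ := (hW _).mp ((Submodule.Quotient.mk_eq_zero _).mp hsu)
      refine hcon s hs c ?_
      rw [mul_comm c]
      exact hc)
  have hvann : P ≤ LinearMap.ker (LinearMap.toSpanSingleton B (B ⧸ 𝔵) (Ideal.Quotient.mk 𝔵 v)) :=
    fun p hp => Ideal.Quotient.eq_zero_iff_mem.mpr (hv p hp)
  let f : U →ₗ[B] B ⧸ 𝔵 := P.liftQ _ hvann ∘ₗ e ∘ₗ W.mkQ
  obtain ⟨r, hr⟩ := h.exists_eq_mul ha hna (U := U)
    (fun x hx => (hU x).mpr fun p _ => Ideal.mul_mem_left _ p hx)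
    (fun c hc => (hU c).mpr fun p hp => hna _ (by
      have := (hU _).mp hc p hp
      convert this using 1; ring)) f (fun w hw => by
      have : W.mkQ w = 0 := (Submodule.Quotient.mk_eq_zero _).mpr
        ((hW w).mpr ⟨0, by rwa [mul_zero, sub_zero]⟩)
      change P.liftQ _ hvann (e (W.mkQ w)) = 0
      rw [this, map_zero, map_zero])
  have hrv : r * v ∈ 𝔵 := by
    have h1 := hr ⟨v, (hU v).mpr hv⟩
    have h2 : W.mkQ ⟨v, (hU v).mpr hv⟩ = 0 := (Submodule.Quotient.mk_eq_zero _).mpr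
      ((hW _).mpr ⟨1, by simp⟩)
    have h3 : f ⟨v, (hU v).mpr hv⟩ = 0 := by
      change P.liftQ _ hvann (e (W.mkQ _)) = 0
      rw [h2, map_zero, map_zero]
    rw [h3] at h1
    exact Ideal.Quotient.eq_zero_iff_mem.mp h1.symm
  have hrP : r ∈ P := by
    by_contra hrP
    exact hvn r hrP hrv
  have h1 := hr ⟨u, (hU u).mpr hu⟩
  rw [Ideal.Quotient.eq_zero_iff_mem.mpr (hu r hrP)] at h1
  obtain ⟨s, hs⟩ := Ideal.Quotient.mk_surjective (e (W.mkQ ⟨u, (hU u).mpr hu⟩))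
  have hsP : s ∉ P := fun hsP => he (by rw [← hs]; exact Ideal.Quotient.eq_zero_iff_mem.mpr hsP)
  refine hvn s hsP (Ideal.Quotient.eq_zero_iff_mem.mp ?_)
  change P.liftQ _ hvann (e (W.mkQ _)) = 0 at h1
  rw [← hs] at h1
  exact h1

/-- Every prime containing `xs` has height at least its length, so none lies strictly inside `P`. -/
theorem maximalIdeal_mem_minimalPrimes_map {R : Type u} [CommRing R] [IsNoetherianRing R]
    {P : Ideal R} [P.IsPrime] {xs : List R}
    (hxs : RegularOver ⊥ xs) (hP : Ideal.ofList xs ≤ P) (hlen : P.height = xs.length) :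
    maximalIdeal (Localization.AtPrime P) ∈
      ((Ideal.ofList xs).map (algebraMap R (Localization.AtPrime P))).minimalPrimes := by
  refine ⟨⟨inferInstance, Ideal.map_le_iff_le_comap.mpr fun r hr =>
    (IsLocalization.AtPrime.to_map_mem_maximal_iff _ P r).mpr (hP hr)⟩, fun Q hQ hQm => ?_⟩
  have hQp := hQ.1
  have hle : Q.comap (algebraMap R (Localization.AtPrime P)) ≤ P := fun r hr =>
    (IsLocalization.AtPrime.to_map_mem_maximal_iff (Localization.AtPrime P) P r).mp (hQm hr)
  have h1 := length_le_height hxs (P := Q.comap (algebraMap R (Localization.AtPrime P)))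
    fun x hx => hQ.2 (Ideal.mem_map_of_mem _ (Ideal.subset_span hx))
  have h2 : Q.comap (algebraMap R (Localization.AtPrime P)) = P := by
    by_contra hne
    have h3 := Ideal.height_add_one_le_of_lt_of_isPrime (lt_of_le_of_ne hle hne)
    have h4 := (add_le_add_left h1 1).trans h3
    rw [hlen] at h4
    have h5 : xs.length + 1 ≤ xs.length := by exact_mod_cast h4
    omega
  intro b hb
  obtain ⟨r, s, rfl⟩ := IsLocalization.exists_mk'_eq P.primeCompl b
  have h3 : r ∈ Q.comap (algebraMap R (Localization.AtPrime P)) := by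
    rw [h2, ← IsLocalization.AtPrime.to_map_mem_maximal_iff (Localization.AtPrime P) P,
      ← IsLocalization.mk'_spec (Localization.AtPrime P) r s]
    exact Ideal.mul_mem_right _ _ hb
  rw [← Ideal.mul_unit_mem_iff_mem _ (IsLocalization.map_units _ s), IsLocalization.mk'_spec]
  exact h3

theorem selfInjectiveMod_map {R : Type u} [CommRing R] [IsNoetherianRing R] {P : Ideal R}
    [P.IsPrime] {xs : List R} (hxs : RegularOver ⊥ xs)
    (hP : Ideal.ofList xs ≤ P) (hlen : P.height = xs.length)
    (h : SimpleSocleAt P (Ideal.ofList xs)) :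
    SelfInjectiveMod ((Ideal.ofList xs).map (algebraMap R (Localization.AtPrime P))) :=
  h.localization.selfInjectiveMod (maximalIdeal_mem_minimalPrimes_map hxs hP hlen)

theorem exists_cover {R : Type u} [CommRing R] [IsLocalRing R] [IsNoetherianRing R] {P : Ideal R}
    [P.IsPrime] (hP : P ≠ maximalIdeal R) : ∃ Q : Ideal R, Q.IsPrime ∧ P < Q ∧
      ∀ P' : Ideal R, P'.IsPrime → P < P' → P' ≤ Q → P' = Q := by
  let S : Set (PrimeSpectrum R) := {Q | P < Q.asIdeal}
  obtain ⟨Q, hQ, hmin⟩ := (wellFounded_lt (α := ℕ∞)).has_min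
    ((fun Q : PrimeSpectrum R => Q.asIdeal.height) '' S)
    ⟨_, ⟨maximalIdeal R, inferInstance⟩,
      lt_of_le_of_ne (le_maximalIdeal (Ideal.IsPrime.ne_top')) hP, rfl⟩
  obtain ⟨Q, hQ, rfl⟩ := hQ
  refine ⟨Q.asIdeal, Q.2, hQ, fun P' hP' hlt hle => ?_⟩
  by_contra hne
  have := Q.2
  exact hmin _ ⟨⟨P', hP'⟩, hlt, rfl⟩
    (Ideal.height_strict_mono_of_isPrime (lt_of_le_of_ne hle hne))

/-- A regular local ring is Gorenstein at every prime. -/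
theorem simpleSocleAt_ofList {R : Type u} [CommRing R] [IsRegularLocalRing R] {P : Ideal R}
    [hPp : P.IsPrime] {xs : List R} (hxs : RegularOver ⊥ xs) (hP : Ideal.ofList xs ≤ P)
    (hlen : P.height = xs.length) : SimpleSocleAt P (Ideal.ofList xs) := by
  obtain ⟨zs, hzs, hzm, hht⟩ := exists_regularOver_ofList_eq_maximalIdeal R
  -- Descending induction on the height of `P`, from the maximal ideal down along covers.
  induction hk : zs.length - xs.length generalizing P xs with
  | zero =>
    have hle := Ideal.height_mono (le_maximalIdeal hPp.ne_top)
    rw [hlen, hht] at hle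
    have hle' : xs.length ≤ zs.length := by exact_mod_cast hle
    have hl : zs.length = xs.length := by omega
    obtain rfl : P = maximalIdeal R := by
      by_contra hne
      have := Ideal.height_strict_mono_of_isPrime
        (lt_of_le_of_ne (le_maximalIdeal hPp.ne_top) hne)
      rw [hlen, hht, hl] at this
      exact lt_irrefl _ this
    -- At the maximal ideal the sequence is exchanged for regular parameters, whose quotient is the
    -- residue field.
    have key := RegularOver.exchange le_rfl (SimpleSocleAt (maximalIdeal R))
      (fun 𝔶 a b ha _ h₁ h₂ h => h.exchange ha h₁ h₂) hl hzs hxs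
      (fun z hz => hzm ▸ Ideal.subset_span hz) (fun x hx => hP (Ideal.subset_span hx)) (by
        rw [hzm, bot_sup_eq]
        intro u v _ _ hv
        refine ⟨v, fun hvm => hv 1 ?_ (by rwa [one_mul]), u, by rw [mul_comm, sub_self]; exact zero_mem _⟩
        exact (Ideal.ne_top_iff_one _).mp (Ideal.IsPrime.ne_top'))
    rwa [bot_sup_eq] at key
  | succ k ih =>
    have hne : P ≠ maximalIdeal R := by
      rintro rfl
      rw [hht] at hlen
      have : zs.length = xs.length := by exact_mod_cast hlen
      omega
    -- A prime `Q` covering `P` has height one more, so one extra regular element `y` makes the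
    -- local quotient at `Q` self-injective; this descends to a simple socle at `P`.
    obtain ⟨Q, hQ, hPQ, hcov⟩ := exists_cover hne
    have hQht := height_eq_add_one hPQ hcov
    obtain ⟨y, hy, hy'⟩ := exists_mem_nzdMod (p := Q) hxs (by
      rw [hQht, hlen]
      exact_mod_cast Nat.lt_succ_self _)
    have hys : RegularOver ⊥ (y :: xs) := ⟨hxs, by rwa [bot_sup_eq]⟩
    have hyQ : Ideal.ofList (y :: xs) ≤ Q := by
      rw [Ideal.ofList_cons]
      exact sup_le ((Ideal.span_singleton_le_iff_mem _).mpr hy) (hP.trans hPQ.le)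
    have hlen' : Q.height = (y :: xs).length := by
      rw [hQht, hlen, List.length_cons, Nat.cast_add, Nat.cast_one]
    have hS := selfInjectiveMod_map hys hyQ hlen'
      (ih hys hyQ hlen' (by rw [List.length_cons]; omega))
    rw [Ideal.ofList_cons, sup_comm, map_sup_span_singleton] at hS
    have : (P.map (algebraMap R (Localization.AtPrime Q))).IsPrime :=
      IsLocalization.isPrime_of_isPrime_disjoint Q.primeCompl _ P hPp
        (Set.disjoint_left.mpr fun _ hx hx' => hx (hPQ.le hx'))
    exact SimpleSocleAt.of_localization hPQ.le (hS.simpleSocleAt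
      ((IsLocalization.AtPrime.to_map_mem_maximal_iff _ Q y).mpr hy) hy'.localization)

end Gorenstein

/-! ### Hartshorne's connectedness theorem -/

section Connected

variable {B : Type u} [CommRing B]

theorem NZDMod.pow {𝔟 : Ideal B} {y : B} (h : NZDMod 𝔟 y) (n : ℕ) : NZDMod 𝔟 (y ^ n) := by
  induction n with
  | zero => intro r hr; simpa using hr
  | succ n ih => exact fun r hr => ih r (h _ (by convert hr using 1; ring))

theorem NZDMod.span_pow {u v : B} (hu : NZDMod ⊥ u) (h : NZDMod (Ideal.span {u}) v) (n : ℕ) :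
    NZDMod (Ideal.span {u ^ n}) v := by
  induction n with
  | zero => intro r _; simp
  | succ n ih =>
    intro r hr
    obtain ⟨c, hc⟩ := Ideal.mem_span_singleton'.mp hr
    obtain ⟨r', rfl⟩ := Ideal.mem_span_singleton'.mp (ih r
      (Ideal.mem_span_singleton'.mpr ⟨c * u, by rw [← hc]; ring⟩))
    have h1 : u ^ n * (v * r' - u * c) ∈ (⊥ : Ideal B) := by
      rw [Ideal.mem_bot]
      linear_combination -hc
    have h2 := hu.pow n _ h1
    obtain ⟨d, rfl⟩ := Ideal.mem_span_singleton'.mp (h r' (Ideal.mem_span_singleton'.mpr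
      ⟨c, by rw [Ideal.mem_bot] at h2; linear_combination -h2⟩))
    exact Ideal.mem_span_singleton'.mpr ⟨d, by ring⟩

/-- With `x = a₁ + b₁` and `y = a₂ + b₂`, orthogonality gives `y a₁ = x a₂`, so regularity yields
`a₁ = c x`. Then `a₁² = a₁ x` makes `c` idempotent, hence `0` or `1`, and one of the ideals is
killed by `x`. -/
theorem eq_bot_or_eq_bot_of_mul_eq_bot [IsLocalRing B] {𝔞 𝔠 : Ideal B} {x y : B}
    (hx : NZDMod ⊥ x) (hy : NZDMod (Ideal.span {x}) y) (h : 𝔞 * 𝔠 = ⊥) (hxm : x ∈ 𝔞 ⊔ 𝔠)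
    (hym : y ∈ 𝔞 ⊔ 𝔠) : 𝔞 = ⊥ ∨ 𝔠 = ⊥ := by
  have h0 : ∀ a ∈ 𝔞, ∀ b ∈ 𝔠, a * b = 0 := fun a ha b hb => by
    rw [← Ideal.mem_bot, ← h]
    exact Ideal.mul_mem_mul ha hb
  have hx' : ∀ r, x * r = 0 → r = 0 := fun r hr => hx r hr
  obtain ⟨a₁, ha₁, b₁, hb₁, hxe⟩ := Submodule.mem_sup.mp hxm
  obtain ⟨a₂, ha₂, b₂, hb₂, hye⟩ := Submodule.mem_sup.mp hym
  obtain ⟨c, hc⟩ := Ideal.mem_span_singleton'.mp (hy a₁ (Ideal.mem_span_singleton'.mpr ⟨a₂, by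
    rw [← hxe, ← hye]
    linear_combination h0 a₂ ha₂ b₁ hb₁ - h0 a₁ ha₁ b₂ hb₂⟩))
  have hcc : c * (c - 1) = 0 := by
    refine hx' _ (hx' _ ?_)
    have h1 : a₁ * a₁ = a₁ * x := by rw [← hxe, mul_add, h0 a₁ ha₁ b₁ hb₁, add_zero]
    rw [← hc] at h1
    linear_combination h1
  rcases IsLocalRing.isUnit_or_isUnit_one_sub_self c with hu | hu
  · right
    have hc1 : c = 1 := sub_eq_zero.mp (hu.mul_right_eq_zero.mp hcc)
    refine (Submodule.eq_bot_iff _).mpr fun b hb => hx' b ?_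
    rw [hc1, one_mul] at hc
    rw [hc, h0 a₁ ha₁ b hb]
  · left
    have hc0 : c = 0 := hu.mul_left_eq_zero.mp (by linear_combination -hcc)
    refine (Submodule.eq_bot_iff _).mpr fun a ha => hx' a ?_
    rw [hc0, zero_mul] at hc
    rw [← hxe, ← hc, zero_add, mul_comm, h0 a ha b₁ hb₁]

/-- Hartshorne's connectedness theorem: if a noetherian local ring has depth at least two, its
minimal primes cannot be separated away from the maximal ideal. -/
theorem exists_prime_ne_maximalIdeal [IsLocalRing B] [IsNoetherianRing B] {x y : B}
    (hxm : x ∈ maximalIdeal B) (hym : y ∈ maximalIdeal B) (hx : NZDMod ⊥ x)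
    (hy : NZDMod (Ideal.span {x}) y) (C : Ideal B → Prop) {P₁ P₂ : Ideal B}
    (hP₁ : P₁ ∈ minimalPrimes B) (hP₂ : P₂ ∈ minimalPrimes B) (h₁ : C P₁) (h₂ : ¬ C P₂) :
    ∃ Q : Ideal B, Q.IsPrime ∧ Q ≠ maximalIdeal B ∧
      (∃ P ∈ minimalPrimes B, C P ∧ P ≤ Q) ∧ ∃ P ∈ minimalPrimes B, ¬ C P ∧ P ≤ Q := by
  classical
  by_contra! hcon
  have hfin := minimalPrimes.finite_of_isNoetherianRing B
  let S₁ : Finset (Ideal B) := hfin.toFinset.filter C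
  let S₂ : Finset (Ideal B) := hfin.toFinset.filter fun P => ¬ C P
  let K₁ : Ideal B := S₁.inf id
  let K₂ : Ideal B := S₂.inf id
  have hK : K₁ * K₂ ≤ nilradical B := by
    refine Ideal.mul_le_inf.trans ?_
    rw [nilradical, Ideal.zero_eq_bot, ← Ideal.sInf_minimalPrimes]
    refine le_sInf fun P hP => ?_
    by_cases hC : C P
    · exact inf_le_left.trans (Finset.inf_le (f := id) (by simpa [S₁] using ⟨hP, hC⟩))
    · exact inf_le_right.trans (Finset.inf_le (f := id) (by simpa [S₂] using ⟨hP, hC⟩))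
  obtain ⟨n, hn⟩ := IsNoetherianRing.isNilpotent_nilradical B
  have hmul : K₁ ^ n * K₂ ^ n = ⊥ := by
    rw [← mul_pow, ← le_bot_iff, ← Ideal.zero_eq_bot, ← hn]
    exact Ideal.pow_right_mono hK n
  have hle₁ : ∀ Q : Ideal B, Q.IsPrime → K₁ ^ n ≤ Q → ∃ P ∈ minimalPrimes B, C P ∧ P ≤ Q := by
    intro Q hQ hle
    obtain ⟨P, hP, hle⟩ := hQ.inf_le'.mp (hQ.le_of_pow_le hle)
    have hP : P ∈ minimalPrimes B ∧ C P := by simpa [S₁] using hP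
    exact ⟨P, hP.1, hP.2, hle⟩
  have hle₂ : ∀ Q : Ideal B, Q.IsPrime → K₂ ^ n ≤ Q → ∃ P ∈ minimalPrimes B, ¬ C P ∧ P ≤ Q := by
    intro Q hQ hle
    obtain ⟨P, hP, hle⟩ := hQ.inf_le'.mp (hQ.le_of_pow_le hle)
    have hP : P ∈ minimalPrimes B ∧ ¬ C P := by simpa [S₂] using hP
    exact ⟨P, hP.1, hP.2, hle⟩
  -- By assumption only the maximal ideal contains minimal primes of both classes. Powers of `x` and
  -- `y` therefore lie in the sum, while the product of the two ideals is zero.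
  have hrad : maximalIdeal B ≤ (K₁ ^ n ⊔ K₂ ^ n).radical := by
    rw [Ideal.radical_eq_sInf]
    refine le_sInf fun Q ⟨hle, hQ⟩ => ?_
    by_contra hne
    obtain ⟨P, hP, hCP, hPQ⟩ := hle₂ Q hQ (le_sup_right.trans hle)
    exact hcon Q hQ (fun h => hne h.ge) (hle₁ Q hQ (le_sup_left.trans hle)) P hP hCP hPQ
  obtain ⟨k, hk⟩ := hrad hxm
  obtain ⟨l, hl⟩ := hrad hym
  rcases eq_bot_or_eq_bot_of_mul_eq_bot (hx.pow k) ((NZDMod.span_pow hx hy k).pow l) hmul hk hl with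
    h | h
  · obtain ⟨P, hP, hC, hle⟩ := hle₁ P₂ hP₂.1.1 (h ▸ bot_le)
    exact h₂ (le_antisymm hle (hP₂.2 hP.1 hle) ▸ hC)
  · obtain ⟨P, hP, hC, hle⟩ := hle₂ P₁ hP₁.1.1 (h ▸ bot_le)
    exact hC (le_antisymm hle (hP₁.2 hP.1 hle) ▸ h₁)

end Connected

/-! ### Serre's condition S₂: no embedded primes, equidimensionality -/

section Serre

theorem SerreCondition.exists_regularOver {A : Type u} [CommRing A] (h : SerreCondition 2 A)
    (p : Ideal A) [p.IsPrime] {k : ℕ} (hk : k ≤ 2) (hp : (k : ℕ∞) ≤ p.height) :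
    ∃ rs : List (Localization.AtPrime p), rs.length = k ∧ RegularOver ⊥ rs ∧
      ∀ r ∈ rs, r ∈ maximalIdeal (Localization.AtPrime p) := by
  obtain ⟨rs, hrs, hlen⟩ := h p
  rw [IsLocalization.AtPrime.ringKrullDim_eq_height p] at hlen
  have hlen' : k ≤ rs.length := by
    have h1 : ((k : ℕ∞) : WithBot ℕ∞) ≤ min ((2 : ℕ) : WithBot ℕ∞) p.height :=
      le_min (WithBot.coe_le_coe.mpr (Nat.cast_le.mpr hk)) (WithBot.coe_le_coe.mpr hp)
    exact_mod_cast h1.trans hlen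
  have hw : IsWeaklyRegular (Localization.AtPrime p) (rs.take k) := by
    have := hrs.toIsWeaklyRegular
    rw [← List.take_append_drop k rs, isWeaklyRegular_append_iff] at this
    exact this.1
  refine ⟨(rs.take k).reverse, by simpa using hlen', ?_, fun r hr => ?_⟩
  · rw [← isWeaklyRegular_reverse_iff, List.reverse_reverse]
    exact hw
  · have hr : r ∈ rs := List.mem_of_mem_take (List.mem_reverse.mp hr)
    by_contra hu
    rw [mem_maximalIdeal, mem_nonunits_iff, not_not] at hu
    have h1 : Ideal.ofList rs = ⊤ := Ideal.eq_top_of_isUnit_mem _ (Ideal.subset_span hr) hu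
    exact hrs.top_ne_smul (by rw [h1, Submodule.top_smul])

variable {R : Type u} [CommRing R] {I P : Ideal R}

/-- The prime of `R ⧸ I` corresponding to a prime of `R`. -/
abbrev quotientPrime (I P : Ideal R) : Ideal (R ⧸ I) := P.map (Ideal.Quotient.mk I)

theorem isPrime_quotientPrime [P.IsPrime] (h : I ≤ P) : (quotientPrime I P).IsPrime :=
  Ideal.isPrime_map_quotientMk_of_isPrime h

theorem mk_mem_quotientPrime (h : I ≤ P) {r : R} :
    Ideal.Quotient.mk I r ∈ quotientPrime I P ↔ r ∈ P := by
  rw [← Ideal.mem_comap, Ideal.comap_map_of_surjective _ Ideal.Quotient.mk_surjective,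
    ← RingHom.ker_eq_comap_bot, Ideal.mk_ker, sup_eq_left.mpr h]

theorem quotientPrime_lt {P' : Ideal R} (h' : I ≤ P') (h : I ≤ P) (hlt : P < P') :
    quotientPrime I P < quotientPrime I P' := by
  refine lt_of_le_not_ge (Ideal.map_mono hlt.le) fun hle => hlt.not_ge fun r hr => ?_
  exact (mk_mem_quotientPrime h).mp (hle ((mk_mem_quotientPrime h').mpr hr))

theorem one_le_height_quotientPrime {P₀ : Ideal R} [P₀.IsPrime] [P.IsPrime] (h₀ : I ≤ P₀)
    (h : P₀ < P) : 1 ≤ (quotientPrime I P).height := by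
  have := isPrime_quotientPrime h₀
  have := isPrime_quotientPrime (h₀.trans h.le)
  exact le_add_self.trans (Ideal.height_add_one_le_of_lt_of_isPrime
    (quotientPrime_lt (h₀.trans h.le) h₀ h))

theorem two_le_height_quotientPrime {P₀ P₁ : Ideal R} [P₀.IsPrime] [P₁.IsPrime] [P.IsPrime]
    (h₀ : I ≤ P₀) (h₁ : P₀ < P₁) (h₂ : P₁ < P) : 2 ≤ (quotientPrime I P).height := by
  have := isPrime_quotientPrime (h₀.trans h₁.le)
  have := isPrime_quotientPrime (h₀.trans (h₁.le.trans h₂.le))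
  refine le_trans ?_ (Ideal.height_add_one_le_of_lt_of_isPrime
    (quotientPrime_lt (h₀.trans (h₁.le.trans h₂.le)) (h₀.trans h₁.le) h₂))
  exact (add_le_add_left (one_le_height_quotientPrime h₀ h₁) 1).trans' (by norm_num)

section AtPrime

variable [hp : (quotientPrime I P).IsPrime]

/-- The canonical map from `R` to the localization of `R ⧸ I` at a prime. -/
abbrev toLocalQuotient (I P : Ideal R) [(quotientPrime I P).IsPrime] :
    R →+* Localization.AtPrime (quotientPrime I P) :=
  (algebraMap (R ⧸ I) (Localization.AtPrime (quotientPrime I P))).comp (Ideal.Quotient.mk I)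

theorem toLocalQuotient_eq_zero_iff (h : I ≤ P) {r : R} :
    toLocalQuotient I P r = 0 ↔ ∃ s ∉ P, s * r ∈ I := by
  rw [RingHom.comp_apply, IsLocalization.map_eq_zero_iff (quotientPrime I P).primeCompl]
  constructor
  · rintro ⟨⟨s, hs⟩, hsr⟩
    obtain ⟨s, rfl⟩ := Ideal.Quotient.mk_surjective s
    exact ⟨s, fun h' => hs ((mk_mem_quotientPrime h).mpr h'), Ideal.Quotient.eq_zero_iff_mem.mp hsr⟩
  · rintro ⟨s, hs, hsr⟩
    exact ⟨⟨Ideal.Quotient.mk I s, fun h' => hs ((mk_mem_quotientPrime h).mp h')⟩,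
      Ideal.Quotient.eq_zero_iff_mem.mpr hsr⟩

theorem toLocalQuotient_mem_maximalIdeal (h : I ≤ P) {r : R} :
    toLocalQuotient I P r ∈ maximalIdeal _ ↔ r ∈ P := by
  rw [RingHom.comp_apply, IsLocalization.AtPrime.to_map_mem_maximal_iff _ (quotientPrime I P),
    mk_mem_quotientPrime h]

theorem exists_mul_eq_toLocalQuotient
    (b : Localization.AtPrime (quotientPrime I P)) :
    ∃ (r : R) (w : Localization.AtPrime (quotientPrime I P)), IsUnit w ∧
      b = toLocalQuotient I P r * w := by
  obtain ⟨r, s, rfl⟩ := IsLocalization.exists_mk'_eq (quotientPrime I P).primeCompl b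
  obtain ⟨r, rfl⟩ := Ideal.Quotient.mk_surjective r
  obtain ⟨w, hw⟩ := (IsLocalization.map_units (Localization.AtPrime (quotientPrime I P)) s)
  refine ⟨r, (w⁻¹ : _ˣ), Units.isUnit _, ?_⟩
  rw [Units.eq_mul_inv_iff_mul_eq, hw, IsLocalization.mk'_spec, RingHom.comp_apply]

theorem comap_toLocalQuotient_le (h : I ≤ P) (Q : Ideal (Localization.AtPrime (quotientPrime I P)))
    [hQ : Q.IsPrime] : Q.comap (toLocalQuotient I P) ≤ P := fun _ hr =>
  (toLocalQuotient_mem_maximalIdeal h).mp (le_maximalIdeal hQ.ne_top hr)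

theorem le_comap_toLocalQuotient (Q : Ideal (Localization.AtPrime (quotientPrime I P))) :
    I ≤ Q.comap (toLocalQuotient I P) := fun r hr => by
  rw [Ideal.mem_comap, RingHom.comp_apply, Ideal.Quotient.eq_zero_iff_mem.mpr hr, map_zero]
  exact zero_mem _

theorem comap_toLocalQuotient_mem_minimalPrimes [IsNoetherianRing R]
    {Q : Ideal (Localization.AtPrime (quotientPrime I P))}
    (hQ : Q ∈ minimalPrimes (Localization.AtPrime (quotientPrime I P))) :
    Q.comap (toLocalQuotient I P) ∈ I.minimalPrimes := by
  have := hQ.1.1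
  rw [Ideal.minimalPrimes_eq_comap]
  refine ⟨Q.under (R ⧸ I), ?_, Ideal.comap_comap _ _⟩
  rw [← Ideal.height_eq_zero_iff, IsLocalization.height_under (quotientPrime I P).primeCompl,
    Ideal.height_eq_zero_iff]
  exact hQ

theorem exists_comap_toLocalQuotient_eq {P₁ : Ideal R} [P₁.IsPrime] (h₁ : I ≤ P₁) (h : P₁ ≤ P) :
    ∃ Q : Ideal (Localization.AtPrime (quotientPrime I P)), Q.IsPrime ∧
      Q.comap (toLocalQuotient I P) = P₁ := by
  have := isPrime_quotientPrime h₁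
  have hle : quotientPrime I P₁ ≤ quotientPrime I P := Ideal.map_mono h
  have hdis : Disjoint ((quotientPrime I P).primeCompl : Set (R ⧸ I)) (quotientPrime I P₁) :=
    Set.disjoint_left.mpr fun _ hx hx' => hx (hle hx')
  refine ⟨(quotientPrime I P₁).map (algebraMap _ _),
    IsLocalization.isPrime_of_isPrime_disjoint (quotientPrime I P).primeCompl _ _ this hdis, ?_⟩
  rw [← Ideal.comap_comap, comap_map_of_le hle]
  ext r
  exact mk_mem_quotientPrime h₁

theorem exists_minimalPrimes_comap_toLocalQuotient_eq [IsNoetherianRing R] {P₁ : Ideal R}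
    (h₁ : P₁ ∈ I.minimalPrimes) (h : P₁ ≤ P) :
    ∃ Q ∈ minimalPrimes (Localization.AtPrime (quotientPrime I P)),
      Q.comap (toLocalQuotient I P) = P₁ := by
  have := h₁.1.1
  obtain ⟨Q, hQ, hQ'⟩ := exists_comap_toLocalQuotient_eq h₁.1.2 h
  obtain ⟨Q₀, hQ₀, hle⟩ := Ideal.exists_minimalPrimes_le (bot_le : ⊥ ≤ Q)
  have := hQ₀.1.1
  refine ⟨Q₀, hQ₀, ?_⟩
  have hle' : Q₀.comap (toLocalQuotient I P) ≤ P₁ := hQ' ▸ Ideal.comap_mono hle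
  exact le_antisymm hle' (h₁.2 ⟨inferInstance, le_comap_toLocalQuotient Q₀⟩ hle')

end AtPrime

/-- A nonminimal prime has positive height in `R ⧸ I`, so its localization has a regular element in
the maximal ideal; an associated prime consists of zerodivisors. -/
theorem SerreCondition.mem_minimalPrimes_of_assocAt (hS : SerreCondition 2 (R ⧸ I))
    (hA : AssocAt I P) : P ∈ I.minimalPrimes := by
  have hPp := hA.1
  have hle := hA.le
  obtain ⟨P₀, hP₀, h₀⟩ := Ideal.exists_minimalPrimes_le hle
  rcases eq_or_lt_of_le h₀ with rfl | hlt
  · exact hP₀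
  exfalso
  have := hP₀.1.1
  have := isPrime_quotientPrime hle
  obtain ⟨rs, hlen, hrs, hm⟩ := hS.exists_regularOver (quotientPrime I P) (k := 1) (by norm_num)
    (by exact_mod_cast one_le_height_quotientPrime hP₀.1.2 hlt)
  obtain ⟨b, rfl⟩ := List.length_eq_one_iff.mp hlen
  obtain ⟨u, w, hw, rfl⟩ := exists_mul_eq_toLocalQuotient b
  have hu : u ∈ P := by
    rw [← toLocalQuotient_mem_maximalIdeal hle, ← Ideal.mul_unit_mem_iff_mem _ hw]
    exact hm _ (by simp)
  obtain ⟨-, v, hv⟩ := hA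
  have h1 : toLocalQuotient I P v = 0 := by
    have h2 := hrs.2 (toLocalQuotient I P v)
    rw [Ideal.ofList_nil, bot_sup_eq, Ideal.mem_bot, Ideal.mem_bot] at h2
    refine h2 ?_
    rw [mul_right_comm, ← map_mul, (toLocalQuotient_eq_zero_iff hle).mpr
      ⟨1, (Ideal.ne_top_iff_one P).mp hPp.ne_top, by rw [one_mul]; exact (hv u).mpr hu⟩, zero_mul]
  obtain ⟨s, hs, hsv⟩ := (toLocalQuotient_eq_zero_iff hle).mp h1
  exact hs ((hv s).mp hsv)

/-- Over a regular local ring, quotients satisfying `S₂` are equidimensional. -/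
theorem SerreCondition.height_eq {R : Type u} [CommRing R] [IsRegularLocalRing R] {I P : Ideal R}
    {d : ℕ} (hI : I.height = d) (hS : SerreCondition 2 (R ⧸ I)) (hP : P ∈ I.minimalPrimes) :
    P.height = d := by
  by_contra hne
  obtain ⟨P', hP', hIP', hht⟩ := Ideal.exists_isPrime_height_eq hI
  have hmin : P' ∈ I.minimalPrimes :=
    Ideal.mem_minimalPrimes_of_height_le hIP' (by rw [hht, hI])
  -- Take a prime of least height containing minimal primes of `I` both of height `d` and of another
  -- height; Hartshorne's theorem at this prime produces a smaller one.
  let S : Set (PrimeSpectrum R) := {Q | (∃ P ∈ I.minimalPrimes, P.height = d ∧ P ≤ Q.asIdeal) ∧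
    ∃ P ∈ I.minimalPrimes, P.height ≠ d ∧ P ≤ Q.asIdeal}
  obtain ⟨-, ⟨Q, ⟨⟨P₁, hP₁, hd₁, h₁⟩, P₂, hP₂, hd₂, h₂⟩, rfl⟩, hQmin⟩ :=
    (wellFounded_lt (α := ℕ∞)).has_min ((fun Q : PrimeSpectrum R => Q.asIdeal.height) '' S)
    ⟨_, ⟨maximalIdeal R, inferInstance⟩, ⟨⟨P', hmin, hht, le_maximalIdeal hP'.ne_top⟩,
      P, hP, hne, le_maximalIdeal hP.1.1.ne_top⟩, rfl⟩
  have := hP₁.1.1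
  have := hP₂.1.1
  have := Q.2
  have hlt₁ : P₁ < Q.asIdeal := lt_of_le_of_ne h₁ fun h =>
    hd₂ (le_antisymm (h ▸ h₂) (hP₁.2 hP₂.1 (h ▸ h₂)) ▸ hd₁)
  have hlt₂ : P₂ < Q.asIdeal := lt_of_le_of_ne h₂ fun h =>
    hd₂ (le_antisymm (h ▸ h₁) (hP₂.2 hP₁.1 (h ▸ h₁)) ▸ hd₁)
  have hIQ : I ≤ Q.asIdeal := hP₁.1.2.trans h₁
  have := isPrime_quotientPrime hIQ
  -- In dimension at most one `Q` covers both `P₁` and `P₂`, which would force their heights to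
  -- agree.
  have h2 : 2 ≤ (quotientPrime I Q.asIdeal).height := by
    by_contra hlt
    have e₁ := height_eq_add_one hlt₁ fun P' hP' hlt' hle => by
      by_contra hne
      exact hlt (two_le_height_quotientPrime hP₁.1.2 hlt' (lt_of_le_of_ne hle hne))
    have e₂ := height_eq_add_one hlt₂ fun P' hP' hlt' hle => by
      by_contra hne
      exact hlt (two_le_height_quotientPrime hP₂.1.2 hlt' (lt_of_le_of_ne hle hne))
    rw [e₁, hd₁] at e₂
    exact hd₂ (le_antisymm ((ENat.add_le_add_iff_right ENat.one_ne_top).mp e₂.ge)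
      ((ENat.add_le_add_iff_right ENat.one_ne_top).mp e₂.le))
  obtain ⟨rs, hlen, hrs, hm⟩ := hS.exists_regularOver (quotientPrime I Q.asIdeal) le_rfl
    (by exact_mod_cast h2)
  obtain ⟨y, x, rfl⟩ := List.length_eq_two.mp hlen
  obtain ⟨M₁, hM₁, hM₁'⟩ := exists_minimalPrimes_comap_toLocalQuotient_eq hP₁ h₁
  obtain ⟨M₂, hM₂, hM₂'⟩ := exists_minimalPrimes_comap_toLocalQuotient_eq hP₂ h₂
  obtain ⟨⟨-, hx⟩, hy⟩ := hrs
  rw [Ideal.ofList_nil, bot_sup_eq] at hx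
  rw [Ideal.ofList_singleton, bot_sup_eq] at hy
  obtain ⟨N, hN, hNm, ⟨N₁, hN₁, hC₁, hle₁⟩, N₂, hN₂, hC₂, hle₂⟩ :=
    exists_prime_ne_maximalIdeal (hm x (by simp)) (hm y (by simp)) hx hy
      (fun M => (M.comap (toLocalQuotient I Q.asIdeal)).height = d) hM₁ hM₂
      (by rw [hM₁', hd₁]) (by rw [hM₂']; exact hd₂)
  refine hQmin _ ⟨⟨N.comap (toLocalQuotient I Q.asIdeal), inferInstance⟩,
    ⟨⟨_, comap_toLocalQuotient_mem_minimalPrimes hN₁, hC₁, Ideal.comap_mono hle₁⟩,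
    _, comap_toLocalQuotient_mem_minimalPrimes hN₂, hC₂, Ideal.comap_mono hle₂⟩, rfl⟩ ?_
  refine Ideal.height_strict_mono_of_isPrime (lt_of_le_of_ne (comap_toLocalQuotient_le hIQ N) ?_)
  intro h
  refine hNm (le_antisymm (le_maximalIdeal hN.ne_top) fun b hb => ?_)
  obtain ⟨r, w, hw, rfl⟩ := exists_mul_eq_toLocalQuotient b
  rw [Ideal.mul_unit_mem_iff_mem _ hw, toLocalQuotient_mem_maximalIdeal hIQ] at hb
  refine Ideal.mul_mem_right _ _ ?_
  exact h.ge hb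

theorem SerreCondition.height_eq_of_assocAt {R : Type u} [CommRing R] [IsRegularLocalRing R]
    {I P : Ideal R} {d : ℕ} (hI : I.height = d) (hS : SerreCondition 2 (R ⧸ I))
    (hP : AssocAt I P) : P.height = d :=
  hS.height_eq hI (hS.mem_minimalPrimes_of_assocAt hP)

end Serre

/-! ### Maps from the canonical module to `R/𝐱` -/

section Endomorphisms

theorem exists_forall_smul_eq_zero {R : Type u} [CommRing R] {P : Ideal R} [P.IsPrime]
    {M N : Type u} [AddCommGroup M] [Module R M] [Module.Finite R M] [AddCommGroup N] [Module R N]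
    (k : M →ₗ[R] N) (h : ∀ x, ∃ t ∉ P, t • k x = 0) : ∃ t ∉ P, ∀ x, t • k x = 0 := by
  obtain ⟨S, hS⟩ := (Module.Finite.fg_top : (⊤ : Submodule R M).FG)
  choose t ht htk using h
  refine ⟨∏ x ∈ S, t x, fun hmem => ?_, fun x => ?_⟩
  · obtain ⟨x, -, hx⟩ := (Ideal.IsPrime.prod_mem_iff).mp hmem
    exact ht x hx
  · have : (⊤ : Submodule R M) ≤ LinearMap.ker ((∏ x ∈ S, t x) • k) := by
      rw [← hS]
      refine Submodule.span_le.mpr fun x hx => ?_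
      obtain ⟨c, hc⟩ := Finset.dvd_prod_of_mem t hx
      change (∏ x ∈ S, t x) • k x = 0
      rw [hc, mul_comm, mul_smul, htk, smul_zero]
    exact this (Submodule.mem_top : x ∈ ⊤)

/-- If every map from the localization of `U` to that of `R ⧸ 𝔵` is a multiplication, then every
map from `U` to `R ⧸ 𝔵` is locally a multiplication. -/
theorem exists_smul_eq_mul_of_localization {R : Type u} [CommRing R] [IsNoetherianRing R]
    {P 𝔵 U : Ideal R} [P.IsPrime] (hxU : 𝔵 ≤ U) (f : U →ₗ[R] R ⧸ 𝔵)
    (hf : ∀ u : U, (u : R) ∈ 𝔵 → f u = 0)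
    (h : ∀ g : U.map (algebraMap R (Localization.AtPrime P)) →ₗ[Localization.AtPrime P]
        Localization.AtPrime P ⧸ 𝔵.map (algebraMap R (Localization.AtPrime P)),
      (∀ j : U.map (algebraMap R (Localization.AtPrime P)), (j : Localization.AtPrime P) ∈
        𝔵.map (algebraMap R (Localization.AtPrime P)) → g j = 0) →
      ∃ b : Localization.AtPrime P, ∀ j, g j = Ideal.Quotient.mk _ (b * j)) :
    ∃ s ∉ P, ∃ r, ∀ u : U, s • f u = Ideal.Quotient.mk 𝔵 (r * u) := by
  let B := Localization.AtPrime P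
  let 𝔵B := 𝔵.map (algebraMap R B)
  have hunit : ∀ s : P.primeCompl, IsUnit (algebraMap R (Module.End R (B ⧸ 𝔵B)) s) := fun s => by
    rw [Module.End.isUnit_iff]
    obtain ⟨w, hw⟩ := IsLocalization.map_units B s
    have hsm : ∀ e : B ⧸ 𝔵B, algebraMap R (Module.End R (B ⧸ 𝔵B)) s e = (w : B) • e := fun e => by
      rw [hw, algebraMap_smul]
      rfl
    refine ⟨fun e e' hee => ?_, fun e => ⟨((w⁻¹ : Bˣ) : B) • e, ?_⟩⟩
    · rw [hsm, hsm] at hee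
      exact (w.isUnit.smul_left_cancel).mp hee
    · rw [hsm, smul_smul, Units.mul_inv, one_smul]
  let e : (R ⧸ 𝔵) →ₗ[R] B ⧸ 𝔵B :=
    𝔵.liftQ ((Submodule.mkQ 𝔵B).restrictScalars R ∘ₗ Algebra.linearMap R B) fun x hx =>
      Ideal.Quotient.eq_zero_iff_mem.mpr (Ideal.mem_map_of_mem _ hx)
  let g₀ : U.map (algebraMap R B) →ₗ[R] B ⧸ 𝔵B :=
    IsLocalizedModule.lift P.primeCompl (Algebra.idealMap B U) (e ∘ₗ f) hunit
  have hg₀ : ∀ u, g₀ (Algebra.idealMap B U u) = e (f u) := fun u =>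
    IsLocalizedModule.lift_apply _ _ _ _ _
  obtain ⟨b, hb⟩ := h (g₀.extendScalarsOfIsLocalization P.primeCompl B) (fun j hj => by
    obtain ⟨⟨x, s⟩, hxs⟩ := (IsLocalization.mem_map_algebraMap_iff P.primeCompl B).mp hj
    have h1 : (s : R) • j = Algebra.idealMap B U ⟨x, hxU x.2⟩ := Subtype.ext (by
      change (s : R) • (j : B) = algebraMap R B x
      rw [Algebra.smul_def, mul_comm]
      exact hxs)
    have h2 : (s : R) • g₀ j = 0 := by
      rw [← map_smul, h1, hg₀, hf _ x.2, map_zero]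
    exact ((Module.End.isUnit_iff _).mp (hunit s)).1 (h2.trans (map_zero _).symm))
  obtain ⟨r, s, rfl⟩ := IsLocalization.exists_mk'_eq P.primeCompl b
  obtain ⟨t, ht, htk⟩ := exists_forall_smul_eq_zero (P := P)
    ((s : R) • f - r • (𝔵.mkQ ∘ₗ U.subtype)) (fun u => by
      obtain ⟨y, hy⟩ := Ideal.Quotient.mk_surjective (f u)
      have h1 : e (f u) = Ideal.Quotient.mk 𝔵B (IsLocalization.mk' B r s * algebraMap R B u) := by
        rw [← hg₀]
        exact hb (Algebra.idealMap B U u)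
      rw [← hy] at h1
      have h2 : algebraMap R B y - IsLocalization.mk' B r s * algebraMap R B u ∈ 𝔵B :=
        Ideal.Quotient.eq.mp h1
      have h3 : algebraMap R B (s * y - r * u) ∈ 𝔵B := by
        have := Ideal.mul_mem_left 𝔵B (algebraMap R B s) h2
        convert this using 1
        rw [map_sub, map_mul, map_mul, ← IsLocalization.mk'_spec B r s]
        ring
      obtain ⟨t, ht, htm⟩ := algebraMap_mem_map_iff.mp h3
      refine ⟨t, ht, ?_⟩
      rw [LinearMap.sub_apply, LinearMap.smul_apply, ← hy]
      exact Ideal.Quotient.eq_zero_iff_mem.mpr htm)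
  refine ⟨t * s, fun hmem => (Ideal.IsPrime.mem_or_mem ‹_› hmem).elim ht s.2, t * r, fun u => ?_⟩
  have := htk u
  rw [LinearMap.sub_apply, smul_sub, sub_eq_zero, LinearMap.smul_apply, smul_smul] at this
  rw [this, mul_assoc]
  rfl

theorem mem_colon_iff {R : Type u} [CommRing R] {𝔵 I : Ideal R} {u : R} : u ∈ 𝔵.colon (I : Set R) ↔ ∀ i ∈ I, i * u ∈ 𝔵 := by
  rw [Submodule.mem_colon]
  exact forall₂_congr fun p _ => by rw [smul_eq_mul, mul_comm]

variable {R : Type u} [CommRing R] [IsRegularLocalRing R] {I : Ideal R} {ys : List R}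

/-- The canonical module of `R ⧸ I` is faithful when `R ⧸ I` satisfies `S₂`. -/
theorem mem_of_forall_mul_mem (hys : RegularOver ⊥ ys) (hyI : Ideal.ofList ys ≤ I)
    (hI : I.height = ys.length) (hS : SerreCondition 2 (R ⧸ I)) {w : R}
    (hw : ∀ u ∈ (Ideal.ofList ys).colon (I : Set R), w * u ∈ Ideal.ofList ys) : w ∈ I := by
  by_contra hwI
  -- A multiple of `w` generates a copy of `R/P` in `R ⧸ I`, with `P` of height `d`. At `P` every
  -- ideal over `𝔵` is an annihilator, so some element kills `I` but not this multiple, against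
  -- `hw`.
  obtain ⟨c, P, hP, -, hcw⟩ := exists_assoc_le (𝔶 := I) (Q := maximalIdeal R) (v := w)
    (fun s hs hsw => hwI (by
      rw [mem_maximalIdeal, mem_nonunits_iff, not_not] at hs
      exact (Ideal.unit_mul_mem_iff_mem _ hs).mp hsw))
  have hA : AssocAt I P := ⟨hP, _, hcw⟩
  have hht := hS.height_eq_of_assocAt hI hA
  have hyP := hyI.trans hA.le
  let B := Localization.AtPrime P
  have hcwB : algebraMap R B (c * w) ∉ I.map (algebraMap R B) := fun h => by
    obtain ⟨s, hs, hsm⟩ := algebraMap_mem_map_iff.mp h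
    exact hs ((hcw s).mp hsm)
  obtain ⟨b, hbI, hb⟩ := (selfInjectiveMod_map hys hyP hht
    (simpleSocleAt_ofList hys hyP hht)).exists_mul_notMem
      (maximalIdeal_mem_minimalPrimes_map hys hyP hht) (Ideal.map_mono hyI) hcwB
  obtain ⟨r, s, rfl⟩ := IsLocalization.exists_mk'_eq P.primeCompl b
  obtain ⟨t, ht, htr⟩ := exists_forall_mul_mem (Q := P) (P := I) (𝔶 := Ideal.ofList ys) (u := r)
    fun i hi => by
      have := hbI _ (Ideal.mem_map_of_mem (algebraMap R B) hi)
      rwa [mul_comm, IsLocalization.mul_mk'_eq_mk'_of_mul, mk'_mem_map_iff] at this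
  refine hb ?_
  rw [mul_comm, IsLocalization.mul_mk'_eq_mk'_of_mul, mk'_mem_map_iff]
  refine ⟨t, ht, ?_⟩
  have := Ideal.mul_mem_left _ c (hw _ (mem_colon_iff.mpr htr))
  convert this using 1; ring

/-- In height `d` the localization of `R ⧸ 𝔵` is self-injective. In height `d + 1` it becomes so
after dividing by one more regular element, which is also regular modulo `𝔵 : I`. -/
theorem exists_smul_eq_mul_of_height_le (hys : RegularOver ⊥ ys)
    (hyI : Ideal.ofList ys ≤ I) {P : Ideal R} [P.IsPrime] (hIP : I ≤ P)
    (hP : P.height = ys.length ∨ P.height = ys.length + 1)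
    (f : (Ideal.ofList ys).colon (I : Set R) →ₗ[R] R ⧸ Ideal.ofList ys)
    (hf : ∀ u : (Ideal.ofList ys).colon (I : Set R), (u : R) ∈ Ideal.ofList ys → f u = 0) :
    ∃ s ∉ P, ∃ r, ∀ u, s • f u = Ideal.Quotient.mk (Ideal.ofList ys) (r * u) := by
  have hyP := hyI.trans hIP
  have hxU : Ideal.ofList ys ≤ (Ideal.ofList ys).colon (I : Set R) := fun x hx =>
    mem_colon_iff.mpr fun i _ => Ideal.mul_mem_left _ i hx
  refine exists_smul_eq_mul_of_localization hxU f hf fun g hg => ?_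
  rcases hP with hP | hP
  · exact selfInjectiveMod_map hys hyP hP (simpleSocleAt_ofList hys hyP hP) _ g hg
  · obtain ⟨y, hy, hy'⟩ := exists_mem_nzdMod (p := P) hys (by
      rw [hP]; exact_mod_cast Nat.lt_succ_self _)
    have hzs : RegularOver ⊥ (y :: ys) := ⟨hys, by rwa [bot_sup_eq]⟩
    have hzP : Ideal.ofList (y :: ys) ≤ P := by
      rw [Ideal.ofList_cons]
      exact sup_le ((Ideal.span_singleton_le_iff_mem _).mpr hy) hyP
    have hlen : P.height = (y :: ys).length := by
      rw [hP, List.length_cons, Nat.cast_add, Nat.cast_one]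
    have hQ := selfInjectiveMod_map hzs hzP hlen (simpleSocleAt_ofList hzs hzP hlen)
    rw [Ideal.ofList_cons, sup_comm, map_sup_span_singleton] at hQ
    refine hQ.exists_eq_mul ((IsLocalization.AtPrime.to_map_mem_maximal_iff _ P y).mpr hy)
      hy'.localization (Ideal.map_mono hxU) (fun c hc => ?_) g hg
    obtain ⟨r, s, rfl⟩ := IsLocalization.exists_mk'_eq P.primeCompl c
    rw [IsLocalization.mul_mk'_eq_mk'_of_mul, mk'_mem_map_iff] at hc
    obtain ⟨t, ht, htr⟩ := hc
    refine mk'_mem_map_iff.mpr ⟨t, ht, mem_colon_iff.mpr fun i hi => hy' _ ?_⟩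
    have := mem_colon_iff.mp htr i hi
    convert this using 1; ring

theorem exists_mul_toLocalQuotient_eq {R : Type u} [CommRing R] {I P : Ideal R} (h : I ≤ P)
    [(quotientPrime I P).IsPrime] (b : Localization.AtPrime (quotientPrime I P)) :
    ∃ r, ∃ s ∉ P, toLocalQuotient I P s * b = toLocalQuotient I P r := by
  obtain ⟨r, ⟨s, hs⟩, rfl⟩ := IsLocalization.exists_mk'_eq (quotientPrime I P).primeCompl b
  obtain ⟨r, rfl⟩ := Ideal.Quotient.mk_surjective r
  obtain ⟨s, rfl⟩ := Ideal.Quotient.mk_surjective s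
  exact ⟨r, s, fun h' => hs ((mk_mem_quotientPrime h).mpr h'), 
    IsLocalization.mk'_spec' _ (Ideal.Quotient.mk I r) ⟨Ideal.Quotient.mk I s, hs⟩⟩

/-- Let `a`, `b` in `P` be regular on `(R ⧸ I)_P`, with `a f = α` and `b f = β`. Faithfulness gives
`a β = b α` in `R ⧸ I`, so `α` is locally a multiple of `a`, and dividing by `a` gives the
multiplier for `f`. -/
theorem exists_smul_eq_mul_of_two_le_height (hys : RegularOver ⊥ ys)
    (hyI : Ideal.ofList ys ≤ I) (hI : I.height = ys.length) (hS : SerreCondition 2 (R ⧸ I))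
    {P : Ideal R} [P.IsPrime] (hIP : I ≤ P) (hP : 2 ≤ (quotientPrime I P).height)
    (f : (Ideal.ofList ys).colon (I : Set R) →ₗ[R] R ⧸ Ideal.ofList ys)
    (hf : ∀ u : (Ideal.ofList ys).colon (I : Set R), (u : R) ∈ Ideal.ofList ys → f u = 0)
    (h : ∀ s ∈ P, ∃ r, ∀ u, s • f u = Ideal.Quotient.mk (Ideal.ofList ys) (r * u)) :
    ∃ s ∉ P, ∃ r, ∀ u, s • f u = Ideal.Quotient.mk (Ideal.ofList ys) (r * u) := by
  let 𝔵 := Ideal.ofList ys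
  let U := 𝔵.colon (I : Set R)
  have := isPrime_quotientPrime hIP
  let φ := toLocalQuotient I P
  obtain ⟨rs, hlen, hrs, hm⟩ := hS.exists_regularOver (quotientPrime I P) le_rfl
    (by exact_mod_cast hP)
  obtain ⟨y, x, rfl⟩ := List.length_eq_two.mp hlen
  obtain ⟨⟨-, hx⟩, hy⟩ := hrs
  rw [Ideal.ofList_nil, bot_sup_eq] at hx
  rw [Ideal.ofList_singleton, bot_sup_eq] at hy
  obtain ⟨a, w, hw, rfl⟩ := exists_mul_eq_toLocalQuotient x
  obtain ⟨b, w', hw', rfl⟩ := exists_mul_eq_toLocalQuotient y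
  have haP : a ∈ P := by
    rw [← toLocalQuotient_mem_maximalIdeal hIP, ← Ideal.mul_unit_mem_iff_mem _ hw]
    exact hm _ (by simp)
  have hbP : b ∈ P := by
    rw [← toLocalQuotient_mem_maximalIdeal hIP, ← Ideal.mul_unit_mem_iff_mem _ hw']
    exact hm _ (by simp)
  have ha : ∀ e, φ a * e = 0 → e = 0 := fun e he => by
    refine hx e ?_
    rw [Ideal.mem_bot, mul_right_comm, he, zero_mul]
  obtain ⟨α, hα⟩ := h a haP
  obtain ⟨β, hβ⟩ := h b hbP
  have hmem : a * β - b * α ∈ I := by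
    refine mem_of_forall_mul_mem hys hyI hI hS fun u hu => ?_
    have h1 : a • b • f ⟨u, hu⟩ = b • a • f ⟨u, hu⟩ := smul_comm _ _ _
    rw [hα, hβ] at h1
    have h2 : a * (β * u) - b * (α * u) ∈ 𝔵 := Ideal.Quotient.eq.mp h1
    convert h2 using 1; ring
  have hφ : φ a * φ β = φ b * φ α := by
    rw [← map_mul, ← map_mul, ← sub_eq_zero, ← map_sub]
    exact (toLocalQuotient_eq_zero_iff hIP).mpr
      ⟨1, (Ideal.ne_top_iff_one P).mp (Ideal.IsPrime.ne_top'), by rwa [one_mul]⟩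
  obtain ⟨w₁, hw₁⟩ := hw.exists_right_inv
  obtain ⟨e, he⟩ := Ideal.mem_span_singleton'.mp (hy (φ α) (Ideal.mem_span_singleton'.mpr
    ⟨w₁ * w' * φ β, by linear_combination (φ a * φ β * w') * hw₁ + w' * hφ⟩))
  obtain ⟨γ, s, hs, hγ⟩ := exists_mul_toLocalQuotient_eq hIP (e * w)
  obtain ⟨s', hs', hsI⟩ := (toLocalQuotient_eq_zero_iff hIP (r := s * α - γ * a)).mp (by
    rw [map_sub, map_mul, map_mul, ← hγ]
    linear_combination (-φ s) * he)
  have hss : s' * s ∉ P := fun h' => (Ideal.IsPrime.mem_or_mem ‹_› h').elim hs' hs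
  let k : U →ₗ[R] R ⧸ 𝔵 := (s' * s) • f - (s' * γ) • (𝔵.mkQ ∘ₗ U.subtype)
  have hk : ∀ u, k u = (s' * s) • f u - Ideal.Quotient.mk 𝔵 (s' * γ * u) := fun u => rfl
  have hak : ∀ u, a • k u = 0 := fun u => by
    rw [hk, smul_sub, smul_comm, hα]
    refine Ideal.Quotient.eq_zero_iff_mem.mpr (?_ : s' * s * (α * u) - a * (s' * γ * u) ∈ 𝔵)
    have := mem_colon_iff.mp u.2 _ hsI
    convert this using 1; ring
  have hIk : ∀ i ∈ I, ∀ u, i • k u = 0 := fun i hi u => by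
    have hiu : ((i • u : U) : R) ∈ 𝔵 := mem_colon_iff.mp u.2 i hi
    rw [← map_smul, hk, hf _ hiu, smul_zero, zero_sub, neg_eq_zero]
    exact Ideal.Quotient.eq_zero_iff_mem.mpr (Ideal.mul_mem_left _ _ hiu)
  -- The error `k` is killed by `a` and `I`. A value nonzero at `P` would yield an associated prime
  -- of `𝔵` below `P` containing both; having height `d`, it is minimal over `I`, hence associated
  -- to `R ⧸ I`, contrary to the regularity of `a`.
  obtain ⟨t, ht, htk⟩ := exists_forall_smul_eq_zero (P := P) k fun u => by
    by_contra! hcon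
    obtain ⟨z, hz⟩ := Ideal.Quotient.mk_surjective (k u)
    have hmk : ∀ r, r • k u = 0 ↔ r * z ∈ 𝔵 := fun r => by
      rw [← hz]
      exact Ideal.Quotient.eq_zero_iff_mem
    obtain ⟨c, P', hP', hle, hc⟩ := exists_assoc_le (𝔶 := 𝔵) (Q := P) (v := z)
      fun s hs h' => hcon s hs ((hmk s).mpr h')
    have hA : AssocAt 𝔵 P' := ⟨hP', _, hc⟩
    have hzP : ∀ r, r * z ∈ 𝔵 → r ∈ P' := fun r hr => (hc r).mp (by
      have := Ideal.mul_mem_left 𝔵 c hr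
      convert this using 1; ring)
    have hmin : P' ∈ I.minimalPrimes := Ideal.mem_minimalPrimes_of_height_le
      (fun i hi => hzP i ((hmk i).mp (hIk i hi u))) (by rw [hA.height_eq hys, hI])
    obtain ⟨-, v, hv⟩ := assocAt_of_mem_minimalPrimes hmin
    have hav : φ v = 0 := ha _ (by
      rw [← map_mul]
      exact (toLocalQuotient_eq_zero_iff hIP).mpr
        ⟨1, (Ideal.ne_top_iff_one P).mp (Ideal.IsPrime.ne_top'), by
          rw [one_mul]
          exact (hv a).mpr (hzP a ((hmk a).mp (hak u)))⟩)
    obtain ⟨t, ht, htv⟩ := (toLocalQuotient_eq_zero_iff hIP).mp hav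
    exact ht (hle ((hv t).mp htv))
  refine ⟨t * (s' * s), fun h' => (Ideal.IsPrime.mem_or_mem ‹_› h').elim ht hss,
    t * (s' * γ), fun u => ?_⟩
  have := htk u
  rw [hk, smul_sub, sub_eq_zero, smul_smul] at this
  rw [this, mul_assoc t]
  rfl

/-- When `R ⧸ I` satisfies `S₂`, the maps from its canonical module `(𝔵 : I) / 𝔵` to `R ⧸ 𝔵` are
multiplications. -/
theorem exists_eq_mul (hys : RegularOver ⊥ ys) (hyI : Ideal.ofList ys ≤ I)
    (hI : I.height = ys.length) (hS : SerreCondition 2 (R ⧸ I))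
    (f : (Ideal.ofList ys).colon (I : Set R) →ₗ[R] R ⧸ Ideal.ofList ys)
    (hf : ∀ u : (Ideal.ofList ys).colon (I : Set R), (u : R) ∈ Ideal.ofList ys → f u = 0) :
    ∃ r, ∀ u, f u = Ideal.Quotient.mk (Ideal.ofList ys) (r * u) := by
  let 𝔵 := Ideal.ofList ys
  let 𝔠 : Ideal R :=
    { carrier := {s | ∃ r, ∀ u, s • f u = Ideal.Quotient.mk 𝔵 (r * u)}
      add_mem' := fun {s s'} ⟨r, hr⟩ ⟨r', hr'⟩ => ⟨r + r', fun u => by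
        rw [add_smul, hr, hr', ← map_add, add_mul]⟩
      zero_mem' := ⟨0, fun u => by rw [zero_smul, zero_mul, map_zero]⟩
      smul_mem' := fun t s ⟨r, hr⟩ => ⟨t * r, fun u => by
        rw [smul_eq_mul, mul_smul, hr, mul_assoc]
        rfl⟩ }
  have h𝔠 : ∀ s, s ∈ 𝔠 ↔ ∃ r, ∀ u, s • f u = Ideal.Quotient.mk 𝔵 (r * u) := fun s => Iff.rfl
  by_cases htop : 𝔠 = ⊤
  · obtain ⟨r, hr⟩ := (h𝔠 1).mp (htop ▸ Submodule.mem_top)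
    exact ⟨r, fun u => by rw [← hr, one_smul]⟩
  exfalso
  obtain ⟨P, hP, -⟩ := Ideal.exists_minimalPrimes_le (le_maximalIdeal htop)
  have hPp := hP.1.1
  -- Replacing `f` by `v • f` makes the ideal of good multipliers equal to the prime `P`, so a good
  -- multiplier outside `P` is a contradiction.
  obtain ⟨-, v, hv⟩ := assocAt_of_mem_minimalPrimes hP
  have hvP : ∀ s, s ∈ P ↔ ∃ r, ∀ u, s • (v • f) u = Ideal.Quotient.mk 𝔵 (r * u) := fun s => by
    rw [← hv, h𝔠]
    simp only [LinearMap.smul_apply, smul_smul]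
  have hf' : ∀ u : 𝔵.colon (I : Set R), (u : R) ∈ 𝔵 → (v • f) u = 0 := fun u hu => by
    rw [LinearMap.smul_apply, hf u hu, smul_zero]
  suffices H : ∃ s ∉ P, ∃ r, ∀ u, s • (v • f) u = Ideal.Quotient.mk 𝔵 (r * u) by
    obtain ⟨s, hs, h⟩ := H
    exact hs ((hvP s).mpr h)
  have hIP : I ≤ P := fun i hi => (hvP i).mpr ⟨0, fun u => by
    rw [← map_smul, hf' _ (mem_colon_iff.mp u.2 i hi), zero_mul, map_zero]⟩
  by_cases hcase : P.height = ys.length ∨ P.height = ys.length + 1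
  · exact exists_smul_eq_mul_of_height_le hys hyI hIP hcase _ hf'
  push Not at hcase
  refine exists_smul_eq_mul_of_two_le_height hys hyI hI hS hIP ?_ _ hf' fun s hs => (hvP s).mp hs
  obtain ⟨P₀, hP₀, hle⟩ := Ideal.exists_minimalPrimes_le hIP
  have := hP₀.1.1
  have hht := hS.height_eq hI hP₀
  have hlt : P₀ < P := lt_of_le_of_ne hle fun h => hcase.1 (h ▸ hht)
  by_contra hcon
  refine hcase.2 ?_
  rw [← hht]
  refine height_eq_add_one hlt fun P' hP' hlt' hle => ?_
  by_contra hne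
  exact hcon (two_le_height_quotientPrime hP₀.1.2 hlt' (lt_of_le_of_ne hle hne))

/-- Evaluation at `1` identifies Ω with `(𝔵 : I) / 𝔵`, where `exists_eq_mul` applies. -/
theorem exists_eq_smul_canonicalInclusion (hys : RegularOver ⊥ ys) (hyI : Ideal.ofList ys ≤ I)
    (hI : I.height = ys.length) (hS : SerreCondition 2 (R ⧸ I))
    (h : CanonicalModule I (Ideal.ofList ys) →ₗ[R] R ⧸ Ideal.ofList ys) :
    ∃ r : R, ∀ ω, h ω = r • canonicalInclusion I (Ideal.ofList ys) ω := by
  let 𝔵 := Ideal.ofList ys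
  let U := 𝔵.colon (I : Set R)
  have hrange : ∀ u : U, ∃ ω : CanonicalModule I 𝔵,
      canonicalInclusion I 𝔵 ω = Ideal.Quotient.mk 𝔵 u := fun u => by
    refine (mem_range_canonicalInclusion _).mpr fun i hi => ?_
    exact Ideal.Quotient.eq_zero_iff_mem.mpr (mem_colon_iff.mp u.2 i hi)
  choose j hj using hrange
  have hinj := canonicalInclusion_injective I 𝔵
  let j' : U →ₗ[R] CanonicalModule I 𝔵 :=
    { toFun := j
      map_add' := fun u u' => hinj (by rw [map_add, hj, hj, hj, Submodule.coe_add, map_add])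
      map_smul' := fun r u => hinj (by rw [map_smul, hj, hj]; rfl) }
  obtain ⟨r, hr⟩ := exists_eq_mul hys hyI hI hS (h ∘ₗ j') fun (u : U) hu => by
    have : j u = 0 := hinj (by rw [hj, map_zero]; exact Ideal.Quotient.eq_zero_iff_mem.mpr hu)
    change h (j u) = 0
    rw [this, map_zero]
  refine ⟨r, fun ω => ?_⟩
  obtain ⟨u, hu⟩ := Ideal.Quotient.mk_surjective (canonicalInclusion I 𝔵 ω)
  have huU : u ∈ U := mem_colon_iff.mpr fun i hi => by
    have := (mem_range_canonicalInclusion _).mp ⟨ω, rfl⟩ i hi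
    rw [← hu] at this
    exact Ideal.Quotient.eq_zero_iff_mem.mp this
  have hω : j ⟨u, huU⟩ = ω := hinj (by rw [hj, hu])
  have h1 : h (j ⟨u, huU⟩) = _ := hr ⟨u, huU⟩
  rw [hω] at h1
  rw [h1, ← hu]
  rfl

/-- If the sequence were shorter than the height, unmixedness would keep `I` out of every associated
prime of its quotient, and prime avoidance would extend it. -/
theorem length_eq_of_isMaximalRegularSequence {d : ℕ} {xs : List R} (hI : I.height = d)
    (hxs : IsMaximalRegularSequence I xs) : xs.length = d := by
  have hreg : RegularOver ⊥ xs.reverse := by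
    rw [← isWeaklyRegular_reverse_iff, List.reverse_reverse]
    exact hxs.regular.toIsWeaklyRegular
  obtain ⟨P, hP, hIP, hht⟩ := Ideal.exists_isPrime_height_eq hI
  have hle := length_le_height hreg (P := P) fun x hx => hIP (hxs.mem x (List.mem_reverse.mp hx))
  rw [hht, List.length_reverse] at hle
  refine le_antisymm (by exact_mod_cast hle) ?_
  by_contra! hlt
  have hA : ∀ Q, AssocAt (Ideal.ofList xs.reverse) Q → ¬ I ≤ Q := fun Q hQ hIQ => by
    have h1 := Ideal.height_mono hIQ
    rw [hQ.height_eq hreg, hI, List.length_reverse] at h1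
    exact absurd hlt (not_lt.mpr (by exact_mod_cast h1))
  obtain ⟨y, hy, hy', -⟩ := exists_nzdMod hA hA
  refine hxs.maximal y hy ?_
  have hIm : I ≤ maximalIdeal R := hIP.trans (le_maximalIdeal hP.ne_top)
  rw [IsLocalRing.isRegular_iff_isWeaklyRegular_of_subset_maximalIdeal]
  · have : RegularOver ⊥ (xs ++ [y]).reverse := by
      rw [List.reverse_append]
      exact ⟨hreg, by rwa [bot_sup_eq]⟩
    rwa [← isWeaklyRegular_reverse_iff, List.reverse_reverse] at this
  · intro x hx
    rcases List.mem_append.mp hx with hx | hx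
    · exact hIm (hxs.mem x hx)
    · exact hIm (List.mem_singleton.mp hx ▸ hy)

end Endomorphisms

end DuttaSyz

theorem proposition1p6 {R : Type u} [CommRing R] [IsRegularLocalRing R] (d : ℕ) :
    (∀ (x : Fin d → R) (lam : R) (J : Ideal R) (a : Fin (d + 1) → R),
      a = Fin.snoc x lam → J = Ideal.span (Set.range a) →
      IsRegular R (List.ofFn x) → J.height = d →
      ∀ ha : ∀ i, a i ∈ maximalIdeal R,
        DuttaSyz.koszulToTor a ha (d + 1) = 0 →
        ∀ L : DuttaSyz.MinimalFreeResolution R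
            (DuttaSyz.CanonicalModule J (Ideal.span (Set.range x))),
          DuttaSyz.HasFreeSummand R (L.Syz d)) ∧
    (∀ (I : Ideal R), I.height = d → DuttaSyz.SerreCondition 2 (R ⧸ I) →
      ∀ xs : List R, DuttaSyz.IsMaximalRegularSequence I xs →
        ∀ L : DuttaSyz.MinimalFreeResolution R
            (DuttaSyz.CanonicalModule I (Ideal.ofList xs)),
          DuttaSyz.HasFreeSummand R (L.Syz d) →
          DuttaSyz.canonicalTorMap I (Ideal.ofList xs) d ≠ 0) := by
  refine ⟨fun x lam J a hax hJ hx _ ha h L =>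
    DuttaSyz.hasFreeSummand_of_koszulToTor_eq_zero x lam J a hax hJ hx ha h L, ?_⟩
  intro I hI hS xs hxs L hL
  -- This places the top of the Koszul complex in the degree of the syzygy.
  obtain rfl := DuttaSyz.length_eq_of_isMaximalRegularSequence hI hxs
  have hreg : DuttaSyz.RegularOver ⊥ xs.reverse := by
    rw [← DuttaSyz.isWeaklyRegular_reverse_iff, List.reverse_reverse]
    exact hxs.regular.toIsWeaklyRegular
  have hmem : ∀ y ∈ xs.reverse, y ∈ I := fun y hy => hxs.mem y (List.mem_reverse.mp hy)
  have hend := DuttaSyz.exists_eq_smul_canonicalInclusion hreg (Ideal.span_le.mpr hmem)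
    (by rw [hI, List.length_reverse]) hS
  rw [DuttaSyz.ofList_reverse] at hend
  have key := DuttaSyz.canonicalTorMap_ne_zero hreg (DuttaSyz.ofList_reverse xs) hmem hend L
  rw [List.length_reverse] at key
  exact key hL
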